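/- **Conventions.** Let $X$ and $Y$ be proper metric spaces (closed bounded sets are compact). An ample $X$-module is a separable complex Hilbert space $H_X$ with a non-degenerate $*$-homomorphism $\rho:C_0(X)\to B(H_X)$ such that $\rho(\varphi)$ is not compact for every $\varphi\neq 0$; we write $\varphi$ for $\rho(\varphi)$. For $T\in B(H_X,H_Y)$, $\operatorname{supp}(T)\subset Y\times X$ is the complement of the set of $(y,x)$ for which there are $\varphi\in C_0(X)$, $\psi\in C_0(Y)$ with $\psi T\varphi=0$, $\varphi(x)\ne0$, $\psi(y)\neq 0$. For $T\in B(H_X)$, $\operatorname{prop}(T)=\sup\{d(x,y):(y,x)\in\operatorname{supp}(T)\}$. The Roe algebra $C^*(X)$ is the norm closure of the set of $T\in B(H_X)$ with $\operatorname{prop}(T)<\infty$ and $T\varphi$ compact for all $\varphi\in C_0(X)$; it is filtered by $C^*(X)_r=\overline{\{T\in C^*(X):\operatorname{prop}(T)<r\}}$, $r>0$. For a $C^*$-algebra $A$ with such a filtration $(A_r)_{r>0}$, let $\tilde A$ be its unitization, $\tilde A_r=A_r+\mathbb C$, and $\rho_A:\tilde A\to\mathbb C$ the canonical projection. For $\varepsilon,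 r>0$ let $$P_n^{\varepsilon,r}=\{p\in M_n(\tilde A_r):p=p^*,\ \|p^2-p\|<\varepsilon\},\qquad U_n^{\varepsilon,r}=\{u\in M_n(\tilde A_r):\|u^*u-1\|<\varepsilon,\ \|uu^*-1\|<\varepsilon\},$$ and $P_\infty^{\varepsilon,r}=\bigcup_{n\ge1}P_n^{\varepsilon,r}$, $U_\infty^{\varepsilon,r}=\bigcup_{n\ge1}U_n^{\varepsilon,r}$ along the inclusions $p\mapsto\operatorname{diag}(p,0)$ and $u\mapsto\operatorname{diag}(u,1)$. For $0<\varepsilon<\frac14$ and $r>0$, $K_1^{\varepsilon,r}(A)$ is the quotient of $U_\infty^{\varepsilon,r}$ by homotopy in $U_\infty^{3\varepsilon,2r}$. $K_0^{\varepsilon,r}(A)$ is the set of those classes $[p,\ell]$ in $(P_\infty^{\varepsilon,r}\times\mathbb N)/\!\sim$ with $\operatorname{rank}\chi_{[1/2,\infty)}(\rho_A(p))=\ell$, where $(p,\ell)\sim(q,\ell')$ if for some $k\ge1$ the matrices $\operatorname{diag}(p,I_{k+\ell'})$ and $\operatorname{diag}(q,I_{k+\ell})$ are homotopic in $P_\infty^{\varepsilon,r}$.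 A map $f:X\to Y$ is coarse if it is Borel, $\sup\{d(f(x_1),f(x_2)):d(x_1,x_2)<s\}<\infty$ for all $s\geq 0$, and preimages of bounded sets are bounded. For $\delta>0$, a $\delta$-cover of $f$ is an isometry $V:H_X\to H_Y$ with $d(y,f(x))<\delta$ for all $(y,x)\in\operatorname{supp}(V)$. Then $T\mapsto VTV^*$ is a $*$-homomorphism $\operatorname{Ad}(V):C^*(X)\to C^*(Y)$; we extend it unitally to $\tilde C^*(X)\to\tilde C^*(Y)$ and entrywise to matrices. **Theorem.** Let $f,g:X\to Y$ be coarse maps and let $F:[0,1]\times X\to Y$ be a continuous map with $F(0,\cdot)=f$ and $F(1,\cdot)=g$ such that each $F(t,\cdot)$ is proper, each $F(t,\cdot)$ is Lipschitz with the same constant $c\ge0$, and the family $\{F(\cdot,x):[0,1]\to Y\}_{x\in X}$ is uniformly equicontinuous. Let $\delta>0$, let $H_X$ and $H_Y$ be ample modules over $X$ and $Y$, and let $V_f,V_g:H_X\to H_Y$ be $\delta$-covers of $f$ and $g$. Then for all $r>0$ and all $\varepsilon>0$ with $21\varepsilon<\frac14$, the maps induced by $\operatorname{Ad}(V_f)$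 and $\operatorname{Ad}(V_g)$ (that is, $[p,\ell]\mapsto[\operatorname{Ad}(V)(p),\ell]$ for $*=0$ and $[u]\mapsto[\operatorname{Ad}(V)(u)]$ for $*=1$) agree: $$\operatorname{Ad}(V_f)_*=\operatorname{Ad}(V_g)_*:K_*^{\varepsilon,r}(C^*(X))\longrightarrow K_*^{21\varepsilon,\,5(cr+2\delta)}(C^*(Y)),\qquad *=0,1.$$ -/

import Mathlib

open Set Topology Filter
open scoped ZeroAtInfty ENNReal NNReal InnerProductSpace

namespace ControlledK

/-! ### Modules over a locally compact space, supports and propagation -/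

/-- An ample `X`-module structure on the Hilbert space `H`: a non-degenerate `*`-representation
of `C₀(X)` on `H` in which no nonzero function acts as a compact operator. -/
structure AmpleModule (X : Type*) [TopologicalSpace X] (H : Type*) [NormedAddCommGroup H]
    [InnerProductSpace ℂ H] [CompleteSpace H] where
  /-- The representation `ρ : C₀(X) → B(H)`. -/
  rep : C₀(X, ℂ) →⋆ₙₐ[ℂ] (H →L[ℂ] H)
  /-- Non-degeneracy: `ρ(C₀(X)) H` spans a dense subspace of `H`. -/
  nondegenerate :
    (Submodule.span ℂ {w : H | ∃ (φ : C₀(X, ℂ)) (v : H), rep φ v = w}).topologicalClosure = ⊤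
  /-- Ampleness. -/
  not_compact : ∀ φ : C₀(X, ℂ), φ ≠ 0 → ¬ IsCompactOperator (rep φ)

section Support

variable {X Y Z : Type*} [TopologicalSpace X] [TopologicalSpace Y] [TopologicalSpace Z]
  {HX HY HZ : Type*}
  [NormedAddCommGroup HX] [InnerProductSpace ℂ HX] [CompleteSpace HX]
  [NormedAddCommGroup HY] [InnerProductSpace ℂ HY] [CompleteSpace HY]
  [NormedAddCommGroup HZ] [InnerProductSpace ℂ HZ] [CompleteSpace HZ]

/-- The support of `T : H_X → H_Y`, a subset of `Y × X`. -/
def opSupport (MX : AmpleModule X HX) (MY : AmpleModule Y HY) (T : HX →L[ℂ] HY) : Set (Y × X) :=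
  {p | ∃ (f : C₀(X, ℂ)) (g : C₀(Y, ℂ)),
    (MY.rep g) ∘L T ∘L (MX.rep f) = 0 ∧ f p.2 ≠ 0 ∧ g p.1 ≠ 0}ᶜ

variable {MX : AmpleModule X HX} {MY : AmpleModule Y HY} {MZ : AmpleModule Z HZ}

theorem notMem_opSupport {T : HX →L[ℂ] HY} {p : Y × X} :
    p ∉ opSupport MX MY T ↔ ∃ (f : C₀(X, ℂ)) (g : C₀(Y, ℂ)),
      (MY.rep g) ∘L T ∘L (MX.rep f) = 0 ∧ f p.2 ≠ 0 ∧ g p.1 ≠ 0 := by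
  simp [opSupport]

theorem isClosed_opSupport (T : HX →L[ℂ] HY) : IsClosed (opSupport MX MY T) := by
  rw [← isOpen_compl_iff, isOpen_iff_mem_nhds]
  intro p hp
  obtain ⟨f, g, h, hf, hg⟩ := notMem_opSupport.1 hp
  have h1 : ∀ᶠ q : Y × X in 𝓝 p, f q.2 ≠ 0 :=
    ((map_continuous f).comp continuous_snd).continuousAt.eventually_ne hf
  have h2 : ∀ᶠ q : Y × X in 𝓝 p, g q.1 ≠ 0 :=
    ((map_continuous g).comp continuous_fst).continuousAt.eventually_ne hg
  filter_upwards [h1, h2] with q hq1 hq2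
  exact notMem_opSupport.2 ⟨f, g, h, hq1, hq2⟩

theorem opSupport_add_subset (S T : HX →L[ℂ] HY) :
    opSupport MX MY (S + T) ⊆ opSupport MX MY S ∪ opSupport MX MY T := by
  intro p hp
  by_contra hcon
  rw [mem_union, not_or] at hcon
  obtain ⟨f, g, h, hf, hg⟩ := notMem_opSupport.1 hcon.1
  obtain ⟨f', g', h', hf', hg'⟩ := notMem_opSupport.1 hcon.2
  refine notMem_opSupport.2 ⟨f * f', g' * g, ?_, ?_, ?_⟩ hp
  · have e1 : MX.rep (f * f') = MX.rep f' ∘L MX.rep f := by rw [mul_comm, map_mul]; rfl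
    have e2 : MX.rep (f * f') = MX.rep f ∘L MX.rep f' := by rw [map_mul]; rfl
    have e3 : MY.rep (g' * g) = MY.rep g ∘L MY.rep g' := by rw [mul_comm, map_mul]; rfl
    have e4 : MY.rep (g' * g) = MY.rep g' ∘L MY.rep g := by rw [map_mul]; rfl
    rw [ContinuousLinearMap.add_comp, ContinuousLinearMap.comp_add]
    have h1 : MY.rep (g' * g) ∘L S ∘L MX.rep (f * f') =
        MY.rep g' ∘L (MY.rep g ∘L S ∘L MX.rep f) ∘L MX.rep f' := by
      rw [e2, e4]; rfl
    have h2 : MY.rep (g' * g) ∘L T ∘L MX.rep (f * f') =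
        MY.rep g ∘L (MY.rep g' ∘L T ∘L MX.rep f') ∘L MX.rep f := by
      rw [e1, e3]; rfl
    rw [h1, h2, h, h']
    simp
  · simp [hf, hf']
  · simp [hg, hg']

theorem opSupport_smul_subset (c : ℂ) (T : HX →L[ℂ] HY) :
    opSupport MX MY (c • T) ⊆ opSupport MX MY T := by
  intro p hp
  by_contra hcon
  obtain ⟨f, g, h, hf, hg⟩ := notMem_opSupport.1 hcon
  refine notMem_opSupport.2 ⟨f, g, ?_, hf, hg⟩ hp
  rw [ContinuousLinearMap.smul_comp, ContinuousLinearMap.comp_smul, h, smul_zero]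

theorem adjoint_rep (f : C₀(X, ℂ)) :
    ContinuousLinearMap.adjoint (MX.rep f) = MX.rep (star f) := by
  rw [map_star]; rfl

theorem opSupport_adjoint_subset (T : HX →L[ℂ] HY) :
    opSupport MY MX (ContinuousLinearMap.adjoint T) ⊆ Prod.swap ⁻¹' opSupport MX MY T := by
  intro p hp
  by_contra hcon
  obtain ⟨f, g, h, hf, hg⟩ := notMem_opSupport.1 hcon
  refine notMem_opSupport.2 ⟨star g, star f, ?_, ?_, ?_⟩ hp
  · have := congrArg ContinuousLinearMap.adjoint h
    rw [ContinuousLinearMap.adjoint_comp, ContinuousLinearMap.adjoint_comp, adjoint_rep,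
      adjoint_rep, map_zero] at this
    exact this
  · simpa using hg
  · simpa using hf

theorem exists_cutoff {X : Type*} [TopologicalSpace X] [T2Space X] [LocallyCompactSpace X]
    {K U : Set X} (hK : IsCompact K) (hU : IsOpen U) (hKU : K ⊆ U) :
    ∃ φ : C₀(X, ℂ), HasCompactSupport φ ∧ tsupport φ ⊆ U ∧ (∀ x, ‖1 - φ x‖ ≤ 1) ∧
      ∃ W, IsOpen W ∧ K ⊆ W ∧ ∀ x ∈ W, φ x = 1 := by
  obtain ⟨W, hWo, hKW, hWU, hWc⟩ := exists_open_between_and_isCompact_closure hK hU hKU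
  obtain ⟨f, hf1, hfc, hfU, hf01⟩ := exists_continuousMap_one_of_isCompact_subset_isOpen hWc hU hWU
  have hts : tsupport (fun x => (f x : ℂ)) ⊆ tsupport f := by
    refine closure_mono fun x hx => ?_
    simpa using hx
  have hcs : HasCompactSupport (fun x => (f x : ℂ)) :=
    HasCompactSupport.of_support_subset_isCompact hfc ((subset_tsupport _).trans hts)
  have hcont : Continuous (fun x => (f x : ℂ)) := Complex.continuous_ofReal.comp f.continuous
  refine ⟨⟨⟨fun x => (f x : ℂ), hcont⟩, hcs.is_zero_at_infty⟩, hcs, hts.trans hfU, ?_,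
    W, hWo, hKW, ?_⟩
  · intro x
    change ‖(1 : ℂ) - (f x : ℂ)‖ ≤ 1
    have h := hf01 x
    rw [← Complex.ofReal_one, ← Complex.ofReal_sub, Complex.norm_real, Real.norm_eq_abs, abs_le]
    constructor <;> linarith [h.1, h.2]
  · intro x hx
    change (f x : ℂ) = 1
    have := hf1 (subset_closure hx)
    simp [this]

theorem exists_compactSupport_norm_sub_le {X : Type*} [TopologicalSpace X] [T2Space X]
    [LocallyCompactSpace X] (f : C₀(X, ℂ)) {ε : ℝ} (hε : 0 < ε) :
    ∃ g : C₀(X, ℂ), HasCompactSupport g ∧ ‖f - g‖ ≤ ε := by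
  have h0 : ∀ᶠ x in cocompact X, f x ∈ Metric.ball (0 : ℂ) ε :=
    (zero_at_infty f) (Metric.ball_mem_nhds 0 hε)
  obtain ⟨K, hK, hKs⟩ := mem_cocompact.1 h0
  obtain ⟨φ, hφc, -, hφ1, W, -, hKW, hW⟩ := exists_cutoff hK isOpen_univ (subset_univ K)
  refine ⟨φ * f, ?_, ?_⟩
  · exact hφc.mul_right
  · rw [← ZeroAtInftyContinuousMap.norm_toBCF_eq_norm, BoundedContinuousFunction.norm_le hε.le]
    intro x
    change ‖f x - φ x * f x‖ ≤ ε
    by_cases hx : x ∈ K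
    · rw [hW x (hKW hx)]; simpa using hε.le
    · have h2 : ‖f x‖ < ε := by simpa using hKs hx
      calc ‖f x - φ x * f x‖ = ‖1 - φ x‖ * ‖f x‖ := by rw [← norm_mul]; ring_nf
        _ ≤ 1 * ‖f x‖ := by gcongr; exact hφ1 x
        _ ≤ ε := by linarith

/-- A compactly supported function lies in every ideal of `C₀(X)` with no zero on its support. -/
theorem mem_of_ideal {X : Type*} [TopologicalSpace X] [T2Space X] (I : Set C₀(X, ℂ))
    (h0 : (0 : C₀(X, ℂ)) ∈ I)
    (hadd : ∀ a ∈ I, ∀ b ∈ I, a + b ∈ I) (hmul : ∀ a, ∀ b ∈ I, a * b ∈ I)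
    {f : C₀(X, ℂ)} (hf : HasCompactSupport f)
    (h : ∀ x ∈ tsupport f, ∃ k ∈ I, k x ≠ 0) : f ∈ I := by
  have key : ∃ s ∈ I, (∀ x, 0 ≤ (s x).re) ∧ ∀ x ∈ tsupport f, 0 < (s x).re := by
    refine IsCompact.induction_on
      (p := fun K => ∃ s ∈ I, (∀ x, 0 ≤ (s x).re) ∧ ∀ x ∈ K, 0 < (s x).re) hf ?_ ?_ ?_ ?_
    · exact ⟨0, h0, by simp, by simp⟩
    · rintro K L hKL ⟨s, hs, hs0, hsL⟩
      exact ⟨s, hs, hs0, fun x hx => hsL x (hKL hx)⟩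
    · rintro K L ⟨s, hs, hs0, hsK⟩ ⟨t, ht, ht0, htL⟩
      refine ⟨s + t, hadd s hs t ht, fun x => ?_, ?_⟩
      · simpa using add_nonneg (hs0 x) (ht0 x)
      · rintro x (hx | hx)
        · simpa using add_pos_of_pos_of_nonneg (hsK x hx) (ht0 x)
        · simpa using add_pos_of_nonneg_of_pos (hs0 x) (htL x hx)
    · intro x hx
      obtain ⟨k, hk, hkx⟩ := h x hx
      have hre : ∀ y, ((star k * k) y).re = ‖k y‖ ^ 2 := by
        intro y
        change ((starRingEnd ℂ) (k y) * k y).re = _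
        rw [Complex.conj_mul']
        norm_cast
      refine ⟨{y | k y ≠ 0}, ?_, star k * k, hmul _ k hk, fun y => ?_, fun y hy => ?_⟩
      · exact mem_nhdsWithin_of_mem_nhds ((map_continuous k).continuousAt.eventually_ne hkx)
      · rw [hre]; positivity
      · rw [hre]
        have : k y ≠ 0 := hy
        positivity
  obtain ⟨s, hsI, -, hs⟩ := key
  have hs' : ∀ x ∈ tsupport f, s x ≠ 0 := fun x hx h0 => by
    have := hs x hx
    simp [h0] at this
  have hcont : Continuous (fun x => f x / s x) := by
    refine continuous_of_tsupport fun x hx => ?_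
    have hx' : x ∈ tsupport f := by
      refine closure_mono ?_ hx
      intro y hy hfy
      exact hy (by simp [hfy])
    exact (map_continuous f).continuousAt.div (map_continuous s).continuousAt (hs' x hx')
  have hcs : HasCompactSupport (fun x => f x / s x) := by
    refine hf.mono ?_
    intro y hy hfy
    exact hy (by simp [hfy])
  let q : C₀(X, ℂ) := ⟨⟨fun x => f x / s x, hcont⟩, hcs.is_zero_at_infty⟩
  have : f = q * s := by
    ext x
    change f x = f x / s x * s x
    by_cases hx : x ∈ tsupport f
    · rw [div_mul_cancel₀ _ (hs' x hx)]
    · rw [image_eq_zero_of_notMem_tsupport hx]; simp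
  rw [this]
  exact hmul q s hsI

theorem norm_rep_le (f : C₀(X, ℂ)) : ‖MX.rep f‖ ≤ ‖f‖ := NonUnitalStarAlgHom.norm_apply_le _ _

/-- If the supports of `f`, `g` are compact and their product misses `supp T`, then `g T f = 0`. -/
theorem comp_eq_zero [T2Space X] [T2Space Y] [LocallyCompactSpace Y] {T : HX →L[ℂ] HY} {f : C₀(X, ℂ)} {g : C₀(Y, ℂ)}
    (hf : HasCompactSupport f) (hg : HasCompactSupport g)
    (h : ∀ y ∈ tsupport g, ∀ x ∈ tsupport f, (y, x) ∉ opSupport MX MY T) :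
    MY.rep g ∘L T ∘L MX.rep f = 0 := by
  refine mem_of_ideal {g : C₀(Y, ℂ) | MY.rep g ∘L T ∘L MX.rep f = 0} ?_ ?_ ?_ hg ?_
  · simp
  · intro a ha b hb
    simp only [mem_ofPred_eq] at *
    rw [map_add, ContinuousLinearMap.add_comp, ha, hb, add_zero]
  · intro a b hb
    simp only [mem_ofPred_eq] at *
    have : MY.rep (a * b) ∘L T ∘L MX.rep f = MY.rep a ∘L (MY.rep b ∘L T ∘L MX.rep f) := by
      rw [map_mul]; rfl
    rw [this, hb, ContinuousLinearMap.comp_zero]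
  intro y hy
  have := mem_of_ideal {f : C₀(X, ℂ) | ∃ k : C₀(Y, ℂ), k y ≠ 0 ∧ MY.rep k ∘L T ∘L MX.rep f = 0}
    ?_ ?_ ?_ hf ?_
  · obtain ⟨k, hk, hk'⟩ := this
    exact ⟨k, hk', hk⟩
  · obtain ⟨φ, -, -, -, W, -, hyW, hW⟩ :=
      exists_cutoff (isCompact_singleton (x := y)) isOpen_univ (subset_univ _)
    exact ⟨φ, by rw [hW y (hyW rfl)]; simp, by simp⟩
  · rintro a ⟨k, hk, ha⟩ b ⟨l, hl, hb⟩
    refine ⟨k * l, by simp [hk, hl], ?_⟩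
    have h1 : MY.rep (k * l) ∘L T ∘L MX.rep (a + b) =
        MY.rep l ∘L (MY.rep k ∘L T ∘L MX.rep a) + MY.rep k ∘L (MY.rep l ∘L T ∘L MX.rep b) := by
      have e1 : MY.rep (k * l) = MY.rep l ∘L MY.rep k := by rw [mul_comm, map_mul]; rfl
      have e2 : MY.rep (k * l) = MY.rep k ∘L MY.rep l := by rw [map_mul]; rfl
      rw [map_add, ContinuousLinearMap.comp_add, ContinuousLinearMap.comp_add]
      nth_rewrite 1 [e1]
      rw [e2]; rfl
    rw [h1, ha, hb]; simp
  · rintro a b ⟨k, hk, hb⟩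
    refine ⟨k, hk, ?_⟩
    have : MY.rep k ∘L T ∘L MX.rep (a * b) = (MY.rep k ∘L T ∘L MX.rep b) ∘L MX.rep a := by
      rw [mul_comm, map_mul]; rfl
    rw [this, hb, ContinuousLinearMap.zero_comp]
  · intro x hx
    obtain ⟨f', g', h1, h2, h3⟩ := notMem_opSupport.1 (h y hy x hx)
    exact ⟨f', ⟨g', h3, h1⟩, h2⟩

theorem eq_zero_of_rep [T2Space X] [LocallyCompactSpace X] {w : HX}
    (h : ∀ f : C₀(X, ℂ), HasCompactSupport f → MX.rep f w = 0) : w = 0 := by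
  have h' : ∀ f : C₀(X, ℂ), MX.rep f w = 0 := by
    intro f
    rw [← norm_le_zero_iff]
    refine le_of_forall_pos_le_add fun ε hε => ?_
    obtain ⟨g, hg, hfg⟩ := exists_compactSupport_norm_sub_le f
      (show 0 < ε / (‖w‖ + 1) by positivity)
    have : MX.rep f w = MX.rep (f - g) w := by rw [map_sub]; simp [h g hg]
    rw [this]
    calc ‖MX.rep (f - g) w‖ ≤ ‖MX.rep (f - g)‖ * ‖w‖ := ContinuousLinearMap.le_opNorm _ _
      _ ≤ ε / (‖w‖ + 1) * ‖w‖ := by gcongr; exact (norm_rep_le _).trans hfg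
      _ ≤ ε / (‖w‖ + 1) * (‖w‖ + 1) := by gcongr; linarith
      _ = 0 + ε := by field_simp; ring
  have hperp : ∀ v ∈ (Submodule.span ℂ {w : HX | ∃ (φ : C₀(X, ℂ)) (v : HX),
      MX.rep φ v = w}).topologicalClosure, ⟪v, w⟫_ℂ = 0 := by
    intro v hv
    have hcl : IsClosed {v : HX | ⟪v, w⟫_ℂ = 0} :=
      isClosed_eq (by fun_prop) continuous_const
    refine closure_minimal ?_ hcl hv
    intro u hu
    induction hu using Submodule.span_induction with
    | mem u hu =>
      obtain ⟨φ, v, rfl⟩ := hu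
      change ⟪MX.rep φ v, w⟫_ℂ = 0
      rw [← ContinuousLinearMap.adjoint_inner_right, adjoint_rep, h', inner_zero_right]
    | zero => simp
    | add a b _ _ ha hb =>
      simp only [mem_ofPred_eq] at *
      rw [inner_add_left, ha, hb, add_zero]
    | smul c a _ ha =>
      simp only [mem_ofPred_eq] at *
      rw [inner_smul_left, ha, mul_zero]
  have := hperp w (by rw [MX.nondegenerate]; trivial)
  exact inner_self_eq_zero.1 this

/-- If `supp S` maps `supp f` into a compact set near which `φ = 1`, then `φ S f = S f`. -/
theorem absorb [T2Space X] [T2Space Y] [LocallyCompactSpace Y] {S : HX →L[ℂ] HY} {f : C₀(X, ℂ)}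
    (hf : HasCompactSupport f) {φ : C₀(Y, ℂ)} {W : Set Y} (hW : IsOpen W)
    (hφ : ∀ y ∈ W, φ y = 1)
    (h : ∀ y, ∀ x ∈ tsupport f, (y, x) ∈ opSupport MX MY S → y ∈ W) :
    MY.rep φ ∘L S ∘L MX.rep f = S ∘L MX.rep f := by
  ext v
  rw [← sub_eq_zero]
  refine eq_zero_of_rep (MX := MY) fun k hk => ?_
  have hk' : HasCompactSupport (k * φ - k : C₀(Y, ℂ)) :=
    HasCompactSupport.sub hk.mul_right hk
  have key := comp_eq_zero (MX := MX) (MY := MY) (T := S) hf hk' ?_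
  · have := congrArg (fun A : HX →L[ℂ] HY => A v) key
    simp only [ContinuousLinearMap.comp_apply, map_sub, map_mul] at this ⊢
    exact this
  · intro y hy x hx hyx
    have hyW := h y x hx hyx
    have : y ∉ tsupport (k * φ - k : C₀(Y, ℂ)) := by
      rw [notMem_tsupport_iff_eventuallyEq]
      filter_upwards [hW.mem_nhds hyW] with z hz
      change k z * φ z - k z = 0
      rw [hφ z hz]; ring
    exact this hy

/-- If `supp S` is proper over `X`, then `supp (T S) ⊆ supp T ∘ supp S`. -/
theorem opSupport_comp [T2Space X] [LocallyCompactSpace X] [T2Space Y] [LocallyCompactSpace Y]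
    [T2Space Z] [LocallyCompactSpace Z] {S : HX →L[ℂ] HY} {T : HY →L[ℂ] HZ}
    (hS : ∀ x, ∃ P ∈ 𝓝 x, ∃ K, IsCompact K ∧ ∀ x' ∈ P, ∀ y, (y, x') ∈ opSupport MX MY S → y ∈ K)
    {z : Z} {x : X} (hzx : (z, x) ∈ opSupport MX MZ (T ∘L S)) :
    ∃ y, (z, y) ∈ opSupport MY MZ T ∧ (y, x) ∈ opSupport MX MY S := by
  by_contra hcon
  push Not at hcon
  obtain ⟨P, hP, K, hK, hPK⟩ := hS x
  -- the slice of `supp S` over `x`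
  have hcl : IsClosed {y | (y, x) ∈ opSupport MX MY S} :=
    (isClosed_opSupport S).preimage (by fun_prop)
  have hslice : IsCompact {y | (y, x) ∈ opSupport MX MY S} :=
    hK.of_isClosed_subset hcl fun y hy => hPK x (mem_of_mem_nhds hP) y hy
  obtain ⟨W, U, hW, hU, hzW, hsU, hWU⟩ := generalized_tube_lemma (isCompact_singleton (x := z))
    hslice (isClosed_opSupport (MX := MY) (MY := MZ) T).isOpen_compl (by
      rintro ⟨z', y⟩ ⟨hz', hy⟩ hmem
      obtain rfl : z' = z := hz'
      exact hcon y hmem hy)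
  obtain ⟨U', P', -, hP', hKU, hxP, hUP⟩ := generalized_tube_lemma (hK.diff hU)
    (isCompact_singleton (x := x)) (isClosed_opSupport (MX := MX) (MY := MY) S).isOpen_compl (by
      rintro ⟨y, x'⟩ ⟨hy, hx'⟩ hmem
      obtain rfl : x' = x := hx'
      exact hy.2 (hsU hmem))
  obtain ⟨f, hfc, hfs, -, Wf, -, hxWf, hWf⟩ := exists_cutoff (isCompact_singleton (x := x))
    (hP'.inter isOpen_interior) (singleton_subset_iff.2
      (show x ∈ P' ∩ interior P from ⟨hxP rfl, mem_interior_iff_mem_nhds.2 hP⟩))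
  obtain ⟨g, hgc, hgs, -, Wg, -, hzWg, hWg⟩ := exists_cutoff (isCompact_singleton (x := z)) hW hzW
  have hK1c : IsCompact (Prod.fst '' ((K ×ˢ tsupport f) ∩ opSupport MX MY S)) :=
    (((hK.prod hfc).inter_right (isClosed_opSupport S)).image continuous_fst)
  have hK1 : ∀ y, ∀ x' ∈ tsupport f, (y, x') ∈ opSupport MX MY S →
      y ∈ Prod.fst '' ((K ×ˢ tsupport f) ∩ opSupport MX MY S) := by
    intro y x' hx' hy
    exact ⟨(y, x'), ⟨⟨hPK x' (interior_subset (hfs hx').2) y hy, hx'⟩, hy⟩, rfl⟩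
  have hK1U : Prod.fst '' ((K ×ˢ tsupport f) ∩ opSupport MX MY S) ⊆ U := by
    rintro _ ⟨⟨y, x'⟩, ⟨⟨hyK, hx'⟩, hy⟩, rfl⟩
    by_contra hyU
    exact hUP (mk_mem_prod (hKU ⟨hyK, hyU⟩) (hfs hx').1) hy
  obtain ⟨φ, hφc, hφU, -, V, hV, hKV, hφV⟩ := exists_cutoff hK1c hU hK1U
  have h1 : MY.rep φ ∘L S ∘L MX.rep f = S ∘L MX.rep f :=
    absorb hfc hV hφV fun y x' hx' hy => hKV (hK1 y x' hx' hy)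
  have h2 : MZ.rep g ∘L T ∘L MY.rep φ = 0 := comp_eq_zero hφc hgc fun z' hz' y hy =>
    hWU (mk_mem_prod (hgs hz') (hφU hy))
  refine notMem_opSupport.2 ⟨f, g, ?_, ?_, ?_⟩ hzx
  · calc MZ.rep g ∘L (T ∘L S) ∘L MX.rep f = MZ.rep g ∘L T ∘L (S ∘L MX.rep f) := rfl
      _ = MZ.rep g ∘L T ∘L (MY.rep φ ∘L S ∘L MX.rep f) := by rw [h1]
      _ = (MZ.rep g ∘L T ∘L MY.rep φ) ∘L (S ∘L MX.rep f) := rfl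
      _ = 0 := by rw [h2, ContinuousLinearMap.zero_comp]
  · rw [hWf x (hxWf rfl)]; simp
  · rw [hWg z (hzWg rfl)]; simp

/-- The adjoint of a compact operator between Hilbert spaces is compact. -/
theorem isCompactOperator_adjoint {A : HX →L[ℂ] HY} (hA : IsCompactOperator A) :
    IsCompactOperator (ContinuousLinearMap.adjoint A) := by
  set B := ContinuousLinearMap.adjoint A with hB
  have hAB : IsCompactOperator (A ∘L B) := hA.comp_clm B
  change IsCompactOperator (B : HY →ₗ[ℂ] HX)
  rw [isCompactOperator_iff_isCompact_closure_image_closedBall (B : HY →ₗ[ℂ] HX) zero_lt_one]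
  refine TotallyBounded.isCompact_of_isClosed (TotallyBounded.closure ?_) isClosed_closure
  have htb : TotallyBounded ((A ∘L B) '' Metric.closedBall 0 1) := by
    have h1 : IsCompactOperator ((A ∘L B : HY →L[ℂ] HY) : HY →ₗ[ℂ] HY) := hAB
    rw [isCompactOperator_iff_isCompact_closure_image_closedBall _ zero_lt_one] at h1
    exact h1.totallyBounded.subset subset_closure
  have hest : ∀ u ∈ Metric.closedBall (0 : HY) 1, ∀ v ∈ Metric.closedBall (0 : HY) 1,
      dist (B u) (B v) ^ 2 ≤ 2 * dist ((A ∘L B) u) ((A ∘L B) v) := by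
    intro u hu v hv
    rw [dist_eq_norm, dist_eq_norm, ← map_sub, ← map_sub]
    have h1 : ‖B (u - v)‖ ^ 2 = RCLike.re ⟪(A ∘L B) (u - v), u - v⟫_ℂ := by
      rw [ContinuousLinearMap.comp_apply, ← ContinuousLinearMap.adjoint_inner_right A, ← hB,
        inner_self_eq_norm_sq]
    have h2 : ‖u - v‖ ≤ 2 := by
      have := norm_sub_le u v
      simp only [Metric.mem_closedBall, dist_zero_right] at hu hv
      linarith
    rw [h1]
    calc RCLike.re ⟪(A ∘L B) (u - v), u - v⟫_ℂ ≤ ‖⟪(A ∘L B) (u - v), u - v⟫_ℂ‖ :=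
          RCLike.re_le_norm _
      _ ≤ ‖(A ∘L B) (u - v)‖ * ‖u - v‖ := norm_inner_le_norm _ _
      _ ≤ ‖(A ∘L B) (u - v)‖ * 2 := by gcongr
      _ = _ := mul_comm _ _
  rw [Metric.totallyBounded_iff] at htb ⊢
  intro ε hε
  obtain ⟨t, htf, hts⟩ := htb (ε ^ 2 / 4) (by positivity)
  -- choose points of the ball near the centres
  classical
  have hch : ∀ y : HY, ∃ u : HY, (∃ w ∈ Metric.closedBall (0 : HY) 1,
      (A ∘L B) w ∈ Metric.ball y (ε ^ 2 / 4)) →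
      u ∈ Metric.closedBall (0 : HY) 1 ∧ (A ∘L B) u ∈ Metric.ball y (ε ^ 2 / 4) := by
    intro y
    by_cases hy : ∃ w ∈ Metric.closedBall (0 : HY) 1, (A ∘L B) w ∈ Metric.ball y (ε ^ 2 / 4)
    · obtain ⟨w, hw⟩ := hy
      exact ⟨w, fun _ => hw⟩
    · exact ⟨0, fun h => absurd h hy⟩
  choose c hc using hch
  refine ⟨(fun y => B (c y)) '' t, htf.image _, ?_⟩
  rintro _ ⟨u, hu, rfl⟩
  obtain ⟨y, hyt, huy⟩ := mem_iUnion₂.1 (hts ⟨u, hu, rfl⟩)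
  obtain ⟨h1, h2⟩ := hc y ⟨u, hu, huy⟩
  refine mem_iUnion₂.2 ⟨B (c y), ⟨y, hyt, rfl⟩, ?_⟩
  have h3 := hest u hu (c y) h1
  have h4 : dist ((A ∘L B) u) ((A ∘L B) (c y)) < ε ^ 2 / 2 := by
    have := dist_triangle_right ((A ∘L B) u) ((A ∘L B) (c y)) y
    rw [Metric.mem_ball] at huy h2
    linarith
  rw [Metric.mem_ball]
  change dist (B u) (B (c y)) < ε
  exact lt_of_pow_lt_pow_left₀ 2 hε.le (by linarith)

/-- Local compactness of an operator can be tested on compactly supported functions. -/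
theorem isCompactOperator_of_compactSupport [T2Space X] [LocallyCompactSpace X] {T : HX →L[ℂ] HY}
    (h : ∀ f : C₀(X, ℂ), HasCompactSupport f → IsCompactOperator (T ∘L MX.rep f))
    (f : C₀(X, ℂ)) : IsCompactOperator (T ∘L MX.rep f) := by
  have hcl : IsClosed {A : HX →L[ℂ] HY | IsCompactOperator A} :=
    isClosed_setOfPred_isCompactOperator
  refine hcl.closure_subset (Metric.mem_closure_iff.2 fun ε hε => ?_)
  obtain ⟨g, hg, hfg⟩ := exists_compactSupport_norm_sub_le f
    (show 0 < ε / (‖T‖ + 1) by positivity)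
  refine ⟨T ∘L MX.rep g, h g hg, ?_⟩
  rw [dist_eq_norm, ← ContinuousLinearMap.comp_sub, ← map_sub]
  calc ‖T ∘L MX.rep (f - g)‖ ≤ ‖T‖ * ‖MX.rep (f - g)‖ := ContinuousLinearMap.opNorm_comp_le _ _
    _ ≤ ‖T‖ * (ε / (‖T‖ + 1)) := by gcongr; exact (norm_rep_le _).trans hfg
    _ < (‖T‖ + 1) * (ε / (‖T‖ + 1)) := by gcongr; linarith
    _ = ε := by field_simp

end Support

/-! ### The Roe algebra and its filtration -/

section Roe

variable {X : Type*} [MetricSpace X] {H : Type*}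
  [NormedAddCommGroup H] [InnerProductSpace ℂ H] [CompleteSpace H]

/-- The propagation `sup {d(x, y) | (y, x) ∈ supp T}` of `T ∈ B(H_X)`. -/
noncomputable def propagation (M : AmpleModule X H) (T : H →L[ℂ] H) : ℝ≥0∞ :=
  ⨆ p ∈ opSupport M M T, edist p.2 p.1

variable {M : AmpleModule X H}

theorem edist_le_propagation {T : H →L[ℂ] H} {y x : X} (h : (y, x) ∈ opSupport M M T) :
    edist x y ≤ propagation M T :=
  le_iSup₂ (f := fun (p : X × X) (_ : p ∈ opSupport M M T) => edist p.2 p.1) (y, x) h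

theorem propagation_add_le (S T : H →L[ℂ] H) :
    propagation M (S + T) ≤ max (propagation M S) (propagation M T) := by
  refine iSup₂_le fun p hp => ?_
  rcases opSupport_add_subset S T hp with h | h
  · exact le_max_of_le_left (edist_le_propagation h)
  · exact le_max_of_le_right (edist_le_propagation h)

theorem propagation_smul_le (c : ℂ) (T : H →L[ℂ] H) :
    propagation M (c • T) ≤ propagation M T :=
  iSup₂_le fun _ hp => edist_le_propagation (opSupport_smul_subset c T hp)

theorem propagation_star_le (T : H →L[ℂ] H) : propagation M (star T) ≤ propagation M T := by
  refine iSup₂_le fun p hp => ?_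
  rw [edist_comm]
  exact edist_le_propagation (opSupport_adjoint_subset T hp)

variable [ProperSpace X]

theorem propagation_zero : propagation M (0 : H →L[ℂ] H) = 0 := by
  refine le_antisymm (iSup₂_le fun p hp => ?_) zero_le
  exfalso
  obtain ⟨f, -, -, -, W, -, hW, hf⟩ :=
    exists_cutoff (isCompact_singleton (x := p.2)) isOpen_univ (subset_univ _)
  obtain ⟨g, -, -, -, W', -, hW', hg⟩ :=
    exists_cutoff (isCompact_singleton (x := p.1)) isOpen_univ (subset_univ _)
  exact notMem_opSupport.2 ⟨f, g, by simp, by rw [hf _ (hW rfl)]; simp,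
    by rw [hg _ (hW' rfl)]; simp⟩ hp

theorem opSupport_proper {T : H →L[ℂ] H} (hT : propagation M T < ⊤) (x : X) :
    ∃ P ∈ 𝓝 x, ∃ K, IsCompact K ∧ ∀ x' ∈ P, ∀ y, (y, x') ∈ opSupport M M T → y ∈ K := by
  refine ⟨Metric.closedBall x 1, Metric.closedBall_mem_nhds x one_pos,
    Metric.closedBall x (1 + (propagation M T).toReal), isCompact_closedBall _ _, ?_⟩
  intro x' hx' y hy
  have h1 : dist x' y ≤ (propagation M T).toReal := by
    rw [dist_edist]
    exact ENNReal.toReal_mono hT.ne (edist_le_propagation hy)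
  rw [Metric.mem_closedBall] at hx' ⊢
  have := dist_triangle_left y x x'
  linarith

theorem propagation_mul_le {S T : H →L[ℂ] H} (hT : propagation M T < ⊤) :
    propagation M (S * T) ≤ propagation M S + propagation M T := by
  refine iSup₂_le fun p hp => ?_
  obtain ⟨y, h1, h2⟩ := opSupport_comp (opSupport_proper hT) hp
  calc edist p.2 p.1 ≤ edist p.2 y + edist y p.1 := edist_triangle _ _ _
    _ ≤ propagation M T + propagation M S :=
        add_le_add (edist_le_propagation h2) (edist_le_propagation h1)
    _ = _ := add_comm _ _

theorem isCompactOperator_star {T : H →L[ℂ] H} (hT : propagation M T < ⊤)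
    (hc : ∀ f, IsCompactOperator (T ∘L M.rep f)) (f : C₀(X, ℂ)) :
    IsCompactOperator (star T ∘L M.rep f) := by
  refine isCompactOperator_of_compactSupport (fun f hf => ?_) f
  have hT' : propagation M (star T) < ⊤ := (propagation_star_le T).trans_lt hT
  have hK : IsCompact (Metric.cthickening (propagation M (star T)).toReal (tsupport f)) :=
    hf.cthickening
  obtain ⟨φ, hφ, -, -, W, hW, hKW, hφW⟩ := exists_cutoff hK isOpen_univ (subset_univ _)
  have h1 : M.rep φ ∘L star T ∘L M.rep f = star T ∘L M.rep f := by
    refine absorb hf hW hφW fun y x hx hy => hKW ?_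
    refine Metric.mem_cthickening_of_dist_le y x _ _ hx ?_
    rw [dist_comm, dist_edist]
    exact ENNReal.toReal_mono hT'.ne (edist_le_propagation hy)
  have h2 : star T ∘L M.rep f =
      ContinuousLinearMap.adjoint (M.rep (star f) ∘L (T ∘L M.rep (star φ))) := by
    rw [← h1, ContinuousLinearMap.adjoint_comp, ContinuousLinearMap.adjoint_comp, adjoint_rep,
      adjoint_rep, star_star, star_star]
    rfl
  rw [h2]
  exact isCompactOperator_adjoint ((hc (star φ)).clm_comp _)

/-- `C*_alg(H_X)`: the locally compact operators of finite propagation. -/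
noncomputable def algRoe (M : AmpleModule X H) : NonUnitalStarSubalgebra ℂ (H →L[ℂ] H) where
  carrier := {T | (∀ f : C₀(X, ℂ), IsCompactOperator (T ∘L M.rep f)) ∧ propagation M T < ⊤}
  add_mem' := fun {S T} hS hT =>
    ⟨fun f => by rw [ContinuousLinearMap.add_comp]; exact (hS.1 f).add (hT.1 f),
      (propagation_add_le S T).trans_lt (max_lt hS.2 hT.2)⟩
  zero_mem' := ⟨fun f => by rw [ContinuousLinearMap.zero_comp]; exact isCompactOperator_zero,
    by rw [propagation_zero]; exact ENNReal.zero_lt_top⟩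
  mul_mem' := fun {S T} hS hT =>
    ⟨fun f => (hT.1 f).clm_comp S,
      (propagation_mul_le hT.2).trans_lt (ENNReal.add_lt_top.2 ⟨hS.2, hT.2⟩)⟩
  smul_mem' := fun c T hT =>
    ⟨fun f => by rw [ContinuousLinearMap.smul_comp]; exact (hT.1 f).smul c,
      (propagation_smul_le c T).trans_lt hT.2⟩
  star_mem' := fun {T} hT =>
    ⟨isCompactOperator_star hT.2 hT.1, (propagation_star_le T).trans_lt hT.2⟩

/-- The Roe algebra `C*(H_X)`: the norm closure of `C*_alg(H_X)` in `B(H_X)`. -/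
noncomputable def roeAlgebra (M : AmpleModule X H) : NonUnitalStarSubalgebra ℂ (H →L[ℂ] H) :=
  (algRoe M).topologicalClosure

instance isClosed_roeAlgebra (M : AmpleModule X H) :
    IsClosed (roeAlgebra M : Set (H →L[ℂ] H)) :=
  (algRoe M).isClosed_topologicalClosure

noncomputable instance roeCStarAlgebra (M : AmpleModule X H) :
    NonUnitalCStarAlgebra (roeAlgebra M) := inferInstance

end Roe

/-- A filtration of a `C*`-algebra `A` by closed self-adjoint linear subspaces `A_r`, `r > 0`
(the values at `r ≤ 0` are irrelevant). -/
structure CStarFiltration (A : Type*) [NonUnitalCStarAlgebra A] where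
  /-- The subspace `A_r`. -/
  level : ℝ → Set A
  zero_mem : ∀ r, 0 < r → 0 ∈ level r
  add_mem : ∀ r, 0 < r → ∀ a ∈ level r, ∀ b ∈ level r, a + b ∈ level r
  smul_mem : ∀ r, 0 < r → ∀ (c : ℂ), ∀ a ∈ level r, c • a ∈ level r
  isClosed : ∀ r, 0 < r → IsClosed (level r)
  mono : ∀ r s, 0 < r → r ≤ s → level r ⊆ level s
  star_mem : ∀ r, 0 < r → ∀ a ∈ level r, star a ∈ level r
  mul_mem : ∀ r s, 0 < r → 0 < s → ∀ a ∈ level r, ∀ b ∈ level s, a * b ∈ level (r + s)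
  dense : Dense (⋃ r ∈ Ioi (0 : ℝ), level r)

section RoeFiltration

variable {X : Type*} [MetricSpace X] [ProperSpace X] {H : Type*}
  [NormedAddCommGroup H] [InnerProductSpace ℂ H] [CompleteSpace H]

/-- The filtration of the Roe algebra by propagation: `C*(X)_r` is the closure of the set of
elements whose propagation is smaller than `r`. -/
noncomputable def roeFiltration (M : AmpleModule X H) : CStarFiltration (roeAlgebra M) where
  level r := closure {T : roeAlgebra M | propagation M (T : H →L[ℂ] H) < ENNReal.ofReal r}
  zero_mem r hr := subset_closure (by
    change propagation M (0 : H →L[ℂ] H) < _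
    rw [propagation_zero]; exact ENNReal.ofReal_pos.2 hr)
  add_mem r _ a ha b hb := map_mem_closure₂ continuous_add ha hb fun S hS T hT =>
    (propagation_add_le (S : H →L[ℂ] H) T).trans_lt (max_lt hS hT)
  smul_mem r _ c a ha := map_mem_closure (continuous_const_smul c) ha fun T hT =>
    (propagation_smul_le c (T : H →L[ℂ] H)).trans_lt hT
  isClosed _ _ := isClosed_closure
  mono r s _ hrs := closure_mono fun T hT => lt_of_lt_of_le hT (ENNReal.ofReal_le_ofReal hrs)
  star_mem r _ a ha := map_mem_closure continuous_star ha fun T hT =>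
    (propagation_star_le (T : H →L[ℂ] H)).trans_lt hT
  mul_mem r s hr hs a ha b hb := map_mem_closure₂ continuous_mul ha hb fun S hS T hT => by
    have hT' : propagation M (T : H →L[ℂ] H) < ⊤ := lt_of_lt_of_le hT le_top
    refine (propagation_mul_le (S := (S : H →L[ℂ] H)) hT').trans_lt ?_
    rw [ENNReal.ofReal_add hr.le hs.le]
    exact ENNReal.add_lt_add hS hT
  dense := by
    intro T
    rw [Metric.mem_closure_iff]
    intro ε hε
    obtain ⟨S, hS, hST⟩ := Metric.mem_closure_iff.1 T.2 ε hε
    have hS' : S ∈ roeAlgebra M := subset_closure hS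
    refine ⟨⟨S, hS'⟩, mem_iUnion₂.2 ⟨(propagation M S).toReal + 1, ?_, subset_closure ?_⟩, hST⟩
    · exact add_pos_of_nonneg_of_pos ENNReal.toReal_nonneg one_pos
    · change propagation M S < _
      rw [ENNReal.lt_ofReal_iff_toReal_lt hS.2.ne]
      linarith

end RoeFiltration

/-! ### Controlled K-theory -/

section KTheory

variable {A B : Type*} [NonUnitalCStarAlgebra A] [NonUnitalCStarAlgebra B]

/-- `M_n(Ã)` with its `C*`-norm, where `Ã` is the unitization of `A`. -/
abbrev MatUnitization (A : Type*) [NonUnitalCStarAlgebra A] (n : ℕ) : Type _ :=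
  CStarMatrix (Fin n) (Fin n) (Unitization ℂ A)

/-- `M_n(Ã_r)` where `Ã_r = A_r + ℂ`. -/
def matLevel (F : CStarFiltration A) (r : ℝ) (n : ℕ) : Set (MatUnitization A n) :=
  {a | ∀ i j, (a i j).snd ∈ F.level r}

/-- The `(ε, r)`-quasi-projections in `M_n(Ã)`. -/
def quasiProjections (F : CStarFiltration A) (ε r : ℝ) (n : ℕ) : Set (MatUnitization A n) :=
  {p | p ∈ matLevel F r n ∧ star p = p ∧ ‖p * p - p‖ < ε}

/-- The `(ε, r)`-quasi-unitaries in `M_n(Ã)`. -/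
def quasiUnitaries (F : CStarFiltration A) (ε r : ℝ) (n : ℕ) : Set (MatUnitization A n) :=
  {u | u ∈ matLevel F r n ∧ ‖star u * u - 1‖ < ε ∧ ‖u * star u - 1‖ < ε}

/-- `diag(a, d, …, d)` of size `N ≥ n`, for `a` of size `n`. -/
def pad {R : Type*} [Zero R] (d : R) {n : ℕ} (N : ℕ) (a : CStarMatrix (Fin n) (Fin n) R) :
    CStarMatrix (Fin N) (Fin N) R :=
  CStarMatrix.ofMatrix fun i j =>
    if h : i.1 < n ∧ j.1 < n then a ⟨i.1, h.1⟩ ⟨j.1, h.2⟩ else if i = j then d else 0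

/-- Representatives of elements of `P_∞^{ε,r}(Ã) = ⋃_{n ≥ 1} P_n^{ε,r}(Ã)`. -/
structure QuasiProj (F : CStarFiltration A) (ε r : ℝ) where
  size : ℕ
  pos : 0 < size
  val : MatUnitization A size
  mem : val ∈ quasiProjections F ε r size

/-- Representatives of elements of `U_∞^{ε,r}(Ã) = ⋃_{n ≥ 1} U_n^{ε,r}(Ã)`. -/
structure QuasiUnit (F : CStarFiltration A) (ε r : ℝ) where
  size : ℕ
  pos : 0 < size
  val : MatUnitization A size
  mem : val ∈ quasiUnitaries F ε r size

/-- Homotopy in `P_∞^{ε,r}(Ã)`: the matrices become homotopic through `(ε, r)`-quasi-projections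
after adding zeros on the diagonal. -/
def HomotopicProj (F : CStarFiltration A) (ε r : ℝ) {m n : ℕ} (p : MatUnitization A m)
    (q : MatUnitization A n) : Prop :=
  ∃ N, m ≤ N ∧ n ≤ N ∧ JoinedIn (quasiProjections F ε r N) (pad 0 N p) (pad 0 N q)

/-- Homotopy in `U_∞^{ε,r}(Ã)`: the matrices become homotopic through `(ε, r)`-quasi-unitaries
after adding ones on the diagonal. -/
def HomotopicUnit (F : CStarFiltration A) (ε r : ℝ) {m n : ℕ} (u : MatUnitization A m)
    (v : MatUnitization A n) : Prop :=
  ∃ N, m ≤ N ∧ n ≤ N ∧ JoinedIn (quasiUnitaries F ε r N) (pad 1 N u) (pad 1 N v)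

/-- The relation `(p, ℓ) ∼_{ε,r} (q, ℓ')`: for some `k ≥ 1`, `diag(p, I_{k+ℓ'})` and
`diag(q, I_{k+ℓ})` are homotopic in `P_∞^{ε,r}(Ã)`. -/
def relProj (F : CStarFiltration A) (ε r : ℝ) (x y : QuasiProj F ε r × ℕ) : Prop :=
  ∃ k, 0 < k ∧ HomotopicProj F ε r
    (pad 1 (x.1.size + (k + y.2)) x.1.val) (pad 1 (y.1.size + (k + x.2)) y.1.val)

/-- The relation `u ∼_{3ε,2r} v`: homotopy in `U_∞^{3ε,2r}(Ã)`. -/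
def relUnit (F : CStarFiltration A) (ε r : ℝ) (u v : QuasiUnit F ε r) : Prop :=
  HomotopicUnit F (3 * ε) (2 * r) u.val v.val

/-- `ρ_A(p) ∈ M_n(ℂ)`, for `ρ_A : Ã → ℂ` the canonical projection. -/
def scalarPart {n : ℕ} (p : MatUnitization A n) : Matrix (Fin n) (Fin n) ℂ :=
  Matrix.of fun i j => (p i j).fst

/-- The rank of `χ(ρ_A(p))`, where `χ` is the characteristic function of `[1/2, ∞)`. -/
noncomputable def scalarRank {n : ℕ} (p : MatUnitization A n) : ℕ :=
  (cfc (Set.indicator (Set.Ici (1 / 2 : ℝ)) (fun _ => (1 : ℝ))) (scalarPart p)).rank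

/-- `K_0^{ε,r}(A)`: the classes `[p, ℓ]` in `(P_∞^{ε,r}(Ã) × ℕ)/∼_{ε,r}` with
`rank χ(ρ_A(p)) = ℓ`. -/
def K0 (F : CStarFiltration A) (ε r : ℝ) : Type _ :=
  {x : Quot (relProj F ε r) // ∃ (p : QuasiProj F ε r) (l : ℕ),
    Quot.mk _ (p, l) = x ∧ scalarRank p.val = l}

/-- `K_1^{ε,r}(A) = U_∞^{ε,r}(Ã)/∼_{3ε,2r}`. -/
def K1 (F : CStarFiltration A) (ε r : ℝ) : Type _ := Quot (relUnit F ε r)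

/-- The unital extension `M_n(Ã) → M_n(B̃)` of a `*`-homomorphism `A → B`. -/
noncomputable def matMap (φ : A →⋆ₙₐ[ℂ] B) (n : ℕ) (a : MatUnitization A n) : MatUnitization B n :=
  CStarMatrix.mapₙₐ ((Unitization.starMap φ : Unitization ℂ A →⋆ₐ[ℂ] Unitization ℂ B) :
    Unitization ℂ A →⋆ₙₐ[ℂ] Unitization ℂ B) a

theorem matMap_apply (φ : A →⋆ₙₐ[ℂ] B) {n : ℕ} (a : MatUnitization A n) (i j : Fin n) :
    matMap φ n a i j = Unitization.starMap φ (a i j) := rfl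

theorem norm_matMap_le (φ : A →⋆ₙₐ[ℂ] B) {n : ℕ} (a : MatUnitization A n) :
    ‖matMap φ n a‖ ≤ ‖a‖ := NonUnitalStarAlgHom.norm_apply_le _ _

theorem matMap_one (φ : A →⋆ₙₐ[ℂ] B) (n : ℕ) : matMap φ n 1 = 1 := by
  refine CStarMatrix.ext fun i j => ?_
  rw [matMap_apply, CStarMatrix.one_apply, CStarMatrix.one_apply]
  split_ifs <;> simp

theorem matMap_sub (φ : A →⋆ₙₐ[ℂ] B) {n : ℕ} (a b : MatUnitization A n) :
    matMap φ n (a - b) = matMap φ n a - matMap φ n b := map_sub _ _ _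

theorem matMap_mul (φ : A →⋆ₙₐ[ℂ] B) {n : ℕ} (a b : MatUnitization A n) :
    matMap φ n (a * b) = matMap φ n a * matMap φ n b := map_mul _ _ _

theorem matMap_star (φ : A →⋆ₙₐ[ℂ] B) {n : ℕ} (a : MatUnitization A n) :
    matMap φ n (star a) = star (matMap φ n a) := map_star _ _

theorem continuous_matMap (φ : A →⋆ₙₐ[ℂ] B) (n : ℕ) : Continuous (matMap φ n) := by
  refine LipschitzWith.continuous (K := 1) (LipschitzWith.of_dist_le_mul fun a b => ?_)
  rw [dist_eq_norm, dist_eq_norm, ← matMap_sub]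
  simpa using norm_matMap_le φ (a - b)

theorem matMap_pad (φ : A →⋆ₙₐ[ℂ] B) {n : ℕ} (N : ℕ) (d : Unitization ℂ A)
    (a : MatUnitization A n) :
    matMap φ N (pad d N a) = pad (Unitization.starMap φ d) N (matMap φ n a) := by
  refine CStarMatrix.ext fun i j => ?_
  rw [matMap_apply]
  change Unitization.starMap φ (if h : i.1 < n ∧ j.1 < n then a ⟨i.1, h.1⟩ ⟨j.1, h.2⟩
      else if i = j then d else 0) = if h : i.1 < n ∧ j.1 < n then
      Unitization.starMap φ (a ⟨i.1, h.1⟩ ⟨j.1, h.2⟩)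
      else if i = j then Unitization.starMap φ d else 0
  split_ifs
  · rfl
  · rfl
  · simp

theorem matMap_mem_matLevel {F : CStarFiltration A} {G : CStarFiltration B} {φ : A →⋆ₙₐ[ℂ] B}
    {r s : ℝ} (h : MapsTo φ (F.level r) (G.level s)) {n : ℕ} {a : MatUnitization A n}
    (ha : a ∈ matLevel F r n) : matMap φ n a ∈ matLevel G s n := by
  intro i j
  rw [matMap_apply]
  have : (Unitization.starMap φ (a i j)).snd = φ (a i j).snd := by
    simp [Unitization.algebraMap_eq_inl]
  rw [this]
  exact h (ha i j)

theorem matMap_mem_quasiProjections {F : CStarFiltration A} {G : CStarFiltration B}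
    {φ : A →⋆ₙₐ[ℂ] B} {ε η r s : ℝ} (hε : ε ≤ η) (h : MapsTo φ (F.level r) (G.level s)) (n : ℕ) :
    MapsTo (matMap φ n) (quasiProjections F ε r n) (quasiProjections G η s n) := by
  rintro p ⟨h1, h2, h3⟩
  refine ⟨matMap_mem_matLevel h h1, by rw [← matMap_star, h2], ?_⟩
  rw [← matMap_mul, ← matMap_sub]
  exact (norm_matMap_le φ _).trans_lt (h3.trans_le hε)

theorem matMap_mem_quasiUnitaries {F : CStarFiltration A} {G : CStarFiltration B}
    {φ : A →⋆ₙₐ[ℂ] B} {ε η r s : ℝ} (hε : ε ≤ η) (h : MapsTo φ (F.level r) (G.level s)) (n : ℕ) :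
    MapsTo (matMap φ n) (quasiUnitaries F ε r n) (quasiUnitaries G η s n) := by
  rintro u ⟨h1, h2, h3⟩
  refine ⟨matMap_mem_matLevel h h1, ?_, ?_⟩
  · rw [← matMap_star, ← matMap_mul, ← matMap_one φ, ← matMap_sub]
    exact (norm_matMap_le φ _).trans_lt (h2.trans_le hε)
  · rw [← matMap_star, ← matMap_mul, ← matMap_one φ, ← matMap_sub]
    exact (norm_matMap_le φ _).trans_lt (h3.trans_le hε)

theorem scalarRank_matMap (φ : A →⋆ₙₐ[ℂ] B) {n : ℕ} (p : MatUnitization A n) :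
    scalarRank (matMap φ n p) = scalarRank p := by
  have : scalarPart (matMap φ n p) = scalarPart p := by
    ext i j
    change (Unitization.starMap φ (p i j)).fst = (p i j).fst
    simp [Unitization.algebraMap_eq_inl]
  rw [scalarRank, scalarRank, this]

/-- Image of a quasi-projection under (the unital extension of) a `*`-homomorphism. -/
noncomputable def QuasiProj.map {F : CStarFiltration A} {G : CStarFiltration B}
    (φ : A →⋆ₙₐ[ℂ] B) {ε η r s : ℝ} (hε : ε ≤ η) (h : MapsTo φ (F.level r) (G.level s))
    (p : QuasiProj F ε r) : QuasiProj G η s :=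
  ⟨p.size, p.pos, matMap φ p.size p.val, matMap_mem_quasiProjections hε h p.size p.mem⟩

/-- Image of a quasi-unitary under (the unital extension of) a `*`-homomorphism. -/
noncomputable def QuasiUnit.map {F : CStarFiltration A} {G : CStarFiltration B}
    (φ : A →⋆ₙₐ[ℂ] B) {ε η r s : ℝ} (hε : ε ≤ η) (h : MapsTo φ (F.level r) (G.level s))
    (u : QuasiUnit F ε r) : QuasiUnit G η s :=
  ⟨u.size, u.pos, matMap φ u.size u.val, matMap_mem_quasiUnitaries hε h u.size u.mem⟩

theorem relProj_map {F : CStarFiltration A} {G : CStarFiltration B}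
    (φ : A →⋆ₙₐ[ℂ] B) {ε η r s : ℝ} (hε : ε ≤ η) (h : MapsTo φ (F.level r) (G.level s))
    (x y : QuasiProj F ε r × ℕ) (hxy : relProj F ε r x y) :
    relProj G η s (x.1.map φ hε h, x.2) (y.1.map φ hε h, y.2) := by
  obtain ⟨k, hk, N, hN, hN', hJ⟩ := hxy
  refine ⟨k, hk, N, hN, hN', ?_⟩
  have hJ' := (hJ.map (continuous_matMap φ N)).mono
    (matMap_mem_quasiProjections hε h N).image_subset
  simp only [matMap_pad, map_one, map_zero] at hJ'
  exact hJ'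

theorem relUnit_map {F : CStarFiltration A} {G : CStarFiltration B}
    (φ : A →⋆ₙₐ[ℂ] B) {ε η r s : ℝ} (hε : ε ≤ η) (h : MapsTo φ (F.level r) (G.level s))
    (h₂ : MapsTo φ (F.level (2 * r)) (G.level (2 * s)))
    (u v : QuasiUnit F ε r) (huv : relUnit F ε r u v) :
    relUnit G η s (u.map φ hε h) (v.map φ hε h) := by
  obtain ⟨N, hN, hN', hJ⟩ := huv
  refine ⟨N, hN, hN', ?_⟩
  have hJ' := (hJ.map (continuous_matMap φ N)).mono
    (matMap_mem_quasiUnitaries (show 3 * ε ≤ 3 * η by linarith) h₂ N).image_subset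
  simp only [matMap_pad, map_one] at hJ'
  exact hJ'

/-- The map `φ_* : K_0^{ε,r}(A) → K_0^{η,s}(B)`, `[p, ℓ] ↦ [φ(p), ℓ]`, induced by a
`*`-homomorphism `φ` with `φ(A_r) ⊆ B_s`, where `ε ≤ η`. -/
noncomputable def K0.map {F : CStarFiltration A} {G : CStarFiltration B}
    (φ : A →⋆ₙₐ[ℂ] B) {ε η r s : ℝ} (hε : ε ≤ η) (h : MapsTo φ (F.level r) (G.level s)) :
    K0 F ε r → K0 G η s := fun x =>
  ⟨Quot.map (fun y : QuasiProj F ε r × ℕ => (y.1.map φ hε h, y.2)) (relProj_map φ hε h) x.1, by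
    obtain ⟨_, p, l, rfl, hl⟩ := x
    exact ⟨p.map φ hε h, l, rfl, (scalarRank_matMap φ p.val).trans hl⟩⟩

/-- The map `φ_* : K_1^{ε,r}(A) → K_1^{η,s}(B)`, `[u] ↦ [φ(u)]`, induced by a `*`-homomorphism `φ`
with `φ(A_r) ⊆ B_s` and `φ(A_{2r}) ⊆ B_{2s}`, where `ε ≤ η`. -/
noncomputable def K1.map {F : CStarFiltration A} {G : CStarFiltration B}
    (φ : A →⋆ₙₐ[ℂ] B) {ε η r s : ℝ} (hε : ε ≤ η) (h : MapsTo φ (F.level r) (G.level s))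
    (h₂ : MapsTo φ (F.level (2 * r)) (G.level (2 * s))) :
    K1 F ε r → K1 G η s :=
  Quot.map (QuasiUnit.map φ hε h) (relUnit_map φ hε h h₂)

end KTheory

/-! ### Coarse maps, covering isometries and strong Lipschitz homotopies -/

section Coarse

variable {X Y : Type*} [MetricSpace X] [MetricSpace Y]

/-- The expansion function `ω_f(r) = sup {d(f x₁, f x₂) | d(x₁, x₂) < r}`. -/
noncomputable def expansion (f : X → Y) (r : ℝ) : ℝ≥0∞ :=
  ⨆ (x₁ : X) (x₂ : X) (_ : dist x₁ x₂ < r), edist (f x₁) (f x₂)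

/-- Coarse maps: Borel maps with finite expansion function for which preimages of bounded sets
are bounded. -/
structure IsCoarseMap (f : X → Y) : Prop where
  borel : @Measurable X Y (borel X) (borel Y) f
  expansion_lt_top : ∀ r : ℝ, 0 ≤ r → expansion f r < ⊤
  isBounded_preimage : ∀ K : Set Y, Bornology.IsBounded K → Bornology.IsBounded (f ⁻¹' K)

/-- `F : [0,1] × X → Y` is a strong Lipschitz homotopy from `f` to `g` whose uniform Lipschitz
constant is (bounded by) `c`. -/
structure IsStrongLipschitzHomotopy (F : unitInterval × X → Y) (f g : X → Y) (c : ℝ≥0) : Prop where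
  continuous : Continuous F
  proper : ∀ t, IsProperMap fun x => F (t, x)
  lipschitz : ∀ t, LipschitzWith c fun x => F (t, x)
  equicontinuous : UniformEquicontinuous fun (x : X) (t : unitInterval) => F (t, x)
  map_zero : ∀ x, F (0, x) = f x
  map_one : ∀ x, F (1, x) = g x

theorem IsStrongLipschitzHomotopy.lipschitz_left {F : unitInterval × X → Y} {f g : X → Y} {c : ℝ≥0}
    (h : IsStrongLipschitzHomotopy F f g c) : LipschitzWith c f := by
  have := h.lipschitz 0
  rwa [funext h.map_zero] at this

theorem IsStrongLipschitzHomotopy.lipschitz_right {F : unitInterval × X → Y} {f g : X → Y}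
    {c : ℝ≥0} (h : IsStrongLipschitzHomotopy F f g c) : LipschitzWith c g := by
  have := h.lipschitz 1
  rwa [funext h.map_one] at this

theorem edist_le_expansion (f : X → Y) {r : ℝ} {x₁ x₂ : X} (h : dist x₁ x₂ < r) :
    edist (f x₁) (f x₂) ≤ expansion f r :=
  le_iSup₂_of_le x₁ x₂ (le_iSup_of_le h le_rfl)

theorem expansion_le {f : X → Y} {c : ℝ≥0} (hf : LipschitzWith c f) (r : ℝ) :
    expansion f r ≤ ENNReal.ofReal (c * r) := by
  refine iSup₂_le fun x₁ x₂ => iSup_le fun h => ?_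
  rw [edist_dist]
  exact ENNReal.ofReal_le_ofReal ((hf.dist_le_mul x₁ x₂).trans (by gcongr))

variable {HX HY : Type*}
  [NormedAddCommGroup HX] [InnerProductSpace ℂ HX] [CompleteSpace HX]
  [NormedAddCommGroup HY] [InnerProductSpace ℂ HY] [CompleteSpace HY]

/-- The isometry `V : H_X → H_Y` is a `δ`-cover of `f`. -/
def IsCover (MX : AmpleModule X HX) (MY : AmpleModule Y HY) (f : X → Y) (δ : ℝ)
    (V : HX →ₗᵢ[ℂ] HY) : Prop :=
  ∀ y x, (y, x) ∈ opSupport MX MY V.toContinuousLinearMap → dist y (f x) < δ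

/-- `Ad(V) : B(H_X) → B(H_Y)`, `T ↦ V T V*`, for an isometry `V`. -/
noncomputable def adIsometry (V : HX →ₗᵢ[ℂ] HY) : (HX →L[ℂ] HX) →⋆ₙₐ[ℂ] (HY →L[ℂ] HY) where
  toFun T := V.toContinuousLinearMap ∘L T ∘L ContinuousLinearMap.adjoint V.toContinuousLinearMap
  map_smul' c T := by ext v; simp
  map_zero' := by ext v; simp
  map_add' S T := by ext v; simp
  map_mul' S T := by
    have h : ContinuousLinearMap.adjoint V.toContinuousLinearMap ∘L V.toContinuousLinearMap =
        ContinuousLinearMap.id ℂ HX := by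
      ext v
      refine ext_inner_right ℂ fun w => ?_
      rw [ContinuousLinearMap.comp_apply, ContinuousLinearMap.adjoint_inner_left]
      exact V.inner_map_map v w
    ext v
    have := congrArg (fun A : HX →L[ℂ] HX =>
      A (T (ContinuousLinearMap.adjoint V.toContinuousLinearMap v))) h
    simp only [ContinuousLinearMap.comp_apply, ContinuousLinearMap.id_apply] at this
    simp only [ContinuousLinearMap.comp_apply, mul_apply_eq_comp, this]
  map_star' T := by
    simp only [ContinuousLinearMap.star_eq_adjoint, ContinuousLinearMap.adjoint_comp,
      ContinuousLinearMap.adjoint_adjoint]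
    rfl

variable [ProperSpace X] {MX : AmpleModule X HX} {MY : AmpleModule Y HY}
  {f : X → Y} {δ : ℝ} {V : HX →ₗᵢ[ℂ] HY}

theorem opSupport_adjoint_proper (hf : IsCoarseMap f) (hV : IsCover MX MY f δ V) {P : Set Y}
    (hP : Bornology.IsBounded P) : ∃ K : Set X, IsCompact K ∧ ∀ y ∈ P, ∀ x,
      (x, y) ∈ opSupport MY MX (ContinuousLinearMap.adjoint V.toContinuousLinearMap) → x ∈ K := by
  have hb : Bornology.IsBounded (f ⁻¹' Metric.cthickening δ P) :=
    hf.isBounded_preimage _ hP.cthickening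
  refine ⟨closure (f ⁻¹' Metric.cthickening δ P), hb.isCompact_closure, fun y hy x hx => ?_⟩
  refine subset_closure (Metric.mem_cthickening_of_dist_le _ y _ _ hy ?_)
  rw [dist_comm]
  exact (hV y x (opSupport_adjoint_subset _ hx)).le

variable [ProperSpace Y]

theorem exists_of_mem_opSupport_adIsometry (hf : IsCoarseMap f) (hV : IsCover MX MY f δ V)
    {T : HX →L[ℂ] HX} (hT : propagation MX T < ⊤) {z y : Y}
    (h : (z, y) ∈ opSupport MY MY (adIsometry V T)) :
    ∃ x₁ x, dist z (f x₁) < δ ∧ (x₁, x) ∈ opSupport MX MX T ∧ dist y (f x) < δ := by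
  have hTV : ∀ {x₁ : X} {y : Y}, (x₁, y) ∈ opSupport MY MX
      (T ∘L ContinuousLinearMap.adjoint V.toContinuousLinearMap) →
      ∃ x, (x₁, x) ∈ opSupport MX MX T ∧ (x, y) ∈ opSupport MY MX
        (ContinuousLinearMap.adjoint V.toContinuousLinearMap) := by
    intro x₁ y h
    refine opSupport_comp (fun y => ?_) h
    obtain ⟨K, hK, hK'⟩ := opSupport_adjoint_proper hf hV
      (Metric.isBounded_closedBall (x := y) (r := 1))
    exact ⟨_, Metric.closedBall_mem_nhds y one_pos, K, hK, fun y' hy' x hx => hK' y' hy' x hx⟩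
  obtain ⟨x₁, h1, h2⟩ := opSupport_comp (S := T ∘L
    ContinuousLinearMap.adjoint V.toContinuousLinearMap) (T := V.toContinuousLinearMap)
    (MX := MY) (MY := MX) (MZ := MY) (fun y => by
      obtain ⟨K, hK, hK'⟩ := opSupport_adjoint_proper hf hV
        (Metric.isBounded_closedBall (x := y) (r := 1))
      refine ⟨_, Metric.closedBall_mem_nhds y one_pos,
        Metric.cthickening (propagation MX T).toReal K, hK.cthickening, fun y' hy' x₁ hx => ?_⟩
      obtain ⟨x, h1, h2⟩ := hTV hx
      refine Metric.mem_cthickening_of_dist_le _ x _ _ (hK' y' hy' x h2) ?_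
      rw [dist_comm, dist_edist]
      exact ENNReal.toReal_mono hT.ne (edist_le_propagation h1)) h
  obtain ⟨x, h3, h4⟩ := hTV h2
  exact ⟨x₁, x, hV _ _ h1, h3, hV _ _ (opSupport_adjoint_subset _ h4)⟩

theorem propagation_adIsometry_le (hf : IsCoarseMap f) (hV : IsCover MX MY f δ V)
    {T : HX →L[ℂ] HX} {r : ℝ} (hT : propagation MX T < ENNReal.ofReal r) :
    propagation MY (adIsometry V T) ≤ expansion f r + ENNReal.ofReal (2 * δ) := by
  refine iSup₂_le fun p hp => ?_
  obtain ⟨x₁, x, h1, h2, h3⟩ := exists_of_mem_opSupport_adIsometry hf hV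
    (hT.trans ENNReal.ofReal_lt_top) hp
  have hδ : 0 ≤ δ := dist_nonneg.trans h1.le
  have h4 : dist x x₁ < r := by
    have := (edist_le_propagation h2).trans_lt hT
    rwa [edist_lt_ofReal] at this
  calc edist p.2 p.1 ≤ edist p.2 (f x) + edist (f x) (f x₁) + edist (f x₁) p.1 :=
        edist_triangle4 _ _ _ _
    _ ≤ ENNReal.ofReal δ + expansion f r + ENNReal.ofReal δ := by
        gcongr
        · exact (edist_lt_ofReal.2 h3).le
        · exact edist_le_expansion f h4
        · rw [edist_comm]; exact (edist_lt_ofReal.2 h1).le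
    _ = _ := by rw [two_mul, ENNReal.ofReal_add hδ hδ]; ring

theorem adIsometry_mem_roeAlgebra (hf : IsCoarseMap f) (hV : IsCover MX MY f δ V)
    {T : HX →L[ℂ] HX} (hT : T ∈ roeAlgebra MX) : adIsometry V T ∈ roeAlgebra MY := by
  have hcont : Continuous (adIsometry V) :=
    AddMonoidHomClass.continuous_of_bound (adIsometry V) 1 fun T => by
      rw [one_mul]; exact NonUnitalStarAlgHom.norm_apply_le _ _
  refine map_mem_closure hcont hT fun S hS => ⟨fun g => ?_, ?_⟩
  · refine isCompactOperator_of_compactSupport (fun g hg => ?_) g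
    obtain ⟨K, hK, hK'⟩ := opSupport_adjoint_proper hf hV hg.isBounded
    obtain ⟨φ, -, -, -, W, hW, hKW, hφW⟩ := exists_cutoff hK isOpen_univ (subset_univ _)
    have h1 := absorb (MX := MY) (MY := MX) hg hW hφW fun x y hy hx => hKW (hK' y hy x hx)
    have h2 : adIsometry V S ∘L MY.rep g = V.toContinuousLinearMap ∘L ((S ∘L MX.rep φ) ∘L
        (ContinuousLinearMap.adjoint V.toContinuousLinearMap ∘L MY.rep g)) := by
      calc adIsometry V S ∘L MY.rep g = V.toContinuousLinearMap ∘L S ∘L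
            (ContinuousLinearMap.adjoint V.toContinuousLinearMap ∘L MY.rep g) := rfl
        _ = V.toContinuousLinearMap ∘L S ∘L (MX.rep φ ∘L
            ContinuousLinearMap.adjoint V.toContinuousLinearMap ∘L MY.rep g) := by rw [h1]
        _ = _ := rfl
    rw [h2]
    exact ((hS.1 φ).comp_clm _).clm_comp _
  · have h3 : propagation MX S < ENNReal.ofReal ((propagation MX S).toReal + 1) := by
      rw [ENNReal.lt_ofReal_iff_toReal_lt hS.2.ne]; linarith
    exact (propagation_adIsometry_le hf hV h3).trans_lt (ENNReal.add_lt_top.2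
      ⟨hf.expansion_lt_top _ (by positivity), ENNReal.ofReal_lt_top⟩)

/-- `Ad(V) : C*(X) → C*(Y)` for a `δ`-cover `V` of a coarse map `f : X → Y`. -/
noncomputable def adCover (hf : IsCoarseMap f) (hV : IsCover MX MY f δ V) :
    roeAlgebra MX →⋆ₙₐ[ℂ] roeAlgebra MY where
  toFun T := ⟨adIsometry V T, adIsometry_mem_roeAlgebra hf hV T.2⟩
  map_smul' c T := Subtype.ext (map_smul (adIsometry V) c (T : HX →L[ℂ] HX))
  map_zero' := Subtype.ext (map_zero (adIsometry V))
  map_add' S T := Subtype.ext (map_add (adIsometry V) (S : HX →L[ℂ] HX) T)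
  map_mul' S T := Subtype.ext (map_mul (adIsometry V) (S : HX →L[ℂ] HX) T)
  map_star' T := Subtype.ext (map_star (adIsometry V) (T : HX →L[ℂ] HX))

theorem mapsTo_adCover (hf : IsCoarseMap f) (hV : IsCover MX MY f δ V) {r s : ℝ}
    (h : expansion f r + ENNReal.ofReal (2 * δ) < ENNReal.ofReal s) :
    MapsTo (adCover hf hV) ((roeFiltration MX).level r) ((roeFiltration MY).level s) := by
  intro T hT
  have hcont : Continuous (adCover hf hV) :=
    AddMonoidHomClass.continuous_of_bound (adCover hf hV) 1 fun T => by
      rw [one_mul]; exact NonUnitalStarAlgHom.norm_apply_le _ _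
  exact map_mem_closure hcont hT fun S hS => (propagation_adIsometry_le hf hV hS).trans_lt h

theorem mapsTo_adCover_of_lipschitz (hf : IsCoarseMap f) (hV : IsCover MX MY f δ V) (hδ : 0 < δ)
    {c : ℝ≥0} (hc : LipschitzWith c f) {r : ℝ} (hr : 0 < r) :
    MapsTo (adCover hf hV) ((roeFiltration MX).level r)
      ((roeFiltration MY).level (5 * (c * r + 2 * δ))) := by
  refine mapsTo_adCover hf hV ?_
  have h : c * r + 2 * δ < 5 * (c * r + 2 * δ) := by
    have : 0 ≤ c * r := by positivity
    linarith
  calc expansion f r + ENNReal.ofReal (2 * δ)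
      ≤ ENNReal.ofReal (c * r) + ENNReal.ofReal (2 * δ) := by gcongr; exact expansion_le hc r
    _ = ENNReal.ofReal (c * r + 2 * δ) := (ENNReal.ofReal_add (by positivity) (by positivity)).symm
    _ < ENNReal.ofReal (5 * (c * r + 2 * δ)) := (ENNReal.ofReal_lt_ofReal_iff_of_nonneg (by positivity)).2 h

theorem mapsTo_adCover_of_lipschitz_two (hf : IsCoarseMap f) (hV : IsCover MX MY f δ V)
    (hδ : 0 < δ) {c : ℝ≥0} (hc : LipschitzWith c f) {r : ℝ} (hr : 0 < r) :
    MapsTo (adCover hf hV) ((roeFiltration MX).level (2 * r))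
      ((roeFiltration MY).level (2 * (5 * (c * r + 2 * δ)))) :=
  (mapsTo_adCover_of_lipschitz hf hV hδ hc (by positivity : 0 < 2 * r)).mono_right
    ((roeFiltration MY).mono _ _ (by positivity) (by linarith))

/-- `Ad(V)_* : K_0^{ε,r}(C*(X)) → K_0^{21ε,5(cr+2δ)}(C*(Y))`, `[p, ℓ] ↦ [Ad(V)(p), ℓ]`, for a
`δ`-cover `V` of a coarse `c`-Lipschitz map. -/
noncomputable def adK0 (hf : IsCoarseMap f) (hV : IsCover MX MY f δ V) (hδ : 0 < δ)
    {c : ℝ≥0} (hc : LipschitzWith c f) {ε r : ℝ} (hε : 0 < ε) (hr : 0 < r) :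
    K0 (roeFiltration MX) ε r → K0 (roeFiltration MY) (21 * ε) (5 * (c * r + 2 * δ)) :=
  K0.map (adCover hf hV) (by linarith) (mapsTo_adCover_of_lipschitz hf hV hδ hc hr)

/-- `Ad(V)_* : K_1^{ε,r}(C*(X)) → K_1^{21ε,5(cr+2δ)}(C*(Y))`, `[u] ↦ [Ad(V)(u)]`, for a
`δ`-cover `V` of a coarse `c`-Lipschitz map. -/
noncomputable def adK1 (hf : IsCoarseMap f) (hV : IsCover MX MY f δ V) (hδ : 0 < δ)
    {c : ℝ≥0} (hc : LipschitzWith c f) {ε r : ℝ} (hε : 0 < ε) (hr : 0 < r) :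
    K1 (roeFiltration MX) ε r → K1 (roeFiltration MY) (21 * ε) (5 * (c * r + 2 * δ)) :=
  K1.map (adCover hf hV) (by linarith) (mapsTo_adCover_of_lipschitz hf hV hδ hc hr)
    (mapsTo_adCover_of_lipschitz_two hf hV hδ hc hr)

end Coarse

end ControlledK

open ControlledK

set_option linter.unusedSectionVars false

/-! Uniform equicontinuity lets the homotopy be cut into finitely many steps along which the map
moves by at most `δ`. Every intermediate map is proper and `c`-Lipschitz, hence coarse, and has a
`δ`-cover by `exists_isCover`. All comparisons take place in the same target group, so chaining the
steps costs nothing. It remains to treat two covers `V₀`, `V₁` of coarse `c`-Lipschitz maps at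
distance at most `δ` (`adK_eq_of_dist_le`).

For `c² + s² = 1` (`c`, `s` now a cosine and a sine) the column `W = (c V₀, s V₁)` is an isometry,
so `T ↦ W T W*` is a `*`-homomorphism into 2 × 2 matrices over the Roe algebra of `Y`. Its entries
are multiples of the corners `Vᵢ T Vⱼ*`, whose propagation is controlled because the two maps are
close. Along the circle this joins `diag(Ad V₀, 0)` to `diag(0, Ad V₁)` without any loss in the
error bound. After unital extension the zeros become the scalar part `ρ`, so `diag(Ad V₀ p, ρ p)` is
homotopic to `diag(ρ p, Ad V₁ p)`, and a rotation brings the second to `diag(Ad V₁ p, ρ p)`.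

The scalar summand is then removed. For `K₀` one adds `1 - ρ p` and uses that `diag(q, 1 - q)` is
homotopic to `diag(1, 0)` (`joinedIn_dsum_compl`). For `K₁` one adds `(ρ u)*` and uses Whitehead's
lemma (`joinedIn_dsum_star`), whose factors 3 and 2 are those allowed in the relation defining `K₁`.
`LinkingFamily` isolates what this argument needs of the corners.

A cover of a Lipschitz map has the form `V = ∑ Vₖ φₖ`: the `φₖ²` form a partition of unity with
small supports around points `xₖ`, and the `Vₖ` are isometries with mutually orthogonal ranges in
the vectors localized near `f(xₖ)`. Ampleness of `H_Y` makes those spaces infinite-dimensional,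
which leaves room for the ranges. -/

namespace ControlledK

/-! ### Block matrices over unitizations -/

section Blocks

variable {R : Type*} {ι κ : Type*}

/-- The `2 × 2` block matrix with the given blocks. -/
def block (a : CStarMatrix ι ι R) (b : CStarMatrix ι κ R) (c : CStarMatrix κ ι R)
    (d : CStarMatrix κ κ R) : CStarMatrix (ι ⊕ κ) (ι ⊕ κ) R :=
  CStarMatrix.ofMatrix (Matrix.fromBlocks a b c d)

/-- The block diagonal matrix `diag(a, d)`. -/
def dsum [Zero R] (a : CStarMatrix ι ι R) (d : CStarMatrix κ κ R) :
    CStarMatrix (ι ⊕ κ) (ι ⊕ κ) R := block a 0 0 d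

theorem block_add [Add R] (a a' : CStarMatrix ι ι R) (b b' : CStarMatrix ι κ R)
    (c c' : CStarMatrix κ ι R) (d d' : CStarMatrix κ κ R) :
    block a b c d + block a' b' c' d' = block (a + a') (b + b') (c + c') (d + d') :=
  Matrix.fromBlocks_add a b c d a' b' c' d'

theorem block_sub [Sub R] (a a' : CStarMatrix ι ι R) (b b' : CStarMatrix ι κ R)
    (c c' : CStarMatrix κ ι R) (d d' : CStarMatrix κ κ R) :
    block a b c d - block a' b' c' d' = block (a - a') (b - b') (c - c') (d - d') :=
  CStarMatrix.ext fun i j => by rcases i with i | i <;> rcases j with j | j <;> rfl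

theorem block_smul {S : Type*} [SMul S R] (x : S) (a : CStarMatrix ι ι R) (b : CStarMatrix ι κ R)
    (c : CStarMatrix κ ι R) (d : CStarMatrix κ κ R) :
    x • block a b c d = block (x • a) (x • b) (x • c) (x • d) :=
  Matrix.fromBlocks_smul x a b c d

theorem block_star [Star R] (a : CStarMatrix ι ι R) (b : CStarMatrix ι κ R)
    (c : CStarMatrix κ ι R) (d : CStarMatrix κ κ R) :
    star (block a b c d) =
      block (star a) (CStarMatrix.conjTranspose c) (CStarMatrix.conjTranspose b) (star d) :=
  Matrix.fromBlocks_conjTranspose a b c d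

theorem block_mul [Fintype ι] [Fintype κ] [NonUnitalNonAssocSemiring R]
    (a a' : CStarMatrix ι ι R) (b b' : CStarMatrix ι κ R)
    (c c' : CStarMatrix κ ι R) (d d' : CStarMatrix κ κ R) :
    block a b c d * block a' b' c' d' =
      block (a * a' + b * c') (a * b' + b * d') (c * a' + d * c') (c * b' + d * d') :=
  Matrix.fromBlocks_multiply a b c d a' b' c' d'

theorem block_one [DecidableEq ι] [DecidableEq κ] [Zero R] [One R] :
    block (1 : CStarMatrix ι ι R) 0 0 (1 : CStarMatrix κ κ R) = 1 :=
  Matrix.fromBlocks_one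

theorem dsum_sub [AddGroup R] (a a' : CStarMatrix ι ι R) (d d' : CStarMatrix κ κ R) :
    dsum a d - dsum a' d' = dsum (a - a') (d - d') := by
  rw [dsum, dsum, block_sub, sub_zero, sub_zero, dsum]

theorem dsum_mul [Fintype ι] [Fintype κ] [NonUnitalNonAssocSemiring R]
    (a a' : CStarMatrix ι ι R) (d d' : CStarMatrix κ κ R) :
    dsum a d * dsum a' d' = dsum (a * a') (d * d') := by
  rw [dsum, dsum, block_mul, dsum]
  simp only [CStarMatrix.mul_zero, CStarMatrix.zero_mul, add_zero, zero_add]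

theorem dsum_star [AddMonoid R] [StarAddMonoid R] (a : CStarMatrix ι ι R) (d : CStarMatrix κ κ R) :
    star (dsum a d) = dsum (star a) (star d) := by
  rw [dsum, block_star, CStarMatrix.conjTranspose_zero, CStarMatrix.conjTranspose_zero, dsum]

theorem dsum_one [DecidableEq ι] [DecidableEq κ] [Zero R] [One R] :
    dsum (1 : CStarMatrix ι ι R) (1 : CStarMatrix κ κ R) = 1 := block_one

end Blocks

/-! ### Rotations of block matrices over a C*-algebra -/

section CStarBlocks

variable {R : Type*} [CStarAlgebra R] [PartialOrder R] [StarOrderedRing R]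
  {ι κ : Type*} [Fintype ι] [Fintype κ]

theorem continuous_block {T : Type*} [TopologicalSpace T]
    {a : T → CStarMatrix ι ι R} {b : T → CStarMatrix ι κ R} {c : T → CStarMatrix κ ι R}
    {d : T → CStarMatrix κ κ R} (ha : Continuous a) (hb : Continuous b) (hc : Continuous c)
    (hd : Continuous d) : Continuous fun t => block (a t) (b t) (c t) (d t) :=
  Continuous.matrix_fromBlocks ha hb hc hd

/-- `(a, d) ↦ diag(a, d)` as a `*`-homomorphism. -/
noncomputable def dsumHom : CStarMatrix ι ι R × CStarMatrix κ κ R →⋆ₙₐ[ℂ] CStarMatrix (ι ⊕ κ) (ι ⊕ κ) R where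
  toFun x := dsum x.1 x.2
  map_smul' c x := by
    change dsum (c • x.1) (c • x.2) = c • dsum x.1 x.2
    rw [dsum, dsum, block_smul, smul_zero, smul_zero]
  map_zero' := Matrix.fromBlocks_zero
  map_add' x y := by
    change dsum (x.1 + y.1) (x.2 + y.2) = dsum x.1 x.2 + dsum y.1 y.2
    rw [dsum, dsum, dsum, block_add, add_zero, add_zero]
  map_mul' x y := (dsum_mul _ _ _ _).symm
  map_star' x := (dsum_star _ _).symm

/-- A `*`-homomorphism between C*-algebras is contractive, so no matrix norm has to be computed; the
product carries the maximum norm. -/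
theorem norm_dsum_lt {a : CStarMatrix ι ι R} {d : CStarMatrix κ κ R} {ε : ℝ} (ha : ‖a‖ < ε)
    (hd : ‖d‖ < ε) : ‖dsum a d‖ < ε :=
  (NonUnitalStarAlgHom.norm_apply_le (dsumHom (R := R)) (a, d)).trans_lt (max_lt ha hd)

/-- With a single index type all blocks lie in one algebra, where the entrywise identities below can
be settled by ring manipulations. -/
theorem block_mul_square (a a' b b' c c' d d' : CStarMatrix ι ι R) :
    block a b c d * block a' b' c' d' =
      block (a * a' + b * c') (a * b' + b * d') (c * a' + d * c') (c * b' + d * d') :=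
  block_mul a a' b b' c c' d d'

theorem block_star_square (a b c d : CStarMatrix ι ι R) :
    star (block a b c d) = block (star a) (star c) (star b) (star d) :=
  block_star a b c d

/-- The conjugate of `diag(a, b)` by the rotation with cosine `c` and sine `s`. -/
noncomputable def rot (c s : ℝ) (a b : CStarMatrix ι ι R) : CStarMatrix (ι ⊕ ι) (ι ⊕ ι) R :=
  block ((c : ℂ) ^ 2 • a + (s : ℂ) ^ 2 • b) ((c * s : ℂ) • (b - a)) ((c * s : ℂ) • (b - a))
    ((s : ℂ) ^ 2 • a + (c : ℂ) ^ 2 • b)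

/-- Conjugation by a fixed unitary is multiplicative. Entrywise, every coefficient identity is a
multiple of `c² + s² = 1`. -/
theorem rot_mul {c s : ℝ} (h : c ^ 2 + s ^ 2 = 1) (a b a' b' : CStarMatrix ι ι R) :
    rot c s a b * rot c s a' b' = rot c s (a * a') (b * b') := by
  have h' : (c : ℂ) ^ 2 + (s : ℂ) ^ 2 = 1 := by exact_mod_cast h
  rw [rot, rot, block_mul_square, rot]
  congr 1 <;>
  · simp only [mul_add, add_mul, mul_sub, sub_mul, smul_sub, smul_mul_assoc, mul_smul_comm,
      smul_add]
    match_scalars <;> first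
      | ring1
      | linear_combination ((c : ℂ) ^ 2) * h'
      | linear_combination ((s : ℂ) ^ 2) * h'
      | linear_combination ((c : ℂ) * s) * h'
      | linear_combination (-(c : ℂ) * s) * h'

theorem rot_star (c s : ℝ) (a b : CStarMatrix ι ι R) :
    star (rot c s a b) = rot c s (star a) (star b) := by
  rw [rot, block_star_square, rot]
  simp only [star_add, star_smul, star_sub, star_mul', star_pow, RCLike.star_def, Complex.conj_ofReal]

theorem rot_sub (c s : ℝ) (a b a' b' : CStarMatrix ι ι R) :
    rot c s a b - rot c s a' b' = rot c s (a - a') (b - b') := by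
  rw [rot, rot, rot, block_sub]
  congr 1 <;> module

theorem rot_one_one [DecidableEq ι] {c s : ℝ} (h : c ^ 2 + s ^ 2 = 1) :
    rot c s (1 : CStarMatrix ι ι R) 1 = 1 := by
  have h' : (c : ℂ) ^ 2 + (s : ℂ) ^ 2 = 1 := by exact_mod_cast h
  have h'' : (s : ℂ) ^ 2 + (c : ℂ) ^ 2 = 1 := by rw [add_comm, h']
  rw [rot, ← add_smul, ← add_smul, h', h'', one_smul, sub_self, smul_zero, block_one]

theorem rot_one_zero (a b : CStarMatrix ι ι R) : rot 1 0 a b = dsum a b := by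
  simp [rot, dsum]

theorem rot_zero_one (a b : CStarMatrix ι ι R) : rot 0 1 a b = dsum b a := by
  simp [rot, dsum]

theorem continuous_rot (a b : CStarMatrix ι ι R) :
    Continuous fun z : ℝ × ℝ => rot z.1 z.2 a b := by
  unfold rot
  apply continuous_block <;> fun_prop

/-- For `(c, s)` on the circle, `rot c s` is a `*`-homomorphism on the product algebra, hence
contractive. -/
theorem norm_rot_le {c s : ℝ} (h : c ^ 2 + s ^ 2 = 1) (a b : CStarMatrix ι ι R) :
    ‖rot c s a b‖ ≤ max ‖a‖ ‖b‖ := by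
  let Φ : CStarMatrix ι ι R × CStarMatrix ι ι R →⋆ₙₐ[ℂ] CStarMatrix (ι ⊕ ι) (ι ⊕ ι) R :=
    { toFun := fun x => rot c s x.1 x.2
      map_smul' := fun k x => by
        change rot c s (k • x.1) (k • x.2) = k • rot c s x.1 x.2
        rw [rot, rot, block_smul]
        congr 1 <;> module
      map_zero' := by
        change rot c s 0 0 = 0
        simp only [rot, smul_zero, sub_self, add_zero]
        exact Matrix.fromBlocks_zero
      map_add' := fun x y => by
        change rot c s (x.1 + y.1) (x.2 + y.2) = rot c s x.1 x.2 + rot c s y.1 y.2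
        rw [rot, rot, rot, block_add]
        congr 1 <;> module
      map_mul' := fun x y => (rot_mul h _ _ _ _).symm
      map_star' := fun x => (rot_star c s _ _).symm }
  exact NonUnitalStarAlgHom.norm_apply_le Φ (a, b)

/-- A path of elements from `diag(p, 1 - p)` to `diag(1, 0)`, parametrized by the circle. -/
noncomputable def rotCompl [DecidableEq ι] (c s : ℝ) (p : CStarMatrix ι ι R) :
    CStarMatrix (ι ⊕ ι) (ι ⊕ ι) R :=
  block (p + (s : ℂ) ^ 2 • (1 - p)) ((c * s : ℂ) • (1 - p)) ((c * s : ℂ) • (1 - p))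
    ((c : ℂ) ^ 2 • (1 - p))

/-- Let `E = diag(1, 0)` and let `Q` be the projection onto the line through `(s, c)`, so that the
path is `p E + (1 - p) Q`. With `d = p² - p` one has `(1 - p)² - (1 - p) = d` and `p (1 - p) = -d`,
so the defect is `d (Q - E)²`. The square of the difference of these two rank-one projections is the
scalar `c²`. -/
theorem rotCompl_mul_self [DecidableEq ι] {c s : ℝ} (h : c ^ 2 + s ^ 2 = 1)
    (p : CStarMatrix ι ι R) : rotCompl c s p * rotCompl c s p - rotCompl c s p =
      (c : ℂ) ^ 2 • dsum (p * p - p) (p * p - p) := by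
  have h' : (c : ℂ) ^ 2 + (s : ℂ) ^ 2 = 1 := by exact_mod_cast h
  have hs : (s : ℂ) ^ 2 = 1 - (c : ℂ) ^ 2 := by linear_combination h'
  rw [rotCompl, block_mul_square, block_sub, dsum, block_smul, smul_zero]
  congr 1
  all_goals
    simp only [mul_add, add_mul, mul_sub, sub_mul, smul_sub, smul_mul_assoc, mul_smul_comm,
      smul_add, one_mul, mul_one]
    match_scalars <;> first
      | ring1
      | linear_combination ((c : ℂ) ^ 2) * h'
      | linear_combination ((s : ℂ) ^ 2) * h'
      | linear_combination ((s : ℂ) ^ 2 - 1) * h'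
      | linear_combination (1 - 2 * (s : ℂ) ^ 2) * h'
      | linear_combination (-2 * (c : ℂ) ^ 2) * h'
      | linear_combination (-2 * (c : ℂ) * s) * h'
      | linear_combination ((c : ℂ) * s) * h'

theorem rotCompl_star [DecidableEq ι] (c s : ℝ) {p : CStarMatrix ι ι R} (hp : star p = p) :
    star (rotCompl c s p) = rotCompl c s p := by
  rw [rotCompl, block_star_square]
  simp only [star_add, star_smul, star_sub, star_mul', star_pow, RCLike.star_def,
    Complex.conj_ofReal, hp, star_one]

theorem rotCompl_one_zero [DecidableEq ι] (p : CStarMatrix ι ι R) :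
    rotCompl 1 0 p = dsum p (1 - p) := by
  simp [rotCompl, dsum]

theorem rotCompl_zero_one [DecidableEq ι] (p : CStarMatrix ι ι R) :
    rotCompl 0 1 p = dsum 1 0 := by
  simp [rotCompl, dsum]

theorem continuous_rotCompl [DecidableEq ι] (p : CStarMatrix ι ι R) :
    Continuous fun z : ℝ × ℝ => rotCompl z.1 z.2 p := by
  unfold rotCompl
  apply continuous_block <;> fun_prop

end CStarBlocks

/-- All rotations used below are polynomial in a cosine and a sine; trigonometry enters only here.
-/
theorem joinedIn_of_circle {E : Type*} [TopologicalSpace E] {S : Set E} {f : ℝ × ℝ → E}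
    (hf : Continuous f) (hS : ∀ c s : ℝ, c ^ 2 + s ^ 2 = 1 → f (c, s) ∈ S) :
    JoinedIn S (f (1, 0)) (f (0, 1)) := by
  refine JoinedIn.ofLine
    (f := fun t : ℝ => f (Real.cos (t * (Real.pi / 2)), Real.sin (t * (Real.pi / 2))))
    (by fun_prop) (by simp) (by simp) ?_
  rintro _ ⟨t, -, rfl⟩
  exact hS _ _ (Real.cos_sq_add_sin_sq _)

/-! ### Quasi-projections and quasi-unitaries over arbitrary finite index types -/

section Quasi

variable {B : Type*} [NonUnitalCStarAlgebra B] {ι κ : Type*} [Fintype ι] [Fintype κ]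
  [DecidableEq ι] [DecidableEq κ]

/-- `M_ι(B̃_r)`. -/
def levelOn (G : CStarFiltration B) (r : ℝ) (ι : Type*) :
    Set (CStarMatrix ι ι (Unitization ℂ B)) :=
  {a | ∀ i j, (a i j).snd ∈ G.level r}

/-- The `(ε, r)`-quasi-projections in `M_ι(B̃)`. -/
def quasiProjOn (G : CStarFiltration B) (ε r : ℝ) (ι : Type*) [Fintype ι] :
    Set (CStarMatrix ι ι (Unitization ℂ B)) :=
  {p | p ∈ levelOn G r ι ∧ star p = p ∧ ‖p * p - p‖ < ε}

/-- The `(ε, r)`-quasi-unitaries in `M_ι(B̃)`. -/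
def quasiUnitOn (G : CStarFiltration B) (ε r : ℝ) (ι : Type*) [Fintype ι] [DecidableEq ι] :
    Set (CStarMatrix ι ι (Unitization ℂ B)) :=
  {u | u ∈ levelOn G r ι ∧ ‖star u * u - 1‖ < ε ∧ ‖u * star u - 1‖ < ε}

variable {G : CStarFiltration B} {ε r : ℝ}

theorem one_mem_levelOn (hr : 0 < r) : 1 ∈ levelOn G r ι := fun i j => by
  rw [CStarMatrix.one_apply]
  split_ifs
  · exact G.zero_mem r hr
  · exact G.zero_mem r hr

theorem add_mem_levelOn (hr : 0 < r) {a b : CStarMatrix ι ι (Unitization ℂ B)}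
    (ha : a ∈ levelOn G r ι) (hb : b ∈ levelOn G r ι) : a + b ∈ levelOn G r ι :=
  fun i j => G.add_mem r hr _ (ha i j) _ (hb i j)

theorem smul_mem_levelOn (hr : 0 < r) (x : ℂ) {a : CStarMatrix ι ι (Unitization ℂ B)}
    (ha : a ∈ levelOn G r ι) : x • a ∈ levelOn G r ι :=
  fun i j => G.smul_mem r hr x _ (ha i j)

theorem sub_mem_levelOn (hr : 0 < r) {a b : CStarMatrix ι ι (Unitization ℂ B)}
    (ha : a ∈ levelOn G r ι) (hb : b ∈ levelOn G r ι) : a - b ∈ levelOn G r ι := by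
  have := add_mem_levelOn hr ha (smul_mem_levelOn hr (-1) hb)
  rwa [neg_one_smul, ← sub_eq_add_neg] at this

theorem star_mem_levelOn (hr : 0 < r) {a : CStarMatrix ι ι (Unitization ℂ B)}
    (ha : a ∈ levelOn G r ι) : star a ∈ levelOn G r ι := fun i j => by
  rw [CStarMatrix.star_apply]
  exact G.star_mem r hr _ (ha j i)

theorem levelOn_mono {s : ℝ} (hr : 0 < r) (h : r ≤ s) : levelOn G r ι ⊆ levelOn G s ι :=
  fun _ ha i j => G.mono r s hr h (ha i j)

theorem sum_mem_level (hr : 0 < r) {α : Type*} (t : Finset α) (f : α → B)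
    (hf : ∀ k ∈ t, f k ∈ G.level r) : ∑ k ∈ t, f k ∈ G.level r :=
  Finset.sum_induction f (· ∈ G.level r) (fun a b ha hb => G.add_mem r hr a ha b hb)
    (G.zero_mem r hr) hf

/-- In `(x + a)(y + b)` the `B`-part is `x b + y a + a b`; only the last term needs the level `2r`.
-/
theorem mul_mem_levelOn (hr : 0 < r) {a b : CStarMatrix ι ι (Unitization ℂ B)}
    (ha : a ∈ levelOn G r ι) (hb : b ∈ levelOn G r ι) : a * b ∈ levelOn G (2 * r) ι := by
  intro i j
  have hr2 : 0 < 2 * r := by positivity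
  rw [CStarMatrix.mul_apply]
  have : (∑ k, a i k * b k j).snd = ∑ k, (a i k * b k j).snd :=
    map_sum (Unitization.sndHom (R := ℂ) (A := B) ℂ) _ _
  rw [this]
  refine sum_mem_level hr2 _ _ fun k _ => ?_
  rw [Unitization.snd_mul]
  have h2 : G.level r ⊆ G.level (2 * r) := G.mono r _ hr (by linarith)
  refine G.add_mem _ hr2 _ (G.add_mem _ hr2 _ ?_ _ ?_) _ ?_
  · exact G.smul_mem _ hr2 _ _ (h2 (hb k j))
  · exact G.smul_mem _ hr2 _ _ (h2 (ha i k))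
  · rw [two_mul]
    exact G.mul_mem r r hr hr _ (ha i k) _ (hb k j)

theorem block_mem_levelOn {a : CStarMatrix ι ι (Unitization ℂ B)}
    {b : CStarMatrix ι κ (Unitization ℂ B)} {c : CStarMatrix κ ι (Unitization ℂ B)}
    {d : CStarMatrix κ κ (Unitization ℂ B)} (ha : a ∈ levelOn G r ι)
    (hb : ∀ i j, (b i j).snd ∈ G.level r) (hc : ∀ i j, (c i j).snd ∈ G.level r)
    (hd : d ∈ levelOn G r κ) : block a b c d ∈ levelOn G r (ι ⊕ κ) := by
  rintro (i | i) (j | j)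
  · exact ha i j
  · exact hb i j
  · exact hc i j
  · exact hd i j

theorem dsum_mem_levelOn (hr : 0 < r) {a : CStarMatrix ι ι (Unitization ℂ B)}
    {d : CStarMatrix κ κ (Unitization ℂ B)} (ha : a ∈ levelOn G r ι) (hd : d ∈ levelOn G r κ) :
    dsum a d ∈ levelOn G r (ι ⊕ κ) :=
  block_mem_levelOn ha (fun _ _ => G.zero_mem r hr) (fun _ _ => G.zero_mem r hr) hd

theorem rot_mem_levelOn (hr : 0 < r) {a b : CStarMatrix ι ι (Unitization ℂ B)}
    (ha : a ∈ levelOn G r ι) (hb : b ∈ levelOn G r ι) (c s : ℝ) :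
    rot c s a b ∈ levelOn G r (ι ⊕ ι) :=
  block_mem_levelOn
    (add_mem_levelOn hr (smul_mem_levelOn hr _ ha) (smul_mem_levelOn hr _ hb))
    (smul_mem_levelOn hr _ (sub_mem_levelOn hr hb ha))
    (smul_mem_levelOn hr _ (sub_mem_levelOn hr hb ha))
    (add_mem_levelOn hr (smul_mem_levelOn hr _ ha) (smul_mem_levelOn hr _ hb))

theorem dsum_mem_quasiProjOn (hr : 0 < r) {a : CStarMatrix ι ι (Unitization ℂ B)}
    {d : CStarMatrix κ κ (Unitization ℂ B)} (ha : a ∈ quasiProjOn G ε r ι)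
    (hd : d ∈ quasiProjOn G ε r κ) : dsum a d ∈ quasiProjOn G ε r (ι ⊕ κ) := by
  refine ⟨dsum_mem_levelOn hr ha.1 hd.1, by rw [dsum_star, ha.2.1, hd.2.1], ?_⟩
  rw [dsum_mul, dsum_sub]
  exact norm_dsum_lt ha.2.2 hd.2.2

theorem dsum_mem_quasiUnitOn (hr : 0 < r) {a : CStarMatrix ι ι (Unitization ℂ B)}
    {d : CStarMatrix κ κ (Unitization ℂ B)} (ha : a ∈ quasiUnitOn G ε r ι)
    (hd : d ∈ quasiUnitOn G ε r κ) : dsum a d ∈ quasiUnitOn G ε r (ι ⊕ κ) := by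
  refine ⟨dsum_mem_levelOn hr ha.1 hd.1, ?_, ?_⟩
  · rw [dsum_star, dsum_mul, ← dsum_one, dsum_sub]
    exact norm_dsum_lt ha.2.1 hd.2.1
  · rw [dsum_star, dsum_mul, ← dsum_one, dsum_sub]
    exact norm_dsum_lt ha.2.2 hd.2.2

theorem one_mem_quasiProjOn (hε : 0 < ε) (hr : 0 < r) : 1 ∈ quasiProjOn G ε r ι :=
  ⟨one_mem_levelOn hr, star_one _, by simpa using hε⟩

theorem one_mem_quasiUnitOn (hε : 0 < ε) (hr : 0 < r) : 1 ∈ quasiUnitOn G ε r ι :=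
  ⟨one_mem_levelOn hr, by simpa using hε, by simpa using hε⟩

theorem star_mem_quasiUnitOn (hr : 0 < r) {u : CStarMatrix ι ι (Unitization ℂ B)}
    (hu : u ∈ quasiUnitOn G ε r ι) : star u ∈ quasiUnitOn G ε r ι :=
  ⟨star_mem_levelOn hr hu.1, by simpa using hu.2.2, by simpa using hu.2.1⟩

theorem quasiUnitOn_mono {η s : ℝ} (hr : 0 < r) (hε : ε ≤ η) (h : r ≤ s) :
    quasiUnitOn G ε r ι ⊆ quasiUnitOn G η s ι :=
  fun _ hu => ⟨levelOn_mono hr h hu.1, hu.2.1.trans_le hε, hu.2.2.trans_le hε⟩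

/-- The defect of a product is `v* (u* u - 1) v + (v* v - 1)`, and `‖v‖² ≤ 1 + ε ≤ 2`. This is the
source of the factor 3. -/
theorem norm_star_mul_mul_sub_one_lt {M : Type*} [CStarAlgebra M] {u v : M} (hε : ε ≤ 1)
    (hu : ‖star u * u - 1‖ < ε) (hv : ‖star v * v - 1‖ < ε) :
    ‖star (u * v) * (u * v) - 1‖ < 3 * ε := by
  have h1 : ‖(1 : M)‖ ≤ 1 := by
    -- Matrices over an empty index type form the zero algebra, where `‖1‖ = 0`.
    rcases subsingleton_or_nontrivial M with h | h
    · simp [Subsingleton.elim (1 : M) 0]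
    · rw [CStarRing.norm_one]
  have h2 : ‖v‖ * ‖v‖ ≤ 2 := by
    rw [← CStarRing.norm_star_mul_self]
    calc ‖star v * v‖ = ‖(star v * v - 1) + 1‖ := by rw [sub_add_cancel]
      _ ≤ ‖star v * v - 1‖ + ‖(1 : M)‖ := norm_add_le _ _
      _ ≤ 2 := by linarith
  have e : star (u * v) * (u * v) - 1 = star v * (star u * u - 1) * v + (star v * v - 1) := by
    rw [star_mul]; noncomm_ring
  rw [e]
  calc ‖star v * (star u * u - 1) * v + (star v * v - 1)‖
      ≤ ‖star v‖ * ‖star u * u - 1‖ * ‖v‖ + ‖star v * v - 1‖ :=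
        (norm_add_le _ _).trans (by
          gcongr
          exact (norm_mul_le _ _).trans (by gcongr; exact norm_mul_le _ _))
    _ = (‖v‖ * ‖v‖) * ‖star u * u - 1‖ + ‖star v * v - 1‖ := by rw [norm_star]; ring
    _ ≤ 2 * ‖star u * u - 1‖ + ‖star v * v - 1‖ := by gcongr
    _ < 3 * ε := by linarith

theorem mul_mem_quasiUnitOn (hr : 0 < r) (hε : ε ≤ 1) {u v : CStarMatrix ι ι (Unitization ℂ B)}
    (hu : u ∈ quasiUnitOn G ε r ι) (hv : v ∈ quasiUnitOn G ε r ι) :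
    u * v ∈ quasiUnitOn G (3 * ε) (2 * r) ι := by
  refine ⟨mul_mem_levelOn hr hu.1 hv.1, norm_star_mul_mul_sub_one_lt hε hu.2.1 hv.2.1, ?_⟩
  -- The bound for `(u v)(u v)*` is the same estimate applied to `v*` and `u*`.
  have := norm_star_mul_mul_sub_one_lt (u := star v) (v := star u) hε
    (by simpa using hv.2.2) (by simpa using hu.2.2)
  rwa [← star_mul, star_star] at this

/-! ### Elementary homotopies -/

theorem JoinedIn.dsum {S : Set (CStarMatrix ι ι (Unitization ℂ B))}
    {T : Set (CStarMatrix κ κ (Unitization ℂ B))}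
    {U : Set (CStarMatrix (ι ⊕ κ) (ι ⊕ κ) (Unitization ℂ B))}
    (hU : ∀ a ∈ S, ∀ d ∈ T, dsum a d ∈ U) {a a' : CStarMatrix ι ι (Unitization ℂ B)}
    {d d' : CStarMatrix κ κ (Unitization ℂ B)} (ha : JoinedIn S a a') (hd : JoinedIn T d d') :
    JoinedIn U (ControlledK.dsum a d) (ControlledK.dsum a' d') := by
  obtain ⟨γ, hγ⟩ := ha
  obtain ⟨γ', hγ'⟩ := hd
  exact ⟨⟨⟨fun t => ControlledK.dsum (γ t) (γ' t), continuous_block γ.continuous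
    continuous_const continuous_const γ'.continuous⟩, by simp, by simp⟩,
    fun t => hU _ (hγ t) _ (hγ' t)⟩

/-- Conjugation by scalar rotations changes neither the error nor the propagation. -/
theorem joinedIn_quasiProjOn_swap (hr : 0 < r) {a b : CStarMatrix ι ι (Unitization ℂ B)}
    (ha : a ∈ quasiProjOn G ε r ι) (hb : b ∈ quasiProjOn G ε r ι) :
    JoinedIn (quasiProjOn G ε r (ι ⊕ ι)) (dsum a b) (dsum b a) := by
  rw [← rot_one_zero, ← rot_zero_one]
  refine joinedIn_of_circle (f := fun z => rot z.1 z.2 a b) (continuous_rot a b) fun c s h => ?_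
  refine ⟨rot_mem_levelOn hr ha.1 hb.1 c s, by rw [rot_star, ha.2.1, hb.2.1], ?_⟩
  rw [rot_mul h, rot_sub]
  exact (norm_rot_le h _ _).trans_lt (max_lt ha.2.2 hb.2.2)

theorem rot_mem_quasiUnitOn (hr : 0 < r) {a b : CStarMatrix ι ι (Unitization ℂ B)}
    (ha : a ∈ quasiUnitOn G ε r ι) (hb : b ∈ quasiUnitOn G ε r ι) {c s : ℝ}
    (h : c ^ 2 + s ^ 2 = 1) : rot c s a b ∈ quasiUnitOn G ε r (ι ⊕ ι) := by
  refine ⟨rot_mem_levelOn hr ha.1 hb.1 c s, ?_, ?_⟩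
  · rw [rot_star, rot_mul h, ← rot_one_one h, rot_sub]
    exact (norm_rot_le h _ _).trans_lt (max_lt ha.2.1 hb.2.1)
  · rw [rot_star, rot_mul h, ← rot_one_one h, rot_sub]
    exact (norm_rot_le h _ _).trans_lt (max_lt ha.2.2 hb.2.2)

theorem joinedIn_quasiUnitOn_swap (hr : 0 < r) {a b : CStarMatrix ι ι (Unitization ℂ B)}
    (ha : a ∈ quasiUnitOn G ε r ι) (hb : b ∈ quasiUnitOn G ε r ι) :
    JoinedIn (quasiUnitOn G ε r (ι ⊕ ι)) (dsum a b) (dsum b a) := by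
  rw [← rot_one_zero, ← rot_zero_one]
  exact joinedIn_of_circle (f := fun z => rot z.1 z.2 a b) (continuous_rot a b)
    fun c s h => rot_mem_quasiUnitOn hr ha hb h

/-- `diag(p, 1 - p)` and `diag(1, 0)` are homotopic for every quasi-projection `p`. -/
theorem joinedIn_dsum_compl (hr : 0 < r) {p : CStarMatrix ι ι (Unitization ℂ B)}
    (hp : p ∈ quasiProjOn G ε r ι) :
    JoinedIn (quasiProjOn G ε r (ι ⊕ ι)) (dsum p (1 - p)) (dsum 1 0) := by
  rw [← rotCompl_one_zero, ← rotCompl_zero_one p]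
  refine joinedIn_of_circle (f := fun z => rotCompl z.1 z.2 p) (continuous_rotCompl p)
    fun c s h => ⟨?_, rotCompl_star c s hp.2.1, ?_⟩
  · have h1 := sub_mem_levelOn hr (one_mem_levelOn hr) hp.1
    exact block_mem_levelOn (add_mem_levelOn hr hp.1 (smul_mem_levelOn hr _ h1))
      (smul_mem_levelOn hr _ h1) (smul_mem_levelOn hr _ h1) (smul_mem_levelOn hr _ h1)
  · rw [rotCompl_mul_self h, norm_smul]
    have h1 : ‖(c : ℂ) ^ 2‖ ≤ 1 := by
      rw [norm_pow, Complex.norm_real, Real.norm_eq_abs, sq_abs]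
      nlinarith [sq_nonneg s]
    calc ‖(c : ℂ) ^ 2‖ * ‖dsum (p * p - p) (p * p - p)‖
        ≤ 1 * ‖dsum (p * p - p) (p * p - p)‖ := by gcongr
      _ < ε := by rw [one_mul]; exact norm_dsum_lt hp.2.2 hp.2.2

/-- The straight segment works: with `d = u u* - 1` self-adjoint and `‖d‖ < ε ≤ 1`, the square of `1
+ t d` differs from `1` by `2 t d + t² d²`, of norm at most `3 ‖d‖`. -/
theorem joinedIn_mul_star_self (hr : 0 < r) (hε : ε ≤ 1) {u : CStarMatrix ι ι (Unitization ℂ B)}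
    (hu : u ∈ quasiUnitOn G ε r ι) :
    JoinedIn (quasiUnitOn G (3 * ε) (2 * r) ι) (u * star u) 1 := by
  have hr2 : 0 < 2 * r := by positivity
  refine JoinedIn.symm (JoinedIn.ofLine (f := fun t : ℝ => 1 + (t : ℂ) • (u * star u - 1))
    (by fun_prop) (by simp) (by simp) ?_)
  rintro _ ⟨t, ht, rfl⟩
  have hd := hu.2.2
  have hsa : star (u * star u - 1) = u * star u - 1 := by simp
  have hl := mul_mem_levelOn hr hu.1 (star_mem_levelOn hr hu.1)
  set d := u * star u - 1 with hdef
  have hx : star (1 + (t : ℂ) • d) = 1 + (t : ℂ) • d := by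
    rw [star_add, star_one, star_smul, hsa, RCLike.star_def, Complex.conj_ofReal]
  have hn : ‖(1 + (t : ℂ) • d) * (1 + (t : ℂ) • d) - 1‖ < 3 * ε := by
    have e : (1 + (t : ℂ) • d) * (1 + (t : ℂ) • d) - 1 =
        (2 * t : ℂ) • d + ((t : ℂ) ^ 2) • (d * d) := by
      simp only [mul_add, add_mul, one_mul, mul_one, smul_mul_assoc, mul_smul_comm]
      module
    have ht1 : ‖(t : ℂ)‖ ≤ 1 := by
      rw [Complex.norm_real, Real.norm_eq_abs, abs_le]
      exact ⟨by linarith [ht.1], ht.2⟩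
    rw [e]
    calc ‖(2 * t : ℂ) • d + ((t : ℂ) ^ 2) • (d * d)‖
        ≤ ‖(2 * t : ℂ) • d‖ + ‖((t : ℂ) ^ 2) • (d * d)‖ := norm_add_le _ _
      _ ≤ 2 * 1 * ‖d‖ + 1 ^ 2 * (‖d‖ * ‖d‖) := by
          rw [norm_smul, norm_smul, norm_mul, norm_pow, Complex.norm_ofNat]
          gcongr
          exact norm_mul_le _ _
      _ ≤ 2 * 1 * ‖d‖ + 1 ^ 2 * (1 * ‖d‖) := by gcongr; linarith
      _ < 3 * ε := by linarith
  refine ⟨add_mem_levelOn hr2 (one_mem_levelOn hr2)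
    (smul_mem_levelOn hr2 _ (sub_mem_levelOn hr2 hl (one_mem_levelOn hr2))), ?_, ?_⟩
  · change ‖star (1 + (t : ℂ) • d) * (1 + (t : ℂ) • d) - 1‖ < 3 * ε
    rwa [hx]
  · change ‖(1 + (t : ℂ) • d) * star (1 + (t : ℂ) • d) - 1‖ < 3 * ε
    rwa [hx]

/-- Whitehead's lemma: `diag(u, u*)` is homotopic to `1`. -/
theorem joinedIn_dsum_star (hr : 0 < r) (hε : ε ≤ 1) {u : CStarMatrix ι ι (Unitization ℂ B)}
    (hu : u ∈ quasiUnitOn G ε r ι) :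
    JoinedIn (quasiUnitOn G (3 * ε) (2 * r) (ι ⊕ ι)) (dsum u (star u)) 1 := by
  have hε0 : 0 < ε := (norm_nonneg _).trans_lt hu.2.1
  have hr2 : 0 < 2 * r := by positivity
  have h1 : JoinedIn (quasiUnitOn G (3 * ε) (2 * r) (ι ⊕ ι)) (dsum u (star u))
      (dsum (u * star u) 1) := by
    -- Only the second factor of `diag(u, 1) · diag(1, u*)` is rotated, until it becomes `diag(u*,
    -- 1)`. The path consists of products of two quasi-unitaries, whence `3ε` and `2r`.
    have := joinedIn_of_circle (S := quasiUnitOn G (3 * ε) (2 * r) (ι ⊕ ι))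
      (f := fun z => dsum u 1 * rot z.1 z.2 1 (star u))
      (continuous_const.fun_mul (continuous_rot _ _)) fun c s h => mul_mem_quasiUnitOn hr hε
        (dsum_mem_quasiUnitOn hr hu (one_mem_quasiUnitOn hε0 hr))
        (rot_mem_quasiUnitOn hr (one_mem_quasiUnitOn hε0 hr) (star_mem_quasiUnitOn hr hu) h)
    simpa only [rot_one_zero, rot_zero_one, dsum_mul, mul_one, one_mul] using this
  rw [← dsum_one]
  exact h1.trans (JoinedIn.dsum (fun a ha d hd => dsum_mem_quasiUnitOn hr2 ha hd)
    (joinedIn_mul_star_self hr hε hu)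
    (JoinedIn.refl (one_mem_quasiUnitOn (by positivity) hr2)))

end Quasi
/-! ### Linked homomorphisms and the homotopy between them -/

section Linking

variable (A B : Type*) [NonUnitalCStarAlgebra A] [NonUnitalCStarAlgebra B]

/-- A pair of `*`-homomorphisms `ψ false false` and `ψ true true` from `A` to `B`, together with
the off-diagonal corners that make `ψ` a `*`-homomorphism into `M₂(B)` after scaling by a
rank one projection; the model is `ψ i j T = Vᵢ T Vⱼ*` for isometries `V₀`, `V₁`. -/
structure LinkingFamily where
  /-- The corners. -/
  toFun : Bool → Bool → A →ₗ[ℂ] B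
  mul_toFun : ∀ i j k x y, toFun i j x * toFun j k y = toFun i k (x * y)
  star_toFun : ∀ i j x, star (toFun i j x) = toFun j i (star x)

variable {A B}

namespace LinkingFamily

variable (ψ : LinkingFamily A B)

/-- The diagonal corners of a linking family as `*`-homomorphisms. -/
def hom (i : Bool) : A →⋆ₙₐ[ℂ] B where
  toFun := ψ.toFun i i
  map_smul' c x := map_smul _ c x
  map_zero' := map_zero _
  map_add' x y := map_add _ x y
  map_mul' x y := (ψ.mul_toFun i i i x y).symm
  map_star' x := (ψ.star_toFun i i x).symm

variable {n : ℕ}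

/-- A corner of a linking family applied to the `A`-parts of the entries of a matrix over `Ã`. -/
def corner (i j : Bool) (a : MatUnitization A n) : MatUnitization B n :=
  CStarMatrix.ofMatrix fun k l => Unitization.inr (ψ.toFun i j (a k l).snd)

theorem corner_apply (i j : Bool) (a : MatUnitization A n) (k l : Fin n) :
    ψ.corner i j a k l = Unitization.inr (ψ.toFun i j (a k l).snd) := rfl

/-- The unital extension of the zero homomorphism is the scalar part `ρ_A` followed by the inclusion
of scalars. Writing it as `matMap 0` makes every lemma on `matMap` available for it. -/
theorem matMap_zero_apply (a : MatUnitization A n) (k l : Fin n) :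
    matMap (0 : A →⋆ₙₐ[ℂ] B) n a k l = Unitization.inl (a k l).fst := by
  rw [matMap_apply]
  refine Unitization.ext ?_ ?_ <;> simp [Unitization.algebraMap_eq_inl]

theorem corner_add (i j : Bool) (a b : MatUnitization A n) :
    ψ.corner i j (a + b) = ψ.corner i j a + ψ.corner i j b :=
  CStarMatrix.ext fun k l => by
    simp only [corner_apply, CStarMatrix.add_apply, Unitization.snd_add, map_add,
      Unitization.inr_add]

theorem corner_smul (i j : Bool) (c : ℂ) (a : MatUnitization A n) :
    ψ.corner i j (c • a) = c • ψ.corner i j a :=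
  CStarMatrix.ext fun k l => by
    simp only [corner_apply, CStarMatrix.smul_apply, Unitization.snd_smul, map_smul,
      Unitization.inr_smul]

theorem corner_star (i j : Bool) (a : MatUnitization A n) :
    star (ψ.corner i j a) = ψ.corner j i (star a) :=
  CStarMatrix.ext fun k l => by
    rw [CStarMatrix.star_apply, corner_apply, corner_apply, CStarMatrix.star_apply,
      Unitization.snd_star, ← ψ.star_toFun, Unitization.inr_star]

/-- Writing `a = a₀ + a₁` with `a₀` scalar, one has `a₁ b₁ = (ab)₁ - a₀ b₁ - a₁ b₀`; a corner sees
only the index 1 parts and is multiplicative on them. -/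
theorem corner_mul_corner (i j k : Bool) (a b : MatUnitization A n) :
    ψ.corner i j a * ψ.corner j k b = ψ.corner i k (a * b) -
      matMap (0 : A →⋆ₙₐ[ℂ] B) n a * ψ.corner i k b -
      ψ.corner i k a * matMap (0 : A →⋆ₙₐ[ℂ] B) n b := by
  refine CStarMatrix.ext fun p q => ?_
  have hs : (∑ l, a p l * b l q).snd = ∑ l, (a p l * b l q).snd :=
    map_sum (Unitization.sndHom (R := ℂ) (A := A) ℂ) _ _
  have hi : ∀ f : Fin n → B, (Unitization.inr (∑ l, f l) : Unitization ℂ B) =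
      ∑ l, Unitization.inr (f l) := fun f => map_sum (Unitization.inrHom (R := ℂ) (A := B) ℂ) _ _
  simp only [CStarMatrix.sub_apply, CStarMatrix.mul_apply, corner_apply, matMap_zero_apply]
  rw [hs, map_sum, hi, ← Finset.sum_sub_distrib, ← Finset.sum_sub_distrib]
  refine Finset.sum_congr rfl fun l _ => ?_
  rw [Unitization.snd_mul, map_add, map_add, map_smul, map_smul, ← ψ.mul_toFun i j k]
  simp only [Unitization.inl_mul_inr, Unitization.inr_mul_inl, Unitization.inr_add,
    Unitization.inr_smul, Unitization.inr_mul]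
  abel

theorem matMap_hom (i : Bool) (a : MatUnitization A n) :
    matMap (ψ.hom i) n a = matMap (0 : A →⋆ₙₐ[ℂ] B) n a + ψ.corner i i a := by
  refine CStarMatrix.ext fun p q => ?_
  rw [CStarMatrix.add_apply, matMap_zero_apply, corner_apply, matMap_apply]
  refine Unitization.ext ?_ ?_ <;> simp [Unitization.algebraMap_eq_inl, hom]

/-- The compression of `ψ` to the line spanned by `(c, s)`, extended unitally to `Ã`. -/
noncomputable def link (c s : ℝ) (a : MatUnitization A n) :
    CStarMatrix (Fin n ⊕ Fin n) (Fin n ⊕ Fin n) (Unitization ℂ B) :=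
  block (matMap (0 : A →⋆ₙₐ[ℂ] B) n a + (c : ℂ) ^ 2 • ψ.corner false false a)
    ((c * s : ℂ) • ψ.corner false true a) ((c * s : ℂ) • ψ.corner true false a)
    (matMap (0 : A →⋆ₙₐ[ℂ] B) n a + (s : ℂ) ^ 2 • ψ.corner true true a)

/-- In the model, the non-scalar part is `T ↦ W T W*` for the column `W = (c V₀, s V₁)`, and `c² +
s² = 1` says that `W* W = 1`. Placing the scalar part in both diagonal blocks gives the unital
extension. -/
theorem link_mul {c s : ℝ} (h : c ^ 2 + s ^ 2 = 1) (a b : MatUnitization A n) :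
    ψ.link c s a * ψ.link c s b = ψ.link c s (a * b) := by
  have h' : (c : ℂ) ^ 2 + (s : ℂ) ^ 2 = 1 := by exact_mod_cast h
  rw [link, link, block_mul_square, link, matMap_mul]
  congr 1
  all_goals
    simp only [mul_add, add_mul, smul_add, smul_mul_assoc, mul_smul_comm, corner_mul_corner,
      smul_sub]
    match_scalars <;> first
      | ring1
      | linear_combination ((c : ℂ) ^ 2) * h'
      | linear_combination (-(c : ℂ) ^ 2) * h'
      | linear_combination ((s : ℂ) ^ 2) * h'
      | linear_combination (-(s : ℂ) ^ 2) * h'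
      | linear_combination ((c : ℂ) * s) * h'
      | linear_combination (-(c : ℂ) * s) * h'

theorem link_add (c s : ℝ) (a b : MatUnitization A n) :
    ψ.link c s (a + b) = ψ.link c s a + ψ.link c s b := by
  have h : matMap (0 : A →⋆ₙₐ[ℂ] B) n (a + b) = matMap 0 n a + matMap 0 n b := map_add _ _ _
  rw [link, link, link, block_add, h]
  simp only [corner_add]
  congr 1 <;> module

theorem link_smul (c s : ℝ) (x : ℂ) (a : MatUnitization A n) :
    ψ.link c s (x • a) = x • ψ.link c s a := by
  have h : matMap (0 : A →⋆ₙₐ[ℂ] B) n (x • a) = x • matMap 0 n a := map_smul _ _ _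
  rw [link, link, block_smul, h]
  simp only [corner_smul]
  congr 1 <;> module

theorem link_star (c s : ℝ) (a : MatUnitization A n) :
    ψ.link c s (star a) = star (ψ.link c s a) := by
  rw [link, link, block_star_square, matMap_star]
  simp only [star_add, star_smul, star_mul', star_pow, RCLike.star_def, Complex.conj_ofReal,
    corner_star]

/-- `ψ.link c s` as a `*`-homomorphism, for `(c, s)` on the unit circle. -/
noncomputable def linkHom {c s : ℝ} (h : c ^ 2 + s ^ 2 = 1) :
    MatUnitization A n →⋆ₙₐ[ℂ] CStarMatrix (Fin n ⊕ Fin n) (Fin n ⊕ Fin n) (Unitization ℂ B) where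
  toFun := ψ.link c s
  map_smul' x a := ψ.link_smul c s x a
  map_zero' := by simpa using ψ.link_smul c s 0 (0 : MatUnitization A n)
  map_add' := ψ.link_add c s
  map_mul' a b := (ψ.link_mul h a b).symm
  map_star' := ψ.link_star c s

/-- Contractivity of a `*`-homomorphism again: this is why the homotopy below preserves the error
bound of a quasi-projection or quasi-unitary. -/
theorem norm_link_le {c s : ℝ} (h : c ^ 2 + s ^ 2 = 1) (a : MatUnitization A n) :
    ‖ψ.link c s a‖ ≤ ‖a‖ := NonUnitalStarAlgHom.norm_apply_le (ψ.linkHom h) a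

theorem link_sub {c s : ℝ} (h : c ^ 2 + s ^ 2 = 1) (a b : MatUnitization A n) :
    ψ.link c s (a - b) = ψ.link c s a - ψ.link c s b := map_sub (ψ.linkHom h) a b

theorem corner_one (i j : Bool) : ψ.corner i j (1 : MatUnitization A n) = 0 := by
  refine CStarMatrix.ext fun k l => ?_
  rw [corner_apply, CStarMatrix.one_apply]
  split_ifs <;> simp

theorem link_one (c s : ℝ) : ψ.link c s (1 : MatUnitization A n) = 1 := by
  rw [link, matMap_one]
  simp only [corner_one, smul_zero, add_zero]
  exact block_one

theorem link_one_zero (a : MatUnitization A n) :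
    ψ.link 1 0 a = dsum (matMap (ψ.hom false) n a) (matMap (0 : A →⋆ₙₐ[ℂ] B) n a) := by
  simp [link, dsum, matMap_hom]

theorem link_zero_one (a : MatUnitization A n) :
    ψ.link 0 1 a = dsum (matMap (0 : A →⋆ₙₐ[ℂ] B) n a) (matMap (ψ.hom true) n a) := by
  simp [link, dsum, matMap_hom]

theorem continuous_link (a : MatUnitization A n) :
    Continuous fun z : ℝ × ℝ => ψ.link z.1 z.2 a := by
  unfold link
  apply continuous_block <;> fun_prop

variable {F : CStarFiltration A} {G : CStarFiltration B} {ε η r s : ℝ}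

theorem link_mem_levelOn (hs : 0 < s) (hψ : ∀ i j, MapsTo (ψ.toFun i j) (F.level r) (G.level s))
    {a : MatUnitization A n} (ha : a ∈ matLevel F r n) (x y : ℝ) :
    ψ.link x y a ∈ levelOn G s (Fin n ⊕ Fin n) := by
  have hc : ∀ i j, ψ.corner i j a ∈ levelOn G s (Fin n) := fun i j k l => hψ i j (ha k l)
  have h0 : matMap (0 : A →⋆ₙₐ[ℂ] B) n a ∈ levelOn G s (Fin n) := fun k l => by
    rw [matMap_zero_apply]
    exact G.zero_mem s hs
  exact block_mem_levelOn (add_mem_levelOn hs h0 (smul_mem_levelOn hs _ (hc _ _)))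
    (smul_mem_levelOn hs _ (hc _ _)) (smul_mem_levelOn hs _ (hc _ _))
    (add_mem_levelOn hs h0 (smul_mem_levelOn hs _ (hc _ _)))

/-- The path is the image of the single element `p` under a circle of `*`-homomorphisms. The error
is therefore inherited from `p`, and the only geometric input is the level of all four corners,
off-diagonal ones included. -/
theorem joinedIn_quasiProjOn_link (hs : 0 < s) (hε : ε ≤ η)
    (hψ : ∀ i j, MapsTo (ψ.toFun i j) (F.level r) (G.level s))
    {p : MatUnitization A n} (hp : p ∈ quasiProjections F ε r n) :
    JoinedIn (quasiProjOn G η s (Fin n ⊕ Fin n))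
      (dsum (matMap (ψ.hom false) n p) (matMap (0 : A →⋆ₙₐ[ℂ] B) n p))
      (dsum (matMap (0 : A →⋆ₙₐ[ℂ] B) n p) (matMap (ψ.hom true) n p)) := by
  rw [← link_one_zero, ← link_zero_one]
  refine joinedIn_of_circle (f := fun z => ψ.link z.1 z.2 p) (ψ.continuous_link p)
    fun x y h => ⟨ψ.link_mem_levelOn hs hψ hp.1 x y, by rw [← link_star, hp.2.1], ?_⟩
  rw [link_mul ψ h, ← link_sub ψ h]
  exact (ψ.norm_link_le h _).trans_lt (hp.2.2.trans_le hε)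

theorem joinedIn_quasiUnitOn_link (hs : 0 < s) (hε : ε ≤ η)
    (hψ : ∀ i j, MapsTo (ψ.toFun i j) (F.level r) (G.level s))
    {u : MatUnitization A n} (hu : u ∈ quasiUnitaries F ε r n) :
    JoinedIn (quasiUnitOn G η s (Fin n ⊕ Fin n))
      (dsum (matMap (ψ.hom false) n u) (matMap (0 : A →⋆ₙₐ[ℂ] B) n u))
      (dsum (matMap (0 : A →⋆ₙₐ[ℂ] B) n u) (matMap (ψ.hom true) n u)) := by
  rw [← link_one_zero, ← link_zero_one]
  refine joinedIn_of_circle (f := fun z => ψ.link z.1 z.2 u) (ψ.continuous_link u)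
    fun x y h => ⟨ψ.link_mem_levelOn hs hψ hu.1 x y, ?_, ?_⟩
  · rw [← link_star, link_mul ψ h, ← ψ.link_one x y, ← link_sub ψ h]
    exact (ψ.norm_link_le h _).trans_lt (hu.2.1.trans_le hε)
  · rw [← link_star, link_mul ψ h, ← ψ.link_one x y, ← link_sub ψ h]
    exact (ψ.norm_link_le h _).trans_lt (hu.2.2.trans_le hε)

end LinkingFamily

end Linking

/-! ### Reindexing -/

section Reindex

variable {B : Type*} [NonUnitalCStarAlgebra B] {ι κ : Type*} [Fintype ι] [Fintype κ]
  [DecidableEq ι] [DecidableEq κ] {G : CStarFiltration B} {ε r : ℝ}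

/-- Relabelling the rows and columns of a matrix. -/
noncomputable def relabel (e : ι ≃ κ) : CStarMatrix ι ι (Unitization ℂ B) ≃⋆ₐ[ℂ]
    CStarMatrix κ κ (Unitization ℂ B) := CStarMatrix.reindexₐ ℂ (Unitization ℂ B) e

theorem relabel_apply (e : ι ≃ κ) (a : CStarMatrix ι ι (Unitization ℂ B)) (i j : κ) :
    relabel e a i j = a (e.symm i) (e.symm j) := rfl

theorem relabel_apply_apply (e : ι ≃ κ) (a : CStarMatrix ι ι (Unitization ℂ B)) (i j : ι) :
    relabel e a (e i) (e j) = a i j := by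
  rw [relabel_apply, e.symm_apply_apply, e.symm_apply_apply]

theorem norm_relabel_le (e : ι ≃ κ) (a : CStarMatrix ι ι (Unitization ℂ B)) :
    ‖relabel e a‖ ≤ ‖a‖ := NonUnitalStarAlgHom.norm_apply_le (relabel e) a

theorem relabel_one (e : ι ≃ κ) :
    relabel e (1 : CStarMatrix ι ι (Unitization ℂ B)) = 1 := by
  refine CStarMatrix.ext fun i j => ?_
  rw [relabel_apply, CStarMatrix.one_apply, CStarMatrix.one_apply]
  simp

theorem continuous_relabel (e : ι ≃ κ) :
    Continuous (relabel e : CStarMatrix ι ι (Unitization ℂ B) → _) := by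
  refine AddMonoidHomClass.continuous_of_bound (relabel e) 1 fun a => ?_
  rw [one_mul]
  exact norm_relabel_le e a

/-- Direct sums live on sum types, whereas the K-groups are defined with `Fin n`; relabelling moves
homotopies from the former to the latter. For `ι = Fin n` the sets `quasiProjOn` and
`quasiProjections` agree by definition. -/
theorem relabel_mem_quasiProjOn (e : ι ≃ κ) :
    MapsTo (relabel e) (quasiProjOn G ε r ι) (quasiProjOn G ε r κ) := by
  rintro a ⟨h1, h2, h3⟩
  refine ⟨fun i j => h1 _ _, by rw [← map_star, h2], ?_⟩
  rw [← map_mul, ← map_sub]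
  exact (norm_relabel_le e _).trans_lt h3

theorem relabel_mem_quasiUnitOn (e : ι ≃ κ) :
    MapsTo (relabel e) (quasiUnitOn G ε r ι) (quasiUnitOn G ε r κ) := by
  rintro a ⟨h1, h2, h3⟩
  refine ⟨fun i j => h1 _ _, ?_, ?_⟩
  · rw [← map_star, ← map_mul, ← relabel_one e, ← map_sub]
    exact (norm_relabel_le e _).trans_lt h2
  · rw [← map_star, ← map_mul, ← relabel_one e, ← map_sub]
    exact (norm_relabel_le e _).trans_lt h3

theorem JoinedIn.relabel {S : Set (CStarMatrix ι ι (Unitization ℂ B))}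
    {T : Set (CStarMatrix κ κ (Unitization ℂ B))} (e : ι ≃ κ)
    (h : MapsTo (ControlledK.relabel e) S T) {a b : CStarMatrix ι ι (Unitization ℂ B)}
    (hab : JoinedIn S a b) : JoinedIn T (ControlledK.relabel e a) (ControlledK.relabel e b) :=
  (hab.map (continuous_relabel e)).mono h.image_subset

theorem relabel_sumAssoc_dsum {τ : Type*} [Fintype τ] [DecidableEq τ]
    (a : CStarMatrix ι ι (Unitization ℂ B)) (b : CStarMatrix κ κ (Unitization ℂ B))
    (c : CStarMatrix τ τ (Unitization ℂ B)) :
    relabel (Equiv.sumAssoc ι κ τ) (dsum (dsum a b) c) = dsum a (dsum b c) :=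
  CStarMatrix.ext fun i j => by rcases i with i | i | i <;> rcases j with j | j | j <;> rfl

theorem pad_apply {R : Type*} [Zero R] (d : R) {n : ℕ} (N : ℕ)
    (a : CStarMatrix (Fin n) (Fin n) R) (i j : Fin N) : pad d N a i j =
      if h : i.1 < n ∧ j.1 < n then a ⟨i.1, h.1⟩ ⟨j.1, h.2⟩ else if i = j then d else 0 := rfl

theorem dsum_inl_inl {R : Type*} [Zero R] (a : CStarMatrix ι ι R) (d : CStarMatrix κ κ R)
    (i j : ι) : dsum a d (Sum.inl i) (Sum.inl j) = a i j := rfl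

theorem dsum_inl_inr {R : Type*} [Zero R] (a : CStarMatrix ι ι R) (d : CStarMatrix κ κ R)
    (i : ι) (j : κ) : dsum a d (Sum.inl i) (Sum.inr j) = 0 := rfl

theorem dsum_inr_inl {R : Type*} [Zero R] (a : CStarMatrix ι ι R) (d : CStarMatrix κ κ R)
    (i : κ) (j : ι) : dsum a d (Sum.inr i) (Sum.inl j) = 0 := rfl

theorem dsum_inr_inr {R : Type*} [Zero R] (a : CStarMatrix ι ι R) (d : CStarMatrix κ κ R)
    (i j : κ) : dsum a d (Sum.inr i) (Sum.inr j) = d i j := rfl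

/-- Translates `pad`, defined by comparing indices, into a block sum. -/
theorem pad_add {n k : ℕ} (x : Unitization ℂ B)
    (a : CStarMatrix (Fin n) (Fin n) (Unitization ℂ B)) :
    pad x (n + k) a = relabel finSumFinEquiv
      (dsum a (CStarMatrix.ofMatrix (Matrix.diagonal fun _ : Fin k => x))) := by
  refine CStarMatrix.ext fun i j => ?_
  obtain ⟨i, rfl⟩ := finSumFinEquiv.surjective i
  obtain ⟨j, rfl⟩ := finSumFinEquiv.surjective j
  rw [relabel_apply_apply, pad_apply]
  rcases i with i | i <;> rcases j with j | j
  · simp [dsum_inl_inl]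
  · have : i.1 ≠ n + j.1 := by omega
    simp [dsum_inl_inr, Fin.ext_iff, this]
  · have : n + i.1 ≠ j.1 := by omega
    simp [dsum_inr_inl, Fin.ext_iff, this]
  · simp [dsum_inr_inr, Matrix.diagonal_apply]

theorem pad_one_add {n k : ℕ} (a : CStarMatrix (Fin n) (Fin n) (Unitization ℂ B)) :
    pad 1 (n + k) a = relabel finSumFinEquiv (dsum a (1 : CStarMatrix (Fin k) (Fin k) _)) :=
  pad_add 1 a

theorem pad_zero_add {n k : ℕ} (a : CStarMatrix (Fin n) (Fin n) (Unitization ℂ B)) :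
    pad 0 (n + k) a = relabel finSumFinEquiv (dsum a (0 : CStarMatrix (Fin k) (Fin k) _)) := by
  rw [pad_add]
  congr 2
  exact Matrix.diagonal_zero

theorem relabel_dsum_relabel_left {ι' τ : Type*} [Fintype ι'] [Fintype τ] [DecidableEq ι'] [DecidableEq τ]
    (f : ι' ⊕ κ ≃ τ) (g : ι ≃ ι') (a : CStarMatrix ι ι (Unitization ℂ B))
    (d : CStarMatrix κ κ (Unitization ℂ B)) :
    relabel f (dsum (relabel g a) d) =
      relabel ((g.sumCongr (Equiv.refl κ)).trans f) (dsum a d) := by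
  refine CStarMatrix.ext fun i j => ?_
  obtain ⟨i, rfl⟩ := f.surjective i
  obtain ⟨j, rfl⟩ := f.surjective j
  rw [relabel_apply_apply, relabel_apply, Equiv.symm_trans_apply, Equiv.symm_trans_apply,
    f.symm_apply_apply, f.symm_apply_apply]
  rcases i with i | i <;> rcases j with j | j <;> rfl

theorem relabel_dsum_relabel_right {κ' τ : Type*} [Fintype κ'] [Fintype τ] [DecidableEq κ'] [DecidableEq τ]
    (f : ι ⊕ κ' ≃ τ) (g : κ ≃ κ') (a : CStarMatrix ι ι (Unitization ℂ B))
    (d : CStarMatrix κ κ (Unitization ℂ B)) :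
    relabel f (dsum a (relabel g d)) =
      relabel (((Equiv.refl ι).sumCongr g).trans f) (dsum a d) := by
  refine CStarMatrix.ext fun i j => ?_
  obtain ⟨i, rfl⟩ := f.surjective i
  obtain ⟨j, rfl⟩ := f.surjective j
  rw [relabel_apply_apply, relabel_apply, Equiv.symm_trans_apply, Equiv.symm_trans_apply,
    f.symm_apply_apply, f.symm_apply_apply]
  rcases i with i | i <;> rcases j with j | j <;> rfl

/-- Exchanging the third and the fourth of four blocks. -/
def sumSwap (α β γ δ : Type*) : (α ⊕ (β ⊕ γ)) ⊕ δ ≃ (α ⊕ (β ⊕ δ)) ⊕ γ where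
  toFun := Sum.elim (Sum.elim (fun a => .inl (.inl a))
    (Sum.elim (fun b => .inl (.inr (.inl b))) fun c => .inr c)) fun d => .inl (.inr (.inr d))
  invFun := Sum.elim (Sum.elim (fun a => .inl (.inl a))
    (Sum.elim (fun b => .inl (.inr (.inl b))) fun c => .inr c)) fun d => .inl (.inr (.inr d))
  left_inv := by rintro ((a | b | c) | d) <;> rfl
  right_inv := by rintro ((a | b | c) | d) <;> rfl

theorem relabel_sumSwap {τ σ : Type*} [Fintype τ] [DecidableEq τ] [Fintype σ] [DecidableEq σ]
    (a : CStarMatrix ι ι (Unitization ℂ B)) :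
    relabel (sumSwap ι κ τ σ) (dsum (dsum a (dsum 1 0)) 1) = dsum (dsum a 1) 0 := by
  rw [← dsum_one (ι := κ) (κ := σ)]
  refine CStarMatrix.ext fun i j => ?_
  rcases i with (i | i | i) | i <;> rcases j with (j | j | j) | j <;> rfl

/-- The numbering of four blocks of indices in which the third block comes last. -/
def finSumEquiv (n l : ℕ) :
    (Fin n ⊕ (Fin n ⊕ Fin n)) ⊕ Fin l ≃ Fin (n + (n + l) + n) :=
  (sumSwap (Fin n) (Fin n) (Fin n) (Fin l)).trans
    (((((Equiv.refl (Fin n)).sumCongr finSumFinEquiv).trans finSumFinEquiv).sumCongr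
      (Equiv.refl (Fin n))).trans finSumFinEquiv)

theorem relabel_relabel {τ : Type*} [Fintype τ] (e : ι ≃ κ) (f : κ ≃ τ)
    (a : CStarMatrix ι ι (Unitization ℂ B)) :
    relabel f (relabel e a) = relabel (e.trans f) a := rfl

/-- The relation defining `K₀` adds ones first and zeros last, while the homotopy constructed below
has blocks in the order `a, 1, 0, 1`. -/
theorem pad_zero_pad_one {n l : ℕ} (a : MatUnitization B n) :
    pad 0 (n + (n + l) + n) (pad 1 (n + (n + l)) a) =
      relabel (finSumEquiv n l) (dsum (dsum a (dsum 1 0)) 1) := by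
  rw [finSumEquiv, ← relabel_relabel, relabel_sumSwap, ← relabel_dsum_relabel_left,
    ← relabel_dsum_relabel_right, relabel_one, ← pad_one_add, ← pad_zero_add]

end Reindex

/-! ### Linked homomorphisms induce the same map in controlled K-theory -/

namespace LinkingFamily

variable {A B : Type*} [NonUnitalCStarAlgebra A] [NonUnitalCStarAlgebra B]
  {F : CStarFiltration A} {G : CStarFiltration B} {ε η r s : ℝ}

/-- With `q` the scalar part of `p` and `φᵢ` the two homomorphisms, the chain is `diag(φ₀ p, 1, 0) ~
diag(φ₀ p, q, 1 - q) ~ diag(φ₁ p, q, 1 - q) ~ diag(φ₁ p, 1, 0)`. The middle step is the link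
followed by a swap, with `1 - q` held fixed. -/
theorem joinedIn_quasiProjOn (ψ : LinkingFamily A B) (hs : 0 < s) (hε : ε ≤ η)
    (hψ : ∀ i j, MapsTo (ψ.toFun i j) (F.level r) (G.level s)) {n : ℕ}
    {p : MatUnitization A n} (hp : p ∈ quasiProjections F ε r n) :
    JoinedIn (quasiProjOn G η s (Fin n ⊕ (Fin n ⊕ Fin n)))
      (dsum (matMap (ψ.hom false) n p) (dsum 1 0))
      (dsum (matMap (ψ.hom true) n p) (dsum 1 0)) := by
  have h0 : matMap (0 : A →⋆ₙₐ[ℂ] B) n p ∈ quasiProjOn G η s (Fin n) :=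
    matMap_mem_quasiProjections hε (fun _ _ => G.zero_mem s hs) n hp
  have hi : ∀ i, matMap (ψ.hom i) n p ∈ quasiProjOn G η s (Fin n) := fun i =>
    matMap_mem_quasiProjections hε (hψ i i) n hp
  have h1 : 1 - matMap (0 : A →⋆ₙₐ[ℂ] B) n p ∈ quasiProjOn G η s (Fin n) := by
    refine ⟨sub_mem_levelOn hs (one_mem_levelOn hs) h0.1, by rw [star_sub, star_one, h0.2.1], ?_⟩
    have := h0.2.2
    convert this using 2
    noncomm_ring
  have hcompl : ∀ i, JoinedIn (quasiProjOn G η s (Fin n ⊕ (Fin n ⊕ Fin n)))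
      (dsum (matMap (ψ.hom i) n p)
        (dsum (matMap (0 : A →⋆ₙₐ[ℂ] B) n p) (1 - matMap (0 : A →⋆ₙₐ[ℂ] B) n p)))
      (dsum (matMap (ψ.hom i) n p) (dsum 1 0)) := fun i =>
    JoinedIn.dsum (fun a ha d hd => dsum_mem_quasiProjOn hs ha hd) (JoinedIn.refl (hi i))
      (joinedIn_dsum_compl hs h0)
  have hlink := (ψ.joinedIn_quasiProjOn_link hs hε hψ hp).trans
    (joinedIn_quasiProjOn_swap hs h0 (hi true))
  have := JoinedIn.relabel (Equiv.sumAssoc _ _ _) (relabel_mem_quasiProjOn _)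
    (JoinedIn.dsum (fun a ha d hd => dsum_mem_quasiProjOn hs ha hd) hlink (JoinedIn.refl h1))
  rw [relabel_sumAssoc_dsum, relabel_sumAssoc_dsum] at this
  exact (hcompl false).symm.trans (this.trans (hcompl true))

/-- As for projections, with the adjoint of the scalar part in place of the complement. Only the
cancellation by Whitehead's lemma needs `(3η, 2s)`, which is the relation in `K₁` with parameters
`(η, s)`. -/
theorem joinedIn_quasiUnitOn (ψ : LinkingFamily A B) (hs : 0 < s) (hε : ε ≤ η)
    (hη : η ≤ 1) (hψ : ∀ i j, MapsTo (ψ.toFun i j) (F.level r) (G.level s)) {n : ℕ}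
    {u : MatUnitization A n} (hu : u ∈ quasiUnitaries F ε r n) :
    JoinedIn (quasiUnitOn G (3 * η) (2 * s) (Fin n ⊕ (Fin n ⊕ Fin n)))
      (dsum (matMap (ψ.hom false) n u) 1) (dsum (matMap (ψ.hom true) n u) 1) := by
  have h0 : matMap (0 : A →⋆ₙₐ[ℂ] B) n u ∈ quasiUnitOn G η s (Fin n) :=
    matMap_mem_quasiUnitaries hε (fun _ _ => G.zero_mem s hs) n hu
  have hi : ∀ i, matMap (ψ.hom i) n u ∈ quasiUnitOn G η s (Fin n) := fun i =>
    matMap_mem_quasiUnitaries hε (hψ i i) n hu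
  have hs2 : 0 < 2 * s := by positivity
  have hη0 : 0 < η := (norm_nonneg _).trans_lt h0.2.1
  have hη3 : η ≤ 3 * η := by linarith
  have hs12 : s ≤ 2 * s := by linarith
  have hcompl : ∀ i, JoinedIn (quasiUnitOn G (3 * η) (2 * s) (Fin n ⊕ (Fin n ⊕ Fin n)))
      (dsum (matMap (ψ.hom i) n u)
        (dsum (matMap (0 : A →⋆ₙₐ[ℂ] B) n u) (star (matMap (0 : A →⋆ₙₐ[ℂ] B) n u))))
      (dsum (matMap (ψ.hom i) n u) 1) := fun i =>
    JoinedIn.dsum (fun a ha d hd => dsum_mem_quasiUnitOn hs2 ha hd)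
      (JoinedIn.refl (quasiUnitOn_mono hs hη3 hs12 (hi i))) (joinedIn_dsum_star hs hη h0)
  have hlink := (ψ.joinedIn_quasiUnitOn_link hs hε hψ hu).trans
    (joinedIn_quasiUnitOn_swap hs h0 (hi true))
  have := (JoinedIn.relabel (Equiv.sumAssoc _ _ _) (relabel_mem_quasiUnitOn _)
    (JoinedIn.dsum (fun a ha d hd => dsum_mem_quasiUnitOn hs ha hd) hlink
      (JoinedIn.refl (star_mem_quasiUnitOn hs h0)))).mono (quasiUnitOn_mono hs hη3 hs12)
  rw [relabel_sumAssoc_dsum, relabel_sumAssoc_dsum] at this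
  exact (hcompl false).symm.trans (this.trans (hcompl true))

theorem K0_map_eq (ψ : LinkingFamily A B) (hs : 0 < s) (hε : ε ≤ η)
    (hψ : ∀ i j, MapsTo (ψ.toFun i j) (F.level r) (G.level s)) :
    (K0.map (ψ.hom false) hε (hψ false false) : K0 F ε r → K0 G η s) =
      K0.map (ψ.hom true) hε (hψ true true) := by
  funext x
  obtain ⟨q, hq⟩ := x
  refine Subtype.ext ?_
  obtain ⟨p, l, rfl, -⟩ := hq
  -- The stabilization is `k = p.size`, the size of the block `1` left by the cancellation; its
  -- companion block `0` gives the trailing zeros, and `l` further ones complete `I_{k+l}`.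
  refine Quot.sound ⟨p.size, p.pos, p.size + (p.size + l) + p.size, Nat.le_add_right _ _,
    Nat.le_add_right _ _, ?_⟩
  have h0 : 0 < η := (norm_nonneg _).trans_lt (p.mem.2.2.trans_le hε)
  have hJ := JoinedIn.relabel (finSumEquiv p.size l) (relabel_mem_quasiProjOn _)
    (JoinedIn.dsum (fun a ha d hd => dsum_mem_quasiProjOn hs ha hd)
      (ψ.joinedIn_quasiProjOn hs hε hψ p.mem)
      (JoinedIn.refl (one_mem_quasiProjOn (ι := Fin l) h0 hs)))
  rw [← pad_zero_pad_one, ← pad_zero_pad_one] at hJ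
  exact hJ

theorem K1_map_eq (ψ : LinkingFamily A B) (hs : 0 < s) (hε : ε ≤ η) (hη : η ≤ 1)
    (hψ : ∀ i j, MapsTo (ψ.toFun i j) (F.level r) (G.level s))
    (h₀ : MapsTo (ψ.hom false) (F.level (2 * r)) (G.level (2 * s)))
    (h₁ : MapsTo (ψ.hom true) (F.level (2 * r)) (G.level (2 * s))) :
    (K1.map (ψ.hom false) hε (hψ false false) h₀ : K1 F ε r → K1 G η s) =
      K1.map (ψ.hom true) hε (hψ true true) h₁ := by
  funext x
  obtain ⟨u, rfl⟩ := Quot.exists_rep x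
  refine Quot.sound ⟨u.size + (u.size + u.size), Nat.le_add_right _ _, Nat.le_add_right _ _, ?_⟩
  have hJ := JoinedIn.relabel
    (((Equiv.refl (Fin u.size)).sumCongr finSumFinEquiv).trans finSumFinEquiv)
    (relabel_mem_quasiUnitOn _) (ψ.joinedIn_quasiUnitOn hs hε hη hψ u.mem)
  rw [← relabel_dsum_relabel_right, ← relabel_dsum_relabel_right, relabel_one, ← pad_one_add,
    ← pad_one_add] at hJ
  exact hJ

end LinkingFamily

/-! ### Covers of nearby maps -/

section Nearby

variable {X Y : Type*} [MetricSpace X] [MetricSpace Y] {HX HY : Type*}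
  [NormedAddCommGroup HX] [InnerProductSpace ℂ HX] [CompleteSpace HX]
  [NormedAddCommGroup HY] [InnerProductSpace ℂ HY] [CompleteSpace HY]

theorem adjoint_comp_self_isometry (V : HX →ₗᵢ[ℂ] HY) (v : HX) :
    ContinuousLinearMap.adjoint V.toContinuousLinearMap (V.toContinuousLinearMap v) = v := by
  refine ext_inner_right ℂ fun w => ?_
  rw [ContinuousLinearMap.adjoint_inner_left]
  exact V.inner_map_map v w

/-- The map `T ↦ V T V'*`, for isometries `V` and `V'`. -/
noncomputable def corner (V V' : HX →ₗᵢ[ℂ] HY) : (HX →L[ℂ] HX) →ₗ[ℂ] (HY →L[ℂ] HY) where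
  toFun T := V.toContinuousLinearMap ∘L T ∘L ContinuousLinearMap.adjoint V'.toContinuousLinearMap
  map_smul' c T := by ext v; simp
  map_add' S T := by ext v; simp

theorem corner_apply (V V' : HX →ₗᵢ[ℂ] HY) (T : HX →L[ℂ] HX) : corner V V' T =
    V.toContinuousLinearMap ∘L T ∘L ContinuousLinearMap.adjoint V'.toContinuousLinearMap := rfl

/-- The middle factor `V'* V'` is the identity, whatever the outer isometries are. -/
theorem corner_mul_corner (V V' V'' : HX →ₗᵢ[ℂ] HY) (S T : HX →L[ℂ] HX) :
    corner V V' S * corner V' V'' T = corner V V'' (S * T) := by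
  ext v
  simp only [corner_apply, mul_apply_eq_comp, ContinuousLinearMap.comp_apply,
    adjoint_comp_self_isometry]

theorem star_corner (V V' : HX →ₗᵢ[ℂ] HY) (T : HX →L[ℂ] HX) :
    star (corner V V' T) = corner V' V (star T) := by
  simp only [corner_apply, ContinuousLinearMap.star_eq_adjoint, ContinuousLinearMap.adjoint_comp,
    ContinuousLinearMap.adjoint_adjoint]
  rfl

theorem norm_corner_le (V V' : HX →ₗᵢ[ℂ] HY) (T : HX →L[ℂ] HX) : ‖corner V V' T‖ ≤ ‖T‖ := by
  have h : ∀ W : HX →ₗᵢ[ℂ] HY, ‖W.toContinuousLinearMap‖ ≤ 1 := fun W =>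
    W.norm_toContinuousLinearMap_le
  calc ‖corner V V' T‖ ≤ ‖V.toContinuousLinearMap‖ *
        (‖T‖ * ‖ContinuousLinearMap.adjoint V'.toContinuousLinearMap‖) :=
        (ContinuousLinearMap.opNorm_comp_le _ _).trans
          (by gcongr; exact ContinuousLinearMap.opNorm_comp_le _ _)
    _ ≤ 1 * (‖T‖ * 1) := by
        rw [LinearIsometryEquiv.norm_map]
        gcongr
        · exact h V
        · exact h V'
    _ = ‖T‖ := by ring

theorem continuous_corner (V V' : HX →ₗᵢ[ℂ] HY) : Continuous (corner V V') :=
  AddMonoidHomClass.continuous_of_bound (corner V V') 1 fun T => by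
    rw [one_mul]; exact norm_corner_le V V' T

variable [ProperSpace X] [ProperSpace Y] {MX : AmpleModule X HX} {MY : AmpleModule Y HY}
  {f f' : X → Y} {δ : ℝ} {V V' : HX →ₗᵢ[ℂ] HY}

/-- Supports compose when the right-hand factor is proper. For `V'*` this holds because `f'` pulls
bounded sets back to bounded sets. -/
theorem exists_of_mem_opSupport_corner (hf' : IsCoarseMap f') (hV : IsCover MX MY f δ V)
    (hV' : IsCover MX MY f' δ V') {T : HX →L[ℂ] HX} (hT : propagation MX T < ⊤) {z y : Y}
    (h : (z, y) ∈ opSupport MY MY (corner V V' T)) :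
    ∃ x₁ x, dist z (f x₁) < δ ∧ (x₁, x) ∈ opSupport MX MX T ∧ dist y (f' x) < δ := by
  have hTV : ∀ {x₁ : X} {y : Y}, (x₁, y) ∈ opSupport MY MX
      (T ∘L ContinuousLinearMap.adjoint V'.toContinuousLinearMap) →
      ∃ x, (x₁, x) ∈ opSupport MX MX T ∧ (x, y) ∈ opSupport MY MX
        (ContinuousLinearMap.adjoint V'.toContinuousLinearMap) := by
    intro x₁ y h
    refine opSupport_comp (fun y => ?_) h
    obtain ⟨K, hK, hK'⟩ := opSupport_adjoint_proper hf' hV'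
      (Metric.isBounded_closedBall (x := y) (r := 1))
    exact ⟨_, Metric.closedBall_mem_nhds y one_pos, K, hK, fun y' hy' x hx => hK' y' hy' x hx⟩
  obtain ⟨x₁, h1, h2⟩ := opSupport_comp (S := T ∘L
    ContinuousLinearMap.adjoint V'.toContinuousLinearMap) (T := V.toContinuousLinearMap)
    (MX := MY) (MY := MX) (MZ := MY) (fun y => by
      obtain ⟨K, hK, hK'⟩ := opSupport_adjoint_proper hf' hV'
        (Metric.isBounded_closedBall (x := y) (r := 1))
      -- Properness of `T V'*`: finite propagation enlarges the compact set for `V'*` to a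
      -- thickening, still compact as `X` is proper.
      refine ⟨_, Metric.closedBall_mem_nhds y one_pos,
        Metric.cthickening (propagation MX T).toReal K, hK.cthickening, fun y' hy' x₁ hx => ?_⟩
      obtain ⟨x, h1, h2⟩ := hTV hx
      refine Metric.mem_cthickening_of_dist_le _ x _ _ (hK' y' hy' x h2) ?_
      rw [dist_comm, dist_edist]
      exact ENNReal.toReal_mono hT.ne (edist_le_propagation h1)) h
  obtain ⟨x, h3, h4⟩ := hTV h2
  exact ⟨x₁, x, hV _ _ h1, h3, hV' _ _ (opSupport_adjoint_subset _ h4)⟩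

/-- A point `(z, y)` of the support is bridged by `y → f' x → f x → f x₁ → z`, with steps of length
at most `δ`, `d`, the expansion of `f`, and `δ`. -/
theorem propagation_corner_le (hf' : IsCoarseMap f') (hV : IsCover MX MY f δ V)
    (hV' : IsCover MX MY f' δ V') {d : ℝ} (hd : ∀ x, dist (f' x) (f x) ≤ d) {T : HX →L[ℂ] HX}
    {r : ℝ} (hT : propagation MX T < ENNReal.ofReal r) :
    propagation MY (corner V V' T) ≤ expansion f r + ENNReal.ofReal (2 * δ + d) := by
  refine iSup₂_le fun p hp => ?_
  obtain ⟨x₁, x, h1, h2, h3⟩ := exists_of_mem_opSupport_corner hf' hV hV'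
    (hT.trans ENNReal.ofReal_lt_top) hp
  have hδ : 0 ≤ δ := dist_nonneg.trans h1.le
  have hd0 : 0 ≤ d := dist_nonneg.trans (hd x)
  have h4 : dist x x₁ < r := by
    have := (edist_le_propagation h2).trans_lt hT
    rwa [edist_lt_ofReal] at this
  calc edist p.2 p.1 ≤ edist p.2 (f' x) + edist (f' x) (f x₁) + edist (f x₁) p.1 :=
        edist_triangle4 _ _ _ _
    _ ≤ edist p.2 (f' x) + (edist (f' x) (f x) + edist (f x) (f x₁)) + edist (f x₁) p.1 := by
        gcongr; exact edist_triangle _ _ _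
    _ ≤ ENNReal.ofReal δ + (ENNReal.ofReal d + expansion f r) + ENNReal.ofReal δ := by
        gcongr
        · exact (edist_lt_ofReal.2 h3).le
        · rw [edist_dist]; exact ENNReal.ofReal_le_ofReal (hd x)
        · exact edist_le_expansion f h4
        · rw [edist_comm]; exact (edist_lt_ofReal.2 h1).le
    _ = _ := by
        rw [two_mul, ENNReal.ofReal_add (add_nonneg hδ hδ) hd0, ENNReal.ofReal_add hδ hδ]; ring

/-- For compactly supported `g`, the operator `V'* g` is absorbed by a cutoff `φ` on `X`, so `V S
V'* g = V (S φ) V'* g` is compact because `S φ` is. -/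
theorem corner_mem_roeAlgebra (hf : IsCoarseMap f) (hf' : IsCoarseMap f')
    (hV : IsCover MX MY f δ V) (hV' : IsCover MX MY f' δ V') {d : ℝ}
    (hd : ∀ x, dist (f' x) (f x) ≤ d) {T : HX →L[ℂ] HX} (hT : T ∈ roeAlgebra MX) :
    corner V V' T ∈ roeAlgebra MY := by
  refine map_mem_closure (continuous_corner V V') hT fun S hS => ⟨fun g => ?_, ?_⟩
  · refine isCompactOperator_of_compactSupport (fun g hg => ?_) g
    obtain ⟨K, hK, hK'⟩ := opSupport_adjoint_proper hf' hV' hg.isBounded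
    obtain ⟨φ, -, -, -, W, hW, hKW, hφW⟩ := exists_cutoff hK isOpen_univ (subset_univ _)
    have h1 := absorb (MX := MY) (MY := MX) hg hW hφW fun x y hy hx => hKW (hK' y hy x hx)
    have h2 : corner V V' S ∘L MY.rep g = V.toContinuousLinearMap ∘L ((S ∘L MX.rep φ) ∘L
        (ContinuousLinearMap.adjoint V'.toContinuousLinearMap ∘L MY.rep g)) := by
      calc corner V V' S ∘L MY.rep g = V.toContinuousLinearMap ∘L S ∘L
            (ContinuousLinearMap.adjoint V'.toContinuousLinearMap ∘L MY.rep g) := rfl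
        _ = V.toContinuousLinearMap ∘L S ∘L (MX.rep φ ∘L
            ContinuousLinearMap.adjoint V'.toContinuousLinearMap ∘L MY.rep g) := by rw [h1]
        _ = _ := rfl
    rw [h2]
    exact ((hS.1 φ).comp_clm _).clm_comp _
  · have h3 : propagation MX S < ENNReal.ofReal ((propagation MX S).toReal + 1) := by
      rw [ENNReal.lt_ofReal_iff_toReal_lt hS.2.ne]; linarith
    exact (propagation_corner_le hf' hV hV' hd h3).trans_lt (ENNReal.add_lt_top.2
      ⟨hf.expansion_lt_top _ (by positivity), ENNReal.ofReal_lt_top⟩)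

/-- The linking family `T ↦ Vᵢ T Vⱼ*` of covers `V₀`, `V₁` of nearby coarse maps. -/
noncomputable def coverLinking {f : Bool → X → Y} {V : Bool → HX →ₗᵢ[ℂ] HY}
    (hf : ∀ i, IsCoarseMap (f i)) (hV : ∀ i, IsCover MX MY (f i) δ (V i)) {d : ℝ}
    (hd : ∀ i j x, dist (f i x) (f j x) ≤ d) :
    LinkingFamily (roeAlgebra MX) (roeAlgebra MY) where
  toFun i j :=
    { toFun := fun T => ⟨corner (V i) (V j) T,
        corner_mem_roeAlgebra (hf i) (hf j) (hV i) (hV j) (hd j i) T.2⟩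
      map_add' := fun S T => Subtype.ext (map_add (corner (V i) (V j)) (S : HX →L[ℂ] HX) T)
      map_smul' := fun c T => Subtype.ext (map_smul (corner (V i) (V j)) c (T : HX →L[ℂ] HX)) }
  mul_toFun i j k _ _ := Subtype.ext (corner_mul_corner (V i) (V j) (V k) _ _)
  star_toFun i j _ := Subtype.ext (star_corner (V i) (V j) _)

/-- Taking `d = δ`, all four corners send propagation below `r` to propagation at most `cr + 3δ`,
which is strictly below `5(cr + 2δ)`. -/
theorem mapsTo_coverLinking {f : Bool → X → Y} {V : Bool → HX →ₗᵢ[ℂ] HY}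
    (hf : ∀ i, IsCoarseMap (f i)) (hV : ∀ i, IsCover MX MY (f i) δ (V i)) (hδ : 0 < δ)
    (hd : ∀ i j x, dist (f i x) (f j x) ≤ δ) {c : ℝ≥0} (hc : ∀ i, LipschitzWith c (f i)) {r : ℝ}
    (hr : 0 < r) (i j : Bool) :
    MapsTo ((coverLinking hf hV hd).toFun i j) ((roeFiltration MX).level r)
      ((roeFiltration MY).level (5 * (c * r + 2 * δ))) := by
  intro T hT
  have hcont : Continuous ((coverLinking hf hV hd).toFun i j) :=
    ((continuous_corner (V i) (V j)).comp continuous_subtype_val).subtype_mk _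
  have h : c * r + (2 * δ + δ) < 5 * (c * r + 2 * δ) := by
    have : 0 ≤ c * r := by positivity
    linarith
  refine map_mem_closure hcont hT fun S hS => ?_
  calc propagation MY (corner (V i) (V j) (S : HX →L[ℂ] HX))
      ≤ expansion (f i) r + ENNReal.ofReal (2 * δ + δ) :=
        propagation_corner_le (hf j) (hV i) (hV j) (hd j i) hS
    _ ≤ ENNReal.ofReal (c * r) + ENNReal.ofReal (2 * δ + δ) := by
        gcongr; exact expansion_le (hc i) r
    _ = ENNReal.ofReal (c * r + (2 * δ + δ)) :=
        (ENNReal.ofReal_add (by positivity) (by positivity)).symm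
    _ < ENNReal.ofReal (5 * (c * r + 2 * δ)) :=
        (ENNReal.ofReal_lt_ofReal_iff_of_nonneg (by positivity)).2 h

/-- Covers of maps at distance at most `δ` induce the same maps in controlled K-theory. -/
theorem adK_eq_of_dist_le (hf : IsCoarseMap f) (hf' : IsCoarseMap f')
    (hV : IsCover MX MY f δ V) (hV' : IsCover MX MY f' δ V') (hδ : 0 < δ)
    (hd : ∀ x, dist (f x) (f' x) ≤ δ) {c : ℝ≥0} (hc : LipschitzWith c f)
    (hc' : LipschitzWith c f') {ε r : ℝ} (hε : 0 < ε) (hε' : 21 * ε ≤ 1) (hr : 0 < r) :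
    adK0 hf hV hδ hc hε hr = adK0 hf' hV' hδ hc' hε hr ∧
      adK1 hf hV hδ hc hε hr = adK1 hf' hV' hδ hc' hε hr := by
  have hF : ∀ i, IsCoarseMap (cond i f' f) := by rintro (_ | _); exacts [hf, hf']
  have hW : ∀ i, IsCover MX MY (cond i f' f) δ (cond i V' V) := by rintro (_ | _); exacts [hV, hV']
  have hC : ∀ i, LipschitzWith c (cond i f' f) := by rintro (_ | _); exacts [hc, hc']
  have hD : ∀ i j x, dist (cond i f' f x) (cond j f' f x) ≤ δ := by
    rintro (_ | _) (_ | _) x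
    · simpa using hδ.le
    · exact hd x
    · rw [dist_comm]; exact hd x
    · simpa using hδ.le
  have hs : 0 < 5 * (c * r + 2 * δ) := by positivity
  -- The index `false` stands for `f` and `true` for `f'`; the diagonal homomorphisms of the family
  -- unfold to `adCover`.
  exact ⟨(coverLinking hF hW hD).K0_map_eq hs (by linarith)
      (mapsTo_coverLinking hF hW hδ hD hC hr),
    (coverLinking hF hW hD).K1_map_eq hs (by linarith) hε'
      (mapsTo_coverLinking hF hW hδ hD hC hr)
      (mapsTo_adCover_of_lipschitz_two hf hV hδ hc hr)
      (mapsTo_adCover_of_lipschitz_two hf' hV' hδ hc' hr)⟩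

end Nearby

/-! ### Orthogonal isometries into infinite-dimensional subspaces -/

section Hilbert

variable {H K : Type*} [NormedAddCommGroup H] [InnerProductSpace ℂ H]
  [NormedAddCommGroup K] [InnerProductSpace ℂ K]

/-- Pairing with the finitely many vectors of `s` is a linear map from `L` to a finite-dimensional
space, so it has a kernel; normalize a nonzero element of it. -/
theorem exists_unit_mem_orthogonal (L : Submodule ℂ K) (hL : ¬ FiniteDimensional ℂ L)
    (s : Finset K) : ∃ y ∈ L, ‖y‖ = 1 ∧ ∀ x ∈ s, ⟪x, y⟫_ℂ = 0 := by
  let T : L →ₗ[ℂ] (s → ℂ) := LinearMap.pi fun x => (innerSL ℂ (x : K)).toLinearMap ∘ₗ L.subtype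
  have hT : ¬ Function.Injective T := fun h => hL (FiniteDimensional.of_injective T h)
  obtain ⟨z, hz, hz0⟩ : ∃ z, T z = 0 ∧ z ≠ 0 := by
    by_contra! hcon
    exact hT ((injective_iff_map_eq_zero T).2 hcon)
  have hz0' : ‖(z : K)‖ ≠ 0 := by simpa using hz0
  refine ⟨((‖(z : K)‖⁻¹ : ℝ) : ℂ) • (z : K), L.smul_mem _ z.2, ?_, fun x hx => ?_⟩
  · rw [norm_smul, Complex.norm_real, norm_inv, norm_norm, inv_mul_cancel₀ hz0']
  · have h : ⟪x, (z : K)⟫_ℂ = 0 := congrFun hz ⟨x, hx⟩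
    rw [inner_smul_right, h, mul_zero]

/-- Greedy choice: the `n`-th vector is a unit vector of `L n` orthogonal to the finite set `s n` of
those already chosen. -/
theorem exists_orthonormal_mem (L : ℕ → Submodule ℂ K) (hL : ∀ n, ¬ FiniteDimensional ℂ (L n)) :
    ∃ e : ℕ → K, Orthonormal ℂ e ∧ ∀ n, e n ∈ L n := by
  classical
  choose y hyL hy1 hy0 using fun n s => exists_unit_mem_orthogonal (L n) (hL n) s
  let s : ℕ → Finset K := fun n => Nat.rec ∅ (fun n t => insert (y n t) t) n
  have hs : ∀ n, s (n + 1) = insert (y n (s n)) (s n) := fun n => rfl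
  have hmono : Monotone s := monotone_nat_of_le_succ fun n => by
    rw [hs]; exact Finset.subset_insert _ _
  have hlt : ∀ m n, m < n → ⟪y m (s m), y n (s n)⟫_ℂ = 0 := fun m n hmn =>
    hy0 n (s n) _ (hmono (Nat.succ_le_of_lt hmn) (by rw [hs]; exact Finset.mem_insert_self _ _))
  refine ⟨fun n => y n (s n), ⟨fun n => hy1 n _, fun m n hmn => ?_⟩, fun n => hyL n _⟩
  rcases lt_or_gt_of_ne hmn with h | h
  · exact hlt m n h
  · exact inner_eq_zero_symm.1 (hlt n m h)

theorem inner_eq_zero_of_hasSum {ι : Type*} {f : ι → K} {a x : K} (hf : HasSum f a)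
    (h : ∀ i, ⟪x, f i⟫_ℂ = 0) : ⟪x, a⟫_ℂ = 0 := by
  have h1 := hf.mapL (innerSL ℂ x)
  simp only [innerSL_apply_apply, h] at h1
  exact h1.unique hasSum_zero

/-- Orthonormal vectors are at distance `√2`, so balls of radius `1/2` around them are disjoint. -/
theorem Orthonormal.countable [TopologicalSpace.SeparableSpace H] {ι : Type*} {e : ι → H}
    (he : Orthonormal ℂ e) : Countable ι := by
  refine Pairwise.countable_of_isOpen_disjoint (s := fun i => Metric.ball (e i) (1 / 2)) ?_
    (fun _ => Metric.isOpen_ball) fun i => ⟨e i, Metric.mem_ball_self (by norm_num)⟩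
  intro i j hij
  refine Metric.ball_disjoint_ball ?_
  have h : ‖e i - e j‖ ^ 2 = 2 := by
    rw [@norm_sub_sq ℂ, he.2 hij, he.1 i, he.1 j]; norm_num
  rw [dist_eq_norm]
  nlinarith [norm_nonneg (e i - e j)]

/-- One orthonormal sequence that visits each `L k` infinitely often splits into subsequences
indexed by `k`. The isometry `V k` sends a countable Hilbert basis of `H` into the `k`-th
subsequence; disjointness makes the ranges orthogonal, and closedness of `L k` contains them. -/
theorem exists_orthogonalFamily [CompleteSpace H] [CompleteSpace K]
    [TopologicalSpace.SeparableSpace H] (L : ℕ → Submodule ℂ K)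
    (hL : ∀ n, ¬ FiniteDimensional ℂ (L n)) (hcl : ∀ n, IsClosed (L n : Set K)) :
    ∃ V : ℕ → H →ₗᵢ[ℂ] K, OrthogonalFamily ℂ (fun _ => H) V ∧ ∀ n v, V n v ∈ L n := by
  obtain ⟨w, b, -⟩ := exists_hilbertBasis ℂ H
  have := Orthonormal.countable b.orthonormal
  obtain ⟨enc, henc⟩ := exists_injective_nat w
  obtain ⟨e, he, heL⟩ := exists_orthonormal_mem (fun m => L m.unpair.1) fun m => hL _
  have hek : ∀ k, Orthonormal ℂ fun i : w => e (Nat.pair k (enc i)) := fun k =>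
    he.comp _ fun i j hij => henc (Nat.pair_eq_pair.1 hij).2
  let V : ℕ → H →ₗᵢ[ℂ] K := fun k =>
    (hek k).orthogonalFamily.linearIsometry.comp b.repr.toLinearIsometry
  have hV : ∀ k v, HasSum (fun i => b.repr v i • e (Nat.pair k (enc i))) (V k v) := fun k v =>
    (hek k).orthogonalFamily.hasSum_linearIsometry (b.repr v)
  refine ⟨V, ?_, fun k v => ?_⟩
  · intro k l hkl v u
    refine inner_eq_zero_of_hasSum (hV l u) fun j => ?_
    rw [inner_smul_right]
    refine mul_eq_zero_of_right _ (inner_eq_zero_symm.1 ?_)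
    refine inner_eq_zero_of_hasSum (hV k v) fun i => ?_
    rw [inner_smul_right]
    exact mul_eq_zero_of_right _ (he.2 fun h => hkl (Nat.pair_eq_pair.1 h).1.symm)
  · refine (hcl k).mem_of_tendsto (hV k v) (Eventually.of_forall fun t => ?_)
    refine (L k).sum_mem fun i _ => (L k).smul_mem _ ?_
    simpa using heL (Nat.pair k (enc i))

end Hilbert

/-! ### Vectors localized in an open set -/

section Localized

variable {Y : Type*} [TopologicalSpace Y] {H : Type*} [NormedAddCommGroup H]
  [InnerProductSpace ℂ H] [CompleteSpace H]

/-- The vectors of `H` annihilated by all functions that vanish on `U`. -/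
def localized (M : AmpleModule Y H) (U : Set Y) : Submodule ℂ H where
  carrier := {v | ∀ ψ : C₀(Y, ℂ), (∀ y ∈ U, ψ y = 0) → M.rep ψ v = 0}
  add_mem' hv hw ψ hψ := by rw [map_add, hv ψ hψ, hw ψ hψ, add_zero]
  zero_mem' ψ _ := map_zero _
  smul_mem' c v hv ψ hψ := by rw [map_smul, hv ψ hψ, smul_zero]

theorem isClosed_localized (M : AmpleModule Y H) (U : Set Y) :
    IsClosed (localized M U : Set H) := by
  have : (localized M U : Set H) =
      ⋂ (ψ : C₀(Y, ℂ)) (_ : ∀ y ∈ U, ψ y = 0), {v | M.rep ψ v = 0} := by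
    ext v
    simp [localized]
  rw [this]
  exact isClosed_iInter fun ψ => isClosed_iInter fun _ =>
    isClosed_eq (M.rep ψ).continuous continuous_const

/-- For a nonzero `φ` supported in `U`, the range of `φ` consists of localized vectors. Were these
finite-dimensional, `φ` would have finite rank, against ampleness. -/
theorem not_finiteDimensional_localized [T2Space Y] [LocallyCompactSpace Y]
    (M : AmpleModule Y H) {U : Set Y} (hU : IsOpen U) (hne : U.Nonempty) :
    ¬ FiniteDimensional ℂ (localized M U) := by
  intro hfin
  obtain ⟨y, hy⟩ := hne
  obtain ⟨φ, -, hφU, -, W, -, hyW, hφW⟩ :=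
    exists_cutoff (isCompact_singleton (x := y)) hU (singleton_subset_iff.2 hy)
  have hφ0 : φ ≠ 0 := fun h => by
    have := hφW y (hyW rfl)
    simp [h] at this
  refine M.not_compact φ hφ0 ?_
  have hmem : ∀ v, M.rep φ v ∈ localized M U := fun v ψ hψ => by
    have h0 : ψ * φ = 0 := by
      ext z
      change ψ z * φ z = 0
      by_cases hz : z ∈ U
      · rw [hψ z hz, zero_mul]
      · rw [image_eq_zero_of_notMem_tsupport fun h => hz (hφU h), mul_zero]
    have h1 : M.rep ψ (M.rep φ v) = M.rep (ψ * φ) v := by rw [map_mul]; rfl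
    rw [h1, h0, map_zero, zero_apply]
  have hproper : ProperSpace (localized M U) := FiniteDimensional.proper ℂ _
  have hc : IsCompactOperator ((M.rep φ).codRestrict (localized M U) hmem) :=
    isCompactOperator_of_locallyCompactSpace_dom _
  exact hc.clm_comp (localized M U).subtypeL

end Localized
/-! ### Quadratic partitions of unity -/

section Partition

variable {X : Type*} [MetricSpace X] [ProperSpace X]

/-- There is a countable locally finite partition of unity by squares of compactly supported
functions with supports in balls of a given radius. -/
theorem exists_quadratic_partition [Nonempty X] {a : ℝ} (ha : 0 < a) :
    ∃ (x : ℕ → X) (φ : ℕ → C₀(X, ℂ)), (∀ k z, φ k z ≠ 0 → dist z (x k) < a) ∧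
      (∀ k, star (φ k) = φ k) ∧ (∀ N z, ‖(∑ k ∈ Finset.range N, φ k * φ k) z‖ ≤ 1) ∧
      ∀ K, IsCompact K → ∀ᶠ N in atTop, ∀ z ∈ K, (∑ k ∈ Finset.range N, φ k * φ k) z = 1 := by
  -- The `a`-balls around a dense sequence cover `X`, giving a partition of unity indexed by `ℕ`;
  -- the `φ k` are the square roots of its members.
  obtain ⟨x, hx⟩ := TopologicalSpace.exists_dense_seq X
  obtain ⟨P, hP⟩ := PartitionOfUnity.exists_isSubordinate isClosed_univ
    (fun k => Metric.ball (x k) a) (fun _ => Metric.isOpen_ball) fun z _ => by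
      obtain ⟨k, hk⟩ := hx.exists_dist_lt z ha
      exact mem_iUnion.2 ⟨k, hk⟩
  have hcont : ∀ k, Continuous fun z => ((Real.sqrt (P k z) : ℝ) : ℂ) := fun k => by
    fun_prop
  have hzero : ∀ k z, P k z = 0 → ((Real.sqrt (P k z) : ℝ) : ℂ) = 0 := fun k z h => by
    rw [h, Real.sqrt_zero, Complex.ofReal_zero]
  have hsub : ∀ k, Function.support (fun z => ((Real.sqrt (P k z) : ℝ) : ℂ)) ⊆
      Metric.ball (x k) a := fun k z hz =>
    hP k (subset_tsupport _ fun h => hz (hzero k z h))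
  have hcs : ∀ k, HasCompactSupport fun z => ((Real.sqrt (P k z) : ℝ) : ℂ) := fun k =>
    HasCompactSupport.of_support_subset_isCompact (isCompact_closedBall (x k) a)
      ((hsub k).trans Metric.ball_subset_closedBall)
  let φ : ℕ → C₀(X, ℂ) := fun k => ⟨⟨_, hcont k⟩, (hcs k).is_zero_at_infty⟩
  have hφ : ∀ k z, φ k z = ((Real.sqrt (P k z) : ℝ) : ℂ) := fun _ _ => rfl
  have hsum : ∀ N z, (∑ k ∈ Finset.range N, φ k * φ k) z =
      ((∑ k ∈ Finset.range N, P k z : ℝ) : ℂ) := fun N z => by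
    induction N with
    | zero => simp
    | succ N ih =>
      rw [Finset.sum_range_succ, Finset.sum_range_succ, ZeroAtInftyContinuousMap.add_apply, ih,
        ZeroAtInftyContinuousMap.mul_apply, hφ, ← Complex.ofReal_mul,
        Real.mul_self_sqrt (P.nonneg N z), Complex.ofReal_add]
  refine ⟨x, φ, fun k z hz => hsub k hz, fun k => ?_, fun N z => ?_, fun K hK => ?_⟩
  · ext z
    change (starRingEnd ℂ) _ = _
    rw [hφ, Complex.conj_ofReal]
  · rw [hsum, Complex.norm_real, Real.norm_eq_abs,
      abs_of_nonneg (Finset.sum_nonneg fun k _ => P.nonneg k z)]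
    have hfin : (Function.support fun k => P k z).Finite := P.locallyFinite.point_finite z
    calc ∑ k ∈ Finset.range N, P k z
        ≤ ∑ k ∈ Finset.range N ∪ hfin.toFinset, P k z :=
          Finset.sum_le_sum_of_subset_of_nonneg Finset.subset_union_left
            fun k _ _ => P.nonneg k z
      _ = ∑ᶠ k, P k z := (finsum_eq_sum_of_support_subset _ (by
          rw [Finset.coe_union, hfin.coe_toFinset]; exact subset_union_right)).symm
      _ ≤ 1 := P.sum_le_one z
  -- Only finitely many members meet `K`, so past their largest index the partial sum is the whole
  -- sum.
  · have hfin := P.locallyFinite.finite_nonempty_inter_compact hK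
    obtain ⟨N₀, hN₀⟩ := hfin.bddAbove
    filter_upwards [eventually_gt_atTop N₀] with N hN z hz
    rw [hsum, ← finsum_eq_sum_of_support_subset, P.sum_eq_one (mem_univ z), Complex.ofReal_one]
    intro k hk
    rw [Finset.coe_range, mem_Iio]
    exact (hN₀ ⟨z, hk, hz⟩).trans_lt hN

variable {H : Type*} [NormedAddCommGroup H] [InnerProductSpace ℂ H] [CompleteSpace H]

theorem norm_rep_le_of_forall {M : AmpleModule X H} {φ : C₀(X, ℂ)} {C : ℝ} (hC : 0 ≤ C)
    (h : ∀ z, ‖φ z‖ ≤ C) : ‖M.rep φ‖ ≤ C := by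
  refine (norm_rep_le φ).trans ?_
  rw [← ZeroAtInftyContinuousMap.norm_toBCF_eq_norm, BoundedContinuousFunction.norm_le hC]
  exact h

/-- A bounded sequence of functions that is eventually `1` on each compact set acts as an
approximate unit. -/
theorem tendsto_rep_apply (M : AmpleModule X H) {s : ℕ → C₀(X, ℂ)}
    (hs : ∀ N z, ‖s N z‖ ≤ 1)
    (h1 : ∀ K, IsCompact K → ∀ᶠ N in atTop, ∀ z ∈ K, s N z = 1) (v : H) :
    Tendsto (fun N => M.rep (s N) v) atTop (𝓝 v) := by
  let S : Submodule ℂ H :=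
    { carrier := {v | Tendsto (fun N => M.rep (s N) v) atTop (𝓝 v)}
      add_mem' := fun {v w} hv hw => by
        simpa only [mem_ofPred_eq, map_add] using hv.add hw
      zero_mem' := by simp
      smul_mem' := fun c v hv => by
        simpa only [mem_ofPred_eq, map_smul] using hv.const_smul c }
  have hS : ∀ v, v ∈ S ↔ Tendsto (fun N => M.rep (s N) v) atTop (𝓝 v) := fun _ => Iff.rfl
  have hmem : ∀ (h : C₀(X, ℂ)) (w : H), HasCompactSupport h → M.rep h w ∈ S := by
    intro h w hh
    rw [hS]
    refine tendsto_const_nhds.congr' ?_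
    filter_upwards [h1 _ hh] with N hN
    have e : s N * h = h := by
      ext z
      change s N z * h z = h z
      by_cases hz : z ∈ tsupport h
      · rw [hN z hz, one_mul]
      · rw [image_eq_zero_of_notMem_tsupport hz, mul_zero]
    have e' : M.rep (s N) (M.rep h w) = M.rep (s N * h) w := by rw [map_mul]; rfl
    rw [e', e]
  -- If `w` is orthogonal to `S`, then `‖h w‖² = ⟪h* h w, w⟫ = 0` for every compactly supported `h`,
  -- so `w = 0`. Convergence passes from `S` to its closure because the operators are uniformly
  -- bounded by `1`.
  have hdense : S.topologicalClosure = ⊤ := by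
    rw [Submodule.topologicalClosure_eq_top_iff, Submodule.eq_bot_iff]
    intro w hw
    refine eq_zero_of_rep (MX := M) fun h hh => ?_
    have h2 : HasCompactSupport (star h : C₀(X, ℂ)) :=
      hh.comp_left (g := star) (star_zero ℂ)
    have h3 := (Submodule.mem_orthogonal S w).1 hw _ (hmem (star h) (M.rep h w) h2)
    rw [← adjoint_rep, ContinuousLinearMap.adjoint_inner_left] at h3
    exact inner_self_eq_zero.1 h3
  have hv : v ∈ closure (S : Set H) := by
    have : v ∈ S.topologicalClosure := by rw [hdense]; trivial
    exact this
  rw [Metric.tendsto_atTop]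
  intro ε hε
  obtain ⟨u, hu, hvu⟩ := Metric.mem_closure_iff.1 hv (ε / 3) (by positivity)
  obtain ⟨N₀, hN₀⟩ := Metric.tendsto_atTop.1 ((hS u).1 hu) (ε / 3) (by positivity)
  refine ⟨N₀, fun N hN => ?_⟩
  have h4 : dist (M.rep (s N) v) (M.rep (s N) u) ≤ dist v u := by
    rw [dist_eq_norm, dist_eq_norm, ← map_sub]
    calc ‖M.rep (s N) (v - u)‖ ≤ ‖M.rep (s N)‖ * ‖v - u‖ := ContinuousLinearMap.le_opNorm _ _
      _ ≤ 1 * ‖v - u‖ := by gcongr; exact norm_rep_le_of_forall zero_le_one (hs N)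
      _ = _ := one_mul _
  calc dist (M.rep (s N) v) v
      ≤ dist (M.rep (s N) v) (M.rep (s N) u) + dist (M.rep (s N) u) u + dist u v :=
        dist_triangle4 _ _ _ _
    _ < ε := by rw [dist_comm u v]; linarith [hN₀ N hN]

/-- The isometry `v ↦ (φₖ v)ₖ` given by a quadratic partition of unity. -/
theorem exists_partition_isometry (M : AmpleModule X H) {φ : ℕ → C₀(X, ℂ)}
    (hstar : ∀ k, star (φ k) = φ k) (hle : ∀ N z, ‖(∑ k ∈ Finset.range N, φ k * φ k) z‖ ≤ 1)
    (h1 : ∀ K, IsCompact K → ∀ᶠ N in atTop, ∀ z ∈ K,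
      (∑ k ∈ Finset.range N, φ k * φ k) z = 1) :
    ∃ D : H →ₗᵢ[ℂ] lp (fun _ : ℕ => H) 2, ∀ v k, D v k = M.rep (φ k) v := by
  have hsum : ∀ v, HasSum (fun k => ‖M.rep (φ k) v‖ ^ 2) (‖v‖ ^ 2) := by
    intro v
    rw [hasSum_iff_tendsto_nat_of_nonneg fun k => by positivity]
    -- The partial sums of `∑ ‖φₖ v‖²` are `⟪v, (∑ φₖ²) v⟫`, and the sums `∑ φₖ²` act as an
    -- approximate unit.
    have h2 : ∀ N, ∑ k ∈ Finset.range N, ‖M.rep (φ k) v‖ ^ 2 =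
        RCLike.re ⟪v, M.rep (∑ k ∈ Finset.range N, φ k * φ k) v⟫_ℂ := by
      intro N
      rw [map_sum, sum_apply, inner_sum, map_sum]
      refine Finset.sum_congr rfl fun k _ => ?_
      have e : M.rep (φ k * φ k) v =
          ContinuousLinearMap.adjoint (M.rep (φ k)) (M.rep (φ k) v) := by
        rw [adjoint_rep, hstar, map_mul]; rfl
      rw [e, ContinuousLinearMap.adjoint_inner_right, inner_self_eq_norm_sq]
    have h3 : ‖v‖ ^ 2 = RCLike.re ⟪v, v⟫_ℂ := (inner_self_eq_norm_sq v).symm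
    simp only [h2, h3]
    exact (RCLike.continuous_re.tendsto _).comp
      (tendsto_const_nhds.inner (tendsto_rep_apply M hle h1 v))
  have hmem : ∀ v, Memℓp (fun k => M.rep (φ k) v) 2 := fun v =>
    memℓp_gen (by simpa using (hsum v).summable)
  let D : H →ₗ[ℂ] lp (fun _ : ℕ => H) 2 :=
    { toFun := fun v => ⟨fun k => M.rep (φ k) v, hmem v⟩
      map_add' := fun v w => by
        ext k
        exact map_add (M.rep (φ k)) v w
      map_smul' := fun c v => by
        ext k
        exact map_smul (M.rep (φ k)) c v }
  refine ⟨⟨D, fun v => ?_⟩, fun v k => rfl⟩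
  have h4 : HasSum (fun k => ‖D v k‖ ^ 2) (‖D v‖ ^ 2) := by
    simpa using lp.hasSum_norm (p := 2) (by simp) (D v)
  exact (sq_eq_sq₀ (norm_nonneg _) (norm_nonneg _)).1 (h4.unique (hsum v))

end Partition

/-! ### Existence of covers -/

section Covers

variable {X Y : Type*} [MetricSpace X] [MetricSpace Y] [ProperSpace X] [ProperSpace Y]
  {HX HY : Type*}
  [NormedAddCommGroup HX] [InnerProductSpace ℂ HX] [CompleteSpace HX]
  [NormedAddCommGroup HY] [InnerProductSpace ℂ HY] [CompleteSpace HY]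

/-- The isometry is `V = ∑ Vₖ φₖ` as in the introduction. If `(y, z)` is in its support, some `k`
has `xₖ` near `z` and `f(xₖ)` near `y`, and the Lipschitz bound then puts `y` near `f(z)`. -/
theorem exists_isCover [Nonempty X] [TopologicalSpace.SeparableSpace HX]
    (MX : AmpleModule X HX) (MY : AmpleModule Y HY) {f : X → Y} {c : ℝ≥0}
    (hf : LipschitzWith c f) {δ : ℝ} (hδ : 0 < δ) :
    ∃ V : HX →ₗᵢ[ℂ] HY, IsCover MX MY f δ V := by
  -- Points of one `φ`-support near `z` lie within `2a` of each other's centres, which costs `2ac ≤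
  -- δ/2` in `Y`; two radii `δ/4` use up the rest of `δ`. The `+ 1` covers `c = 0`.
  set a : ℝ := δ / (4 * (c + 1)) with ha_def
  have ha : 0 < a := by positivity
  have hca : c * (2 * a) ≤ δ / 2 := by
    have h1 : (4 * ((c : ℝ) + 1)) * a = δ := by rw [ha_def]; field_simp
    nlinarith
  obtain ⟨x, φ, hsupp, hstar, hle, h1⟩ := exists_quadratic_partition (X := X) ha
  obtain ⟨D, hD⟩ := exists_partition_isometry MX hstar hle h1
  obtain ⟨V, hV, hVL⟩ := exists_orthogonalFamily (H := HX)
    (fun k => localized MY (Metric.ball (f (x k)) (δ / 4)))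
    (fun k => not_finiteDimensional_localized MY Metric.isOpen_ball
      ⟨f (x k), Metric.mem_ball_self (by positivity)⟩)
    (fun k => isClosed_localized MY _)
  refine ⟨hV.linearIsometry.comp D, fun y z hyz => ?_⟩
  by_contra! hcon
  obtain ⟨χ, -, hχU, -, W, -, hzW, hχW⟩ := exists_cutoff (isCompact_singleton (x := z))
    Metric.isOpen_ball (singleton_subset_iff.2 (Metric.mem_ball_self ha))
  obtain ⟨ψ, -, hψU, -, W', -, hyW', hψW'⟩ := exists_cutoff (isCompact_singleton (x := y))
    Metric.isOpen_ball
    (singleton_subset_iff.2 (Metric.mem_ball_self (show 0 < δ / 4 by positivity)))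
  refine notMem_opSupport.2 ⟨χ, ψ, ?_, ?_, ?_⟩ hyz
  · ext v
    have hsum := (hV.hasSum_linearIsometry (D (MX.rep χ v))).mapL (MY.rep ψ)
    refine hsum.unique ?_
    convert! hasSum_zero using 1
    funext k
    rw [hD]
    have hk : MX.rep (φ k) (MX.rep χ v) = MX.rep (φ k * χ) v := by rw [map_mul]; rfl
    -- Each term `ψ Vₖ φₖ χ` vanishes: either `φₖ χ = 0`, or `xₖ` is close to `z` and then `ψ` is
    -- zero on the ball around `f(xₖ)`, since otherwise `dist y (f z) < δ`.
    by_cases h0 : φ k * χ = 0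
    · rw [hk, h0]; simp
    · refine hVL k _ ψ fun y' hy' => ?_
      by_contra hψ
      have hy'' : dist y' y < δ / 4 := hψU (subset_tsupport _ hψ)
      obtain ⟨z', hz'⟩ : ∃ z', φ k z' * χ z' ≠ 0 := by
        by_contra! hall
        exact h0 (ZeroAtInftyContinuousMap.ext hall)
      have hz1 := hsupp k z' (left_ne_zero_of_mul hz')
      have hz2 : dist z' z < a := hχU (subset_tsupport _ (right_ne_zero_of_mul hz'))
      have hz3 : dist (x k) z ≤ 2 * a := by
        have := dist_triangle_left (x k) z z'
        linarith
      have h5 : dist (f (x k)) (f z) ≤ δ / 2 :=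
        (hf.dist_le_mul _ _).trans (le_trans (by gcongr) hca)
      have h6 : dist y' (f (x k)) < δ / 4 := hy'
      have h7 := dist_triangle y (f (x k)) (f z)
      have h8 := dist_triangle_left y (f (x k)) y'
      linarith
  · rw [hχW z (hzW rfl)]; simp
  · rw [hψW' y (hyW' rfl)]; simp

end Covers

/-! ### Maps along a strong Lipschitz homotopy -/

section Homotopy

variable {X Y : Type*} [MetricSpace X] [MetricSpace Y] [ProperSpace Y]

/-- Bounded sets in the proper space `Y` have compact closure, and a proper map pulls compact sets
back to compact sets. -/
theorem isCoarseMap_of_lipschitzWith {f : X → Y} {c : ℝ≥0} (hf : LipschitzWith c f)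
    (hp : IsProperMap f) : IsCoarseMap f where
  borel := by
    borelize X Y
    exact hf.continuous.measurable
  expansion_lt_top r _ := (expansion_le hf r).trans_lt ENNReal.ofReal_lt_top
  isBounded_preimage K hK :=
    (hp.isCompact_preimage hK.isCompact_closure).isBounded.subset (preimage_mono subset_closure)

/-- A strong Lipschitz homotopy can be subdivided into steps of size at most `δ`. -/
theorem IsStrongLipschitzHomotopy.exists_subdivision {F : unitInterval × X → Y} {f g : X → Y}
    {c : ℝ≥0} (hF : IsStrongLipschitzHomotopy F f g c) {δ : ℝ} (hδ : 0 < δ) :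
    ∃ (N : ℕ) (t : ℕ → unitInterval), t 0 = 0 ∧ t N = 1 ∧
      ∀ k x, dist (F (t k, x)) (F (t (k + 1), x)) ≤ δ := by
  obtain ⟨η, hη, h⟩ := Metric.uniformEquicontinuous_iff.1 hF.equicontinuous δ hδ
  -- Consecutive points share a ball of radius `η/2`, so they are less than `η` apart.
  obtain ⟨t, ht0, hmono, ⟨N, hN⟩, ht⟩ := exists_monotone_Icc_subset_open_cover_unitInterval
    (c := fun s : unitInterval => Metric.ball s (η / 2)) (fun _ => Metric.isOpen_ball)
    fun s _ => mem_iUnion.2 ⟨s, Metric.mem_ball_self (by positivity)⟩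
  refine ⟨N, t, ht0, hN N le_rfl, fun k x => (h _ _ ?_ x).le⟩
  obtain ⟨s, hs⟩ := ht k
  have h1 : dist (t k) s < η / 2 := hs ⟨le_rfl, hmono k.le_succ⟩
  have h2 : dist (t (k + 1)) s < η / 2 := hs ⟨hmono k.le_succ, le_rfl⟩
  linarith [dist_triangle_right (t k) (t (k + 1)) s]

end Homotopy

end ControlledK

/-! ### Chaining the steps of the homotopy -/

theorem theorem4p2
    {X Y : Type*} [MetricSpace X] [ProperSpace X] [MetricSpace Y] [ProperSpace Y]
    {HX HY : Type*}
    [NormedAddCommGroup HX] [InnerProductSpace ℂ HX] [CompleteSpace HX]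
    [TopologicalSpace.SeparableSpace HX]
    [NormedAddCommGroup HY] [InnerProductSpace ℂ HY] [CompleteSpace HY]
    [TopologicalSpace.SeparableSpace HY]
    (MX : AmpleModule X HX) (MY : AmpleModule Y HY)
    (f g : X → Y) (hf : IsCoarseMap f) (hg : IsCoarseMap g)
    (F : unitInterval × X → Y) (c : ℝ≥0) (hF : IsStrongLipschitzHomotopy F f g c)
    (δ : ℝ) (hδ : 0 < δ) (Vf Vg : HX →ₗᵢ[ℂ] HY)
    (hVf : IsCover MX MY f δ Vf) (hVg : IsCover MX MY g δ Vg)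
    (ε r : ℝ) (hε : 0 < ε) (hε' : 21 * ε < 1 / 4) (hr : 0 < r) :
    (adK0 hf hVf hδ hF.lipschitz_left hε hr :
        K0 (roeFiltration MX) ε r → K0 (roeFiltration MY) (21 * ε) (5 * (c * r + 2 * δ))) =
      adK0 hg hVg hδ hF.lipschitz_right hε hr ∧
    (adK1 hf hVf hδ hF.lipschitz_left hε hr :
        K1 (roeFiltration MX) ε r → K1 (roeFiltration MY) (21 * ε) (5 * (c * r + 2 * δ))) =
      adK1 hg hVg hδ hF.lipschitz_right hε hr := by
  obtain ⟨N, t, ht0, htN, ht⟩ := hF.exists_subdivision hδ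
  have hcoarse : ∀ s, IsCoarseMap fun x => F (s, x) := fun s =>
    isCoarseMap_of_lipschitzWith (hF.lipschitz s) (hF.proper s)
  have hcover : ∀ s, ∃ V : HX →ₗᵢ[ℂ] HY, IsCover MX MY (fun x => F (s, x)) δ V := fun s => by
    rcases isEmpty_or_nonempty X with hX | hX
    -- Over an empty `X` the covering condition is vacuous, so any isometry will do.
    · exact ⟨Vf, fun _ x => isEmptyElim x⟩
    · exact exists_isCover MX MY (hF.lipschitz s) hδ
  -- Quantifying over all covers `W` of the intermediate map lets the induction use any chosen
  -- cover. The case `k = 0`, at distance zero, is independence of the cover of `f`; the end of the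
  -- chain does the same for `g`.
  have key : ∀ k (W : HX →ₗᵢ[ℂ] HY) (hW : IsCover MX MY (fun x => F (t k, x)) δ W),
      adK0 hf hVf hδ hF.lipschitz_left hε hr =
          adK0 (hcoarse (t k)) hW hδ (hF.lipschitz (t k)) hε hr ∧
        adK1 hf hVf hδ hF.lipschitz_left hε hr =
          adK1 (hcoarse (t k)) hW hδ (hF.lipschitz (t k)) hε hr := by
    intro k
    induction k with
    | zero =>
      intro W hW
      refine adK_eq_of_dist_le hf (hcoarse _) hVf hW hδ (fun x => ?_) _ _ hε (by linarith) hr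
      rw [ht0, hF.map_zero, dist_self]
      exact hδ.le
    | succ k ih =>
      intro W hW
      obtain ⟨W', hW'⟩ := hcover (t k)
      have h1 := ih W' hW'
      have h2 := adK_eq_of_dist_le (hcoarse (t k)) (hcoarse (t (k + 1))) hW' hW hδ (ht k)
        (hF.lipschitz _) (hF.lipschitz _) hε (by linarith) hr
      exact ⟨h1.1.trans h2.1, h1.2.trans h2.2⟩
  obtain ⟨W, hW⟩ := hcover (t N)
  have h1 := key N W hW
  have h2 := adK_eq_of_dist_le (hcoarse (t N)) hg hW hVg hδ (fun x => by
    rw [htN, hF.map_one, dist_self]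
    exact hδ.le) (hF.lipschitz _) hF.lipschitz_right hε (by linarith) hr
  exact ⟨h1.1.trans h2.1, h1.2.trans h2.2⟩
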